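/- For $s\ge 0$ let $\phi_s(r)=\sqrt{s^2+r^2}$, and let $\widehat f(\xi)=\int_{\mathbb R^5}f(x)e^{-ix\cdot\xi}\,dx$ (extended to tempered distributions). Let $X_s$ be the space of functions $f$ on $\mathbb R^5$ whose (distributional) Fourier transform is a function with $\phi_s(|\xi|)\widehat f(\xi)\in L^2(\mathbb R^5)$; thus $X_s=H^1(\mathbb R^5)$ for $s>0$ and $X_0=\dot H^1(\mathbb R^5)$. For $f\in X_s$ let $e^{it\phi_s(\sqrt{-\Delta})}f$ be the function with spatial Fourier transform $e^{it\phi_s(|\xi|)}\widehat f(\xi)$, let $\phi_s(\sqrt{-\Delta})^{\beta}$ be the Fourier multiplier with symbol $\phi_s(|\xi|)^{\beta}$, and let $$\|f\|_{(s)}=\Big(\|\phi_s(\sqrt{-\Delta})f\|_{L^2(\mathbb R^5)}^4-s^2\|\phi_s(\sqrt{-\Delta})^{1/2}f\|_{L^2(\mathbb R^5)}^4\Big)^{1/4}$$ (for $s=0$ the second term is absent). (i) For every $s\ge0$ and $f\in X_s$, $$\|e^{it\phi_s(\sqrt{-\Delta})}f\|_{L^4(\mathbb R^{5+1})}\le\Big(\frac1{24\pi^2}\Big)^{1/4}\|f\|_{(s)},$$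 and the constant is the smallest possible. (ii) For $a>0$ let $f_a$ be given by $\widehat{f_a}(\xi)=e^{-a\phi_s(|\xi|)}/\phi_s(|\xi|)$, and let $g_a=f_a/\|f_a\|_{(s)}$. Then $g_a\in X_s$, $\|g_a\|_{(s)}=1$, and $\|e^{it\phi_s(\sqrt{-\Delta})}g_a\|_{L^4(\mathbb R^{5+1})}\to(1/(24\pi^2))^{1/4}$ as $a\to0+$. (iii) If $s>0$, there is no $f\in X_s$, other than $f=0$, for which equality holds in (i). (iv) For $s=1$, with $\|f\|_{H^m}=\|(1-\Delta)^{m/2}f\|_{L^2(\mathbb R^5)}$, one has for all $f\in H^1(\mathbb R^5)$ $$\|e^{it\sqrt{1-\Delta}}f\|_{L^4(\mathbb R^{5+1})}\le\Big(\frac1{24\pi^2}\Big)^{1/4}\big(\|f\|_{H^1}^4-\|f\|_{H^{1/2}}^4\big)^{1/4}\quad\text{and}\quad\|e^{it\sqrt{1-\Delta}}f\|_{L^4(\mathbb R^{5+1})}\le\Big(\frac1{24\pi^2}\Big)^{1/4}\|f\|_{H^1},$$ and in each of these two estimates the constant is the smallest possible. -/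

import Mathlib

open MeasureTheory Filter Topology
open scoped SchwartzMap ENNReal

namespace KleinGordon

/-- Five-dimensional Euclidean space. -/
abbrev E : Type := EuclideanSpace ℝ (Fin 5)

/-- `φ_s(r) = √(s² + r²)`. -/
noncomputable def phi (s r : ℝ) : ℝ := Real.sqrt (s ^ 2 + r ^ 2)

/-- The Fourier integral `∫ f(x) e^{-i x·ξ} dx` (used on Schwartz functions). -/
noncomputable def fourierIntegral (f : E → ℂ) (ξ : E) : ℂ :=
  ∫ x, f x * Complex.exp (-(Complex.I * ((inner ℝ x ξ : ℝ) : ℂ)))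

/-- The function `g` is the Fourier transform of the function `f` in the sense of tempered
distributions: both define tempered distributions by integration, and
`⟨g, ψ⟩ = ⟨f, ψ^⟩` for all Schwartz functions `ψ`. -/
def IsFourierTransform (f g : E → ℂ) : Prop :=
  ∀ ψ : 𝓢(E, ℂ),
    Integrable (fun x => f x * ψ x) ∧ Integrable (fun ξ => g ξ * ψ ξ) ∧
      ∫ ξ, g ξ * ψ ξ = ∫ x, f x * fourierIntegral ψ x

/-- The Fourier transform of `f` (unique up to null sets when it exists as a function). -/
noncomputable def hat (f : E → ℂ) : E → ℂ :=
  Classical.epsilon (fun g => IsFourierTransform f g)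

/-- The Fourier multiplier operator with symbol `m`: the function (unique up to null sets)
whose Fourier transform is `m · hat f`. -/
noncomputable def multiplier (m : E → ℂ) (f : E → ℂ) : E → ℂ :=
  Classical.epsilon (fun w => IsFourierTransform w (fun ξ => m ξ * hat f ξ))

/-- `‖φ_s(√-Δ)^β f‖_{L²}`. -/
noncomputable def phiNorm (s β : ℝ) (f : E → ℂ) : ℝ :=
  (eLpNorm (multiplier (fun ξ => ((phi s ‖ξ‖ ^ β : ℝ) : ℂ)) f) 2 volume).toReal

/-- `‖f‖_{(s)} = (‖φ_s(√-Δ) f‖_{L²}⁴ - s² ‖φ_s(√-Δ)^{1/2} f‖_{L²}⁴)^{1/4}`. -/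
noncomputable def sNorm (s : ℝ) (f : E → ℂ) : ℝ :=
  (phiNorm s 1 f ^ 4 - s ^ 2 * phiNorm s (1 / 2) f ^ 4) ^ (1 / 4 : ℝ)

/-- The inhomogeneous Sobolev norm `‖f‖_{H^m} = ‖(1 - Δ)^{m/2} f‖_{L²}`. -/
noncomputable def sobolevNorm (m : ℝ) (f : E → ℂ) : ℝ :=
  (eLpNorm (multiplier (fun ξ => (((1 + ‖ξ‖ ^ 2) ^ (m / 2) : ℝ) : ℂ)) f) 2 volume).toReal

/-- The data space: functions `f` with a Fourier transform `hat f` that is a function with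
`φ_s(|ξ|) hat f(ξ)` in `L²`. This is `H¹` for `s > 0`, and the homogeneous `Ḣ¹` for `s = 0`. -/
def energySpace (s : ℝ) : Set (E → ℂ) :=
  {f | IsFourierTransform f (hat f) ∧
    MemLp (fun ξ => ((phi s ‖ξ‖ : ℝ) : ℂ) * hat f ξ) 2 volume}

/-- `u(t, x)` is (a space-time measurable version of) `e^{itφ_s(√-Δ)} f (x)`: for almost every
time its spatial Fourier transform is `e^{itφ_s(|ξ|)} hat f(ξ)`. -/
def IsEvolution (s : ℝ) (f : E → ℂ) (u : ℝ × E → ℂ) : Prop :=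
  AEStronglyMeasurable u volume ∧
    ∀ᵐ t : ℝ, IsFourierTransform (fun x => u (t, x))
      (fun ξ => Complex.exp (Complex.I * ((t * phi s ‖ξ‖ : ℝ) : ℂ)) * hat f ξ)

/-- The space-time function `(t, x) ↦ e^{itφ_s(√-Δ)} f (x)` (unique up to null sets). -/
noncomputable def evolution (s : ℝ) (f : E → ℂ) : ℝ × E → ℂ :=
  Classical.epsilon (fun u => IsEvolution s f u)

/-- `e^{-aφ_s(|ξ|)} / φ_s(|ξ|)`. -/
noncomputable def faHat (s a : ℝ) (ξ : E) : ℂ :=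
  ((Real.exp (-(a * phi s ‖ξ‖)) / phi s ‖ξ‖ : ℝ) : ℂ)

/-- The function `f_a` with Fourier transform `e^{-aφ_s(|ξ|)} / φ_s(|ξ|)`, given by the inverse
Fourier integral. -/
noncomputable def fa (s a : ℝ) (x : E) : ℂ :=
  (1 / (2 * Real.pi) ^ 5 : ℝ) *
    ∫ ξ, faHat s a ξ * Complex.exp (Complex.I * ((inner ℝ x ξ : ℝ) : ℂ))

/-- The normalised function `g_a = f_a / ‖f_a‖_{(s)}`. -/
noncomputable def ga (s a : ℝ) (x : E) : ℂ := fa s a x / ((sNorm s (fa s a) : ℝ) : ℂ)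

/-- The constant `(1 / (24 π²))^{1/4}`. -/
noncomputable def sharpConst : ℝ := (1 / (24 * Real.pi ^ 2)) ^ (1 / 4 : ℝ)

end KleinGordon

/-! The square of the wave is a superposition of plane waves indexed by pairs of frequencies,
`freeWave_sq_eq`, and the phase depends on a pair only through its total energy and momentum (τ, ξ).
The measure dy₁dy₂/(φ_s(|y₁|)φ_s(|y₂|)) pushes forward under the total to an explicit absolutely
continuous measure, whose density is a function of τ² − |ξ|² alone (`lintegral_totalMomentum`). With
P = φ_s(|y₁|)φ_s(|y₂|) − y₁·y₂ one has τ² − |ξ|² = 2P + 2s², and the density at the total of a pair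
is w = (2π²/3)(P − s²)√((P − s²)/(P + s²)).

Testing u² against a function Ψ, applying Cauchy-Schwarz with weight φφw on pairs
(`sq_lintegral_comp_totalMomentum_le`) and Plancherel on space-time bounds ‖u‖₄⁴ by (2π)⁻¹⁴ ∫∫
|F(y₁)F(y₂)|² φφw, where F is the frequency profile. For F = e^{-aφ}/φ the product F(y₁)F(y₂) is
1/(φφ) times a function of the total energy; then u² is itself a space-time Fourier transform and
this bound is an equality (`lintegral_freeWave_faHat`).

It remains to compare the kernel with polynomials in P. Bounding the square root by 1 leaves P − s²,
and the double integral of |FF|²φφ(P − s²) factorises into A² − B² − |V|², with A the energy, B the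
charge weighted by s, and V the momentum. Dropping |V|² gives exactly the norm on the right of (i).
For s > 0 the root is strictly less than 1, and P > s² off the diagonal, so a nonzero F never
attains equality.

For sharpness, the kernel is also at least (2π²/3)(P − 3s²). The exponential profiles are even, so V
= 0, and the quotient of the two sides in fourth powers lies between (A² − 3B²)/(A² − B²) and 1. As
a → 0+ the energy A moves to high frequencies, where s/φ_s is small, so B/A → 0
(`tendsto_chargeRatio`). The same limit shows that the full energy norm of the normalised profiles
tends to 1, which gives the second estimate in (iv) with the same constant.

General data in the energy space are reached by truncating in frequency: a cruder bound makes the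
truncated waves Cauchy in L⁴, and the limit is identified with the evolution on almost every time
slice. -/

namespace KleinGordon
open scoped FourierTransform

/-! ### Testing against Schwartz functions, and Plancherel's theorem -/

section SchwartzTesting

variable {V : Type*} [NormedAddCommGroup V] [InnerProductSpace ℝ V]

/-- A smooth real-valued function with compact support, as a complex Schwartz function. -/
theorem exists_schwartz_eq_ofReal {g : V → ℝ} (hg : ContDiff ℝ (⊤ : ℕ∞) g)
    (hs : HasCompactSupport g) : ∃ ψ : 𝓢(V, ℂ), ∀ x, ψ x = (g x : ℂ) := by
  have h1 : HasCompactSupport (fun x => (g x : ℂ)) := hs.comp_left (g := Complex.ofReal) (by simp)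
  exact ⟨h1.toSchwartzMap (Complex.ofRealCLM.contDiff.comp hg), fun x => rfl⟩

variable [FiniteDimensional ℝ V] [MeasurableSpace V] [BorelSpace V]

/-- A bump function equal to 1 near the point serves as test function. Measurability of a function
known only through `IsFourierTransform` also comes from here. -/
theorem locallyIntegrable_of_forall_schwartz {f : V → ℂ}
    (h : ∀ ψ : 𝓢(V, ℂ), Integrable (fun x => f x * ψ x)) : LocallyIntegrable f := by
  intro x
  let b : ContDiffBump x := default
  obtain ⟨ψ, hψ⟩ := exists_schwartz_eq_ofReal b.contDiff b.hasCompactSupport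
  refine ⟨Metric.closedBall x b.rIn, Metric.closedBall_mem_nhds x b.rIn_pos, ?_⟩
  refine (h ψ).integrableOn.congr_fun (fun y hy => ?_) Metric.isClosed_closedBall.measurableSet
  simp [hψ, b.one_of_mem_closedBall hy]

/-- Two functions with the same integrals against Schwartz functions agree almost everywhere. -/
theorem ae_eq_of_forall_schwartz {f g : V → ℂ}
    (hf : ∀ ψ : 𝓢(V, ℂ), Integrable (fun x => f x * ψ x))
    (hg : ∀ ψ : 𝓢(V, ℂ), Integrable (fun x => g x * ψ x))
    (h : ∀ ψ : 𝓢(V, ℂ), ∫ x, f x * ψ x = ∫ x, g x * ψ x) : f =ᵐ[volume] g := by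
  refine ae_eq_of_integral_contDiff_smul_eq (locallyIntegrable_of_forall_schwartz hf)
    (locallyIntegrable_of_forall_schwartz hg) fun k hk hks => ?_
  obtain ⟨ψ, hψ⟩ := exists_schwartz_eq_ofReal hk hks
  have := h ψ
  simp only [hψ] at this
  simpa [mul_comm] using this

theorem integrable_mul_schwartz_of_memLp {f : V → ℂ} {p q : ℝ≥0∞} [p.HolderConjugate q]
    (hf : MemLp f p volume) (ψ : 𝓢(V, ℂ)) : Integrable (fun x => f x * ψ x) :=
  hf.integrable_mul (ψ.memLp q volume)

theorem integrable_mul_schwartz_of_bounded {f : V → ℂ} (hf : AEStronglyMeasurable f volume) {C : ℝ}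
    (hC : ∀ x, ‖f x‖ ≤ C) (ψ : 𝓢(V, ℂ)) : Integrable (fun x => f x * ψ x) :=
  ψ.integrable.bdd_mul hf (Eventually.of_forall hC)

theorem integrable_mul_schwartz_of_integrable {f : V → ℂ} (hf : Integrable f) (ψ : 𝓢(V, ℂ)) :
    Integrable (fun x => f x * ψ x) := by
  obtain ⟨C, hC⟩ := ψ.decay 0 0
  exact hf.mul_bdd ψ.continuous.aestronglyMeasurable (c := C)
    (Eventually.of_forall fun x => by simpa using hC.2 x)

theorem integral_fourier_mul_eq {f g : V → ℂ} (hf : Integrable f) (hg : Integrable g) :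
    ∫ ξ, 𝓕 f ξ * g ξ = ∫ x, f x * 𝓕 g x := by
  have := VectorFourier.integral_fourierIntegral_smul_eq_flip (μ := (volume : Measure V))
    (ν := (volume : Measure V)) (L := innerₗ V) Real.continuous_fourierChar continuous_inner hf hg
  rw [flip_innerₗ] at this
  exact this

theorem norm_fourier_le {f : V → ℂ} (ξ : V) : ‖𝓕 f ξ‖ ≤ ∫ x, ‖f x‖ :=
  VectorFourier.norm_fourierIntegral_le_integral_norm _ _ _ _ _

theorem continuous_fourier {f : V → ℂ} (hf : Integrable f) : Continuous (𝓕 f) :=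
  VectorFourier.fourierIntegral_continuous Real.continuous_fourierChar continuous_inner hf

/-- **Plancherel's theorem** for integrable square-integrable functions. -/
theorem eLpNorm_fourier_eq {f : V → ℂ} (hf : Integrable f) (hf2 : MemLp f 2 volume) :
    eLpNorm (𝓕 f) 2 volume = eLpNorm f 2 volume := by
  set F : Lp ℂ 2 (volume : Measure V) := hf2.toLp f with hF
  have hFf : F =ᵐ[volume] f := hf2.coeFn_toLp
  -- The abstract transform on `Lp` and the Fourier integral are identified as tempered
  -- distributions; the isometry of the former then transfers.
  have key : (𝓕 F : Lp ℂ 2 (volume : Measure V)) =ᵐ[volume] 𝓕 f := by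
    refine ae_eq_of_forall_schwartz
      (fun ψ => integrable_mul_schwartz_of_memLp (p := 2) (q := 2) (Lp.memLp _) ψ)
      (fun ψ => integrable_mul_schwartz_of_bounded
        (continuous_fourier hf).aestronglyMeasurable norm_fourier_le ψ) fun ψ => ?_
    have h1 := congrArg (fun T : 𝓢'(V, ℂ) => T ψ) (Lp.fourier_toTemperedDistribution_eq F)
    simp only [TemperedDistribution.fourier_apply, Lp.toTemperedDistribution_apply,
      smul_eq_mul] at h1
    calc ∫ x, (𝓕 F : Lp ℂ 2 (volume : Measure V)) x * ψ x
        = ∫ x, (𝓕 ψ) x * F x := by rw [h1]; simp only [mul_comm]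
      _ = ∫ x, f x * 𝓕 (ψ : V → ℂ) x := by
          refine integral_congr_ae ?_
          filter_upwards [hFf] with x hx
          rw [hx, mul_comm, SchwartzMap.fourier_coe]
      _ = ∫ x, 𝓕 f x * ψ x := (integral_fourier_mul_eq hf ψ.integrable).symm
  rw [← eLpNorm_congr_ae key, ← eLpNorm_congr_ae hFf, ← Lp.enorm_def, ← Lp.enorm_def]
  have := Lp.norm_fourier_eq F
  rw [← enorm_norm, this, enorm_norm]

end SchwartzTesting

/-! ### The Fourier transform with kernel `e^{-ix·ξ}` -/

theorem fourierIntegral_eq (f : E → ℂ) (ξ : E) :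
    fourierIntegral f ξ = 𝓕 f ((2 * Real.pi)⁻¹ • ξ) := by
  rw [fourierIntegral, Real.fourier_eq']
  refine integral_congr_ae (Eventually.of_forall fun x => ?_)
  simp only [smul_eq_mul, inner_smul_right]
  rw [mul_comm]
  congr 2
  have : (Real.pi : ℂ) ≠ 0 := by exact_mod_cast Real.pi_ne_zero
  push_cast
  field_simp

/-- Dilation by a nonzero factor, on Schwartz functions. -/
theorem exists_schwartz_comp_smul (χ : 𝓢(E, ℂ)) {c : ℝ} (hc : c ≠ 0) :
    ∃ ψ : 𝓢(E, ℂ), ∀ x, ψ x = χ (c • x) :=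
  ⟨SchwartzMap.compCLMOfContinuousLinearEquiv ℂ
    (ContinuousLinearEquiv.smulLeft (Units.mk0 c hc)) χ, fun _ => rfl⟩

theorem exists_schwartz_fourierIntegral (ψ : 𝓢(E, ℂ)) :
    ∃ χ : 𝓢(E, ℂ), ∀ x, fourierIntegral ψ x = χ x := by
  obtain ⟨χ, hχ⟩ := exists_schwartz_comp_smul (𝓕 ψ) (c := (2 * Real.pi)⁻¹) (by positivity)
  exact ⟨χ, fun _ => by rw [fourierIntegral_eq, hχ, SchwartzMap.fourier_coe]⟩

/-- Surjectivity of the transform on Schwartz space is what makes a function determined by its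
transform in `unique_left`. -/
theorem exists_fourierIntegral_eq_schwartz (χ : 𝓢(E, ℂ)) :
    ∃ ψ : 𝓢(E, ℂ), ∀ x, fourierIntegral ψ x = χ x := by
  obtain ⟨χ', hχ⟩ := exists_schwartz_comp_smul χ (c := 2 * Real.pi) (by positivity)
  refine ⟨𝓕⁻ χ', fun x => ?_⟩
  rw [fourierIntegral_eq, ← SchwartzMap.fourier_coe, FourierTransform.fourier_fourierInv_eq, hχ,
    smul_smul, mul_inv_cancel₀ (by positivity), one_smul]

theorem integral_comp_inv_two_pi_smul (f : E → ℂ) :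
    ∫ x, f ((2 * Real.pi)⁻¹ • x) = ((2 * Real.pi) ^ 5 : ℝ) * ∫ x, f x := by
  rw [Measure.integral_comp_smul]
  have : |(((2 * Real.pi)⁻¹ : ℝ) ^ 5)⁻¹| = (2 * Real.pi) ^ 5 := by
    rw [inv_pow, inv_inv, abs_of_pos (by positivity)]
  rw [finrank_euclideanSpace, Fintype.card_fin, this, Complex.real_smul]

namespace IsFourierTransform

variable {f f' g g' : E → ℂ}

theorem congr_right (h : IsFourierTransform f g) (hg : g =ᵐ[volume] g') :
    IsFourierTransform f g' := fun ψ => by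
  have hψ : (fun ξ => g ξ * ψ ξ) =ᵐ[volume] fun ξ => g' ξ * ψ ξ := by
    filter_upwards [hg] with ξ hξ using by rw [hξ]
  exact ⟨(h ψ).1, (h ψ).2.1.congr hψ, by rw [← integral_congr_ae hψ, (h ψ).2.2]⟩

theorem unique_right (h : IsFourierTransform f g) (h' : IsFourierTransform f g') :
    g =ᵐ[volume] g' :=
  ae_eq_of_forall_schwartz (fun ψ => (h ψ).2.1) (fun ψ => (h' ψ).2.1)
    fun ψ => (h ψ).2.2.trans (h' ψ).2.2.symm

theorem unique_left (h : IsFourierTransform f g) (h' : IsFourierTransform f' g) :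
    f =ᵐ[volume] f' := by
  refine ae_eq_of_forall_schwartz (fun ψ => (h ψ).1) (fun ψ => (h' ψ).1) fun χ => ?_
  obtain ⟨ψ, hψ⟩ := exists_fourierIntegral_eq_schwartz χ
  have h1 := (h ψ).2.2
  rw [(h' ψ).2.2] at h1
  simpa only [hψ] using h1.symm

theorem aestronglyMeasurable_right (h : IsFourierTransform f g) :
    AEStronglyMeasurable g volume :=
  (locallyIntegrable_of_forall_schwartz fun ψ => (h ψ).2.1).aestronglyMeasurable

theorem const_mul (h : IsFourierTransform f g) (c : ℂ) :
    IsFourierTransform (fun x => c * f x) (fun ξ => c * g ξ) := fun ψ => by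
  simp only [mul_assoc, integral_const_mul]
  exact ⟨(h ψ).1.const_mul c, (h ψ).2.1.const_mul c, by rw [(h ψ).2.2]⟩

theorem zero : IsFourierTransform 0 0 := fun ψ => by simp

/-- The choice made by `Classical.epsilon` is pinned down only up to null sets, so every explicit
transform enters later through this almost everywhere equality. -/
theorem hat_ae_eq (h : IsFourierTransform f g) : hat f =ᵐ[volume] g :=
  unique_right (Classical.epsilon_spec (p := fun g => IsFourierTransform f g) ⟨g, h⟩) h

theorem hat (h : IsFourierTransform f g) : IsFourierTransform f (hat f) :=
  Classical.epsilon_spec (p := fun g => IsFourierTransform f g) ⟨g, h⟩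

end IsFourierTransform

/-- The inverse Fourier integral `(2π)⁻⁵ ∫ g(ξ) e^{ix·ξ} dξ`. -/
noncomputable def invFourierIntegral (g : E → ℂ) (x : E) : ℂ :=
  (1 / (2 * Real.pi) ^ 5 : ℝ) * ∫ ξ, g ξ * Complex.exp (Complex.I * ((inner ℝ x ξ : ℝ) : ℂ))

theorem invFourierIntegral_eq (g : E → ℂ) (x : E) :
    invFourierIntegral g x = (1 / (2 * Real.pi) ^ 5 : ℝ) * 𝓕⁻ g ((2 * Real.pi)⁻¹ • x) := by
  rw [invFourierIntegral, Real.fourierInv_eq']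
  congr 1
  refine integral_congr_ae (Eventually.of_forall fun ξ => ?_)
  simp only [smul_eq_mul, inner_smul_right]
  rw [mul_comm, real_inner_comm]
  congr 2
  have : (Real.pi : ℂ) ≠ 0 := by exact_mod_cast Real.pi_ne_zero
  push_cast
  field_simp

theorem continuous_invFourierIntegral {g : E → ℂ} (hg : Integrable g) :
    Continuous (invFourierIntegral g) := by
  have : Continuous (𝓕⁻ g) := by
    simp only [funext (Real.fourierInv_eq_fourier_neg g)]
    exact (continuous_fourier hg).comp continuous_neg
  rw [funext (invFourierIntegral_eq g)]
  fun_prop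

/-- An integrable function is the Fourier transform of its inverse Fourier integral. -/
theorem isFourierTransform_invFourierIntegral {g : E → ℂ} (hg : Integrable g) :
    IsFourierTransform (invFourierIntegral g) g := fun ψ => by
  have hb : ∀ x, ‖invFourierIntegral g x‖ ≤ ‖((1 / (2 * Real.pi) ^ 5 : ℝ) : ℂ)‖ * ∫ x, ‖g x‖ := by
    intro x
    rw [invFourierIntegral_eq, norm_mul, Real.fourierInv_eq_fourier_neg]
    gcongr
    exact norm_fourier_le _
  refine ⟨integrable_mul_schwartz_of_bounded
    (continuous_invFourierIntegral hg).aestronglyMeasurable hb ψ,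
    integrable_mul_schwartz_of_integrable hg ψ, ?_⟩
  simp only [fourierIntegral_eq, invFourierIntegral_eq]
  rw [integral_comp_inv_two_pi_smul
    (fun y => ((1 / (2 * Real.pi) ^ 5 : ℝ) : ℂ) * 𝓕⁻ g y * 𝓕 (ψ : E → ℂ) y)]
  simp only [mul_assoc, integral_const_mul]
  have h1 : ∫ y, 𝓕⁻ g y * 𝓕 (ψ : E → ℂ) y = ∫ y, g y * ψ y := by
    have h2 := integral_fourier_mul_eq hg (𝓕⁻ ψ).integrable
    rw [← SchwartzMap.fourier_coe, FourierTransform.fourier_fourierInv_eq] at h2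
    rw [← h2, ← integral_neg_eq_self]
    refine integral_congr_ae (Eventually.of_forall fun y => ?_)
    simp only [SchwartzMap.fourierInv_coe]
    rw [Real.fourierInv_eq_fourier_neg, Real.fourierInv_eq_fourier_neg, neg_neg]
  rw [h1, ← mul_assoc]
  have : (2 * Real.pi : ℂ) ≠ 0 := by exact_mod_cast (by positivity : (2 * Real.pi) ≠ 0)
  push_cast
  field_simp

/-- Every square-integrable function is the Fourier transform of a square-integrable function,
and Plancherel's theorem holds. -/
theorem exists_isFourierTransform_of_memLp {g : E → ℂ} (hg : MemLp g 2 volume) :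
    ∃ w : E → ℂ, IsFourierTransform w g ∧
      (eLpNorm w 2 volume).toReal ^ 2 = ((2 * Real.pi) ^ 5)⁻¹ * ∫ ξ, ‖g ξ‖ ^ 2 := by
  set G : Lp ℂ 2 (volume : Measure E) := hg.toLp g with hG
  have hGg : G =ᵐ[volume] g := hg.coeFn_toLp
  set H : Lp ℂ 2 (volume : Measure E) := 𝓕⁻ G with hH
  have hHG : 𝓕 H = G := FourierTransform.fourier_fourierInv_eq _
  -- The formula of `invFourierIntegral_eq` with the L² inverse transform in place of the integral;
  -- the dilation converts between the two normalisations of the kernel.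
  have hw : MemLp (fun x => ((1 / (2 * Real.pi) ^ 5 : ℝ) : ℂ) * H ((2 * Real.pi)⁻¹ • x)) 2
      volume := by
    refine MemLp.const_mul ?_ _
    rw [memLp_two_iff_integrable_sq_norm]
    · exact ((memLp_two_iff_integrable_sq_norm (Lp.memLp H).1).1 (Lp.memLp H)).comp_smul
        (by positivity)
    · refine (Lp.memLp H).1.comp_quasiMeasurePreserving ?_
      refine ⟨by fun_prop, ?_⟩
      rw [Measure.map_addHaar_smul volume (by positivity)]
      exact Measure.smul_absolutelyContinuous
  refine ⟨_, fun ψ => ⟨integrable_mul_schwartz_of_memLp (p := 2) (q := 2) hw ψ,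
    integrable_mul_schwartz_of_memLp (p := 2) (q := 2) hg ψ, ?_⟩, ?_⟩
  · simp only [fourierIntegral_eq]
    rw [integral_comp_inv_two_pi_smul
      (fun y => ((1 / (2 * Real.pi) ^ 5 : ℝ) : ℂ) * H y * 𝓕 (ψ : E → ℂ) y)]
    simp only [mul_assoc, integral_const_mul]
    have h1 := congrArg (fun T : 𝓢'(E, ℂ) => T ψ) (Lp.fourier_toTemperedDistribution_eq H)
    simp only [TemperedDistribution.fourier_apply, Lp.toTemperedDistribution_apply,
      smul_eq_mul, hHG] at h1
    have h2 : ∫ ξ, g ξ * ψ ξ = ∫ x, H x * 𝓕 (ψ : E → ℂ) x := by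
      calc ∫ ξ, g ξ * ψ ξ = ∫ ξ, ψ ξ * G ξ := by
            refine integral_congr_ae ?_
            filter_upwards [hGg] with x hx
            rw [hx, mul_comm]
        _ = ∫ x, H x * 𝓕 (ψ : E → ℂ) x := by
            rw [← h1]
            simp only [mul_comm, SchwartzMap.fourier_coe]
    rw [h2, ← mul_assoc]
    have : (2 * Real.pi : ℂ) ≠ 0 := by exact_mod_cast (by positivity : (2 * Real.pi) ≠ 0)
    push_cast
    field_simp
  · have e1 : ∀ {k : E → ℂ}, MemLp k 2 volume →
        (eLpNorm k 2 volume).toReal ^ 2 = ∫ x, ‖k x‖ ^ 2 := by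
      intro k hk
      rw [MemLp.eLpNorm_eq_integral_rpow_norm (by norm_num) (by norm_num) hk]
      have h0 : 0 ≤ ∫ x, ‖k x‖ ^ 2 := integral_nonneg fun _ => by positivity
      simp only [ENNReal.toReal_ofNat, Real.rpow_ofNat]
      rw [ENNReal.toReal_ofReal (by positivity), ← Real.rpow_natCast, ← Real.rpow_mul h0]
      norm_num
    have e2 : ∫ ξ, ‖g ξ‖ ^ 2 = ∫ ξ, ‖H ξ‖ ^ 2 := by
      rw [← e1 hg, ← e1 (Lp.memLp H), ← Lp.norm_def, ← eLpNorm_congr_ae hGg, ← Lp.norm_def,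
        ← hHG, Lp.norm_fourier_eq]
    rw [e1 hw, e2]
    simp only [norm_mul, mul_pow, integral_const_mul]
    rw [Measure.integral_comp_smul volume (fun x => ‖H x‖ ^ 2)]
    have : |(((2 * Real.pi)⁻¹ : ℝ) ^ 5)⁻¹| = (2 * Real.pi) ^ 5 := by
      rw [inv_pow, inv_inv, abs_of_pos (by positivity)]
    simp only [finrank_euclideanSpace, Fintype.card_fin, this, smul_eq_mul, Complex.norm_real,
      Real.norm_eq_abs, sq_abs]
    field_simp

end KleinGordon

/-! ### Two-particle phase space at fixed total momentum -/

namespace KleinGordon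
open Set

/-- Integration of radial functions in polar coordinates. -/
theorem lintegral_fun_norm {V : Type*} [NormedAddCommGroup V] [NormedSpace ℝ V] [Nontrivial V]
    [FiniteDimensional ℝ V] [MeasurableSpace V] [BorelSpace V] (μ : Measure V)
    [μ.IsAddHaarMeasure] (f : ℝ → ℝ≥0∞) (hf : Measurable f) :
    ∫⁻ x, f ‖x‖ ∂μ = Module.finrank ℝ V * μ (Metric.ball 0 1) *
      ∫⁻ r in Ioi (0 : ℝ), ENNReal.ofReal (r ^ (Module.finrank ℝ V - 1)) * f r := by
  have h1 : ∫⁻ x, f ‖x‖ ∂μ = ∫⁻ x : ({(0)}ᶜ : Set V), f ‖x.1‖ ∂(μ.comap (↑)) := by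
    rw [lintegral_subtype_comap (measurableSet_singleton _).compl fun x ↦ f ‖x‖,
      restrict_compl_singleton]
  have h2 : ∫⁻ x : ({(0)}ᶜ : Set V), f ‖x.1‖ ∂(μ.comap (↑)) =
      ∫⁻ x, f x.2 ∂μ.toSphere.prod (.volumeIoiPow (Module.finrank ℝ V - 1)) := by
    rw [← μ.measurePreserving_homeomorphUnitSphereProd.lintegral_comp (by fun_prop)]
    simp only [homeomorphUnitSphereProd_apply_snd_coe]
  rw [h1, h2, lintegral_prod _ (by fun_prop)]
  simp only [lintegral_const, μ.toSphere_apply_univ]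
  rw [mul_comm, Measure.volumeIoiPow, lintegral_withDensity_eq_lintegral_mul₀ (by fun_prop)
    (by fun_prop)]
  simp only [Pi.mul_apply]
  rw [lintegral_subtype_comap measurableSet_Ioi
    fun r : ℝ => ENNReal.ofReal (r ^ (Module.finrank ℝ V - 1)) * f r]

theorem lintegral_fun_norm_four (f : ℝ → ℝ≥0∞) (hf : Measurable f) :
    ∫⁻ x : EuclideanSpace ℝ (Fin 4), f ‖x‖ =
      ∫⁻ r in Ioi (0 : ℝ), ENNReal.ofReal (2 * Real.pi ^ 2 * r ^ 3) * f r := by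
  rw [lintegral_fun_norm volume f hf, EuclideanSpace.volume_ball, ← lintegral_const_mul _
    (by fun_prop)]
  refine setLIntegral_congr_fun measurableSet_Ioi fun r (hr : 0 < r) => ?_
  have hg : Real.Gamma (((Fintype.card (Fin 4) : ℕ) : ℝ) / 2 + 1) = 2 := by
    rw [show ((Fintype.card (Fin 4) : ℕ) : ℝ) / 2 + 1 = ((2 : ℕ) : ℝ) + 1 by norm_num,
      Real.Gamma_nat_eq_factorial]
    norm_num
  have hp : √Real.pi ^ 4 = Real.pi ^ 2 := by
    rw [show (4 : ℕ) = 2 * 2 by norm_num, pow_mul, Real.sq_sqrt Real.pi_pos.le]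
  simp only [finrank_euclideanSpace, hg]
  simp only [Fintype.card_fin, hp, ENNReal.ofReal_one, one_pow, one_mul]
  rw [← mul_assoc, show ((4 : ℕ) : ℝ≥0∞) = ENNReal.ofReal 4 by simp,
    ← ENNReal.ofReal_mul (by norm_num), ← ENNReal.ofReal_mul (by positivity)]
  congr 2
  ring

/-- The square of the distance to the axis, on the ellipsoid with foci `0` and `c` on which the two
energies add up to `τ`, at height `z`. -/
noncomputable def axisDistSq (s c τ z : ℝ) : ℝ :=
  (τ ^ 2 - c ^ 2 - 4 * s ^ 2) / 4 - (τ ^ 2 - c ^ 2) / (4 * τ ^ 2) * (2 * z - c) ^ 2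

/-- The sum of the energies of two points at distance `h` from the axis. -/
noncomputable def energySum (s c z h : ℝ) : ℝ :=
  √(s ^ 2 + (z ^ 2 + h ^ 2)) + √(s ^ 2 + ((c - z) ^ 2 + h ^ 2))

theorem lt_energySum {s c z h : ℝ} (hh : 0 < h) : c < energySum s c z h := by
  have h1 : |z| < √(s ^ 2 + (z ^ 2 + h ^ 2)) := by
    rw [← Real.sqrt_sq_eq_abs]
    exact Real.sqrt_lt_sqrt (sq_nonneg _) (by nlinarith [sq_nonneg s, sq_pos_of_pos hh])
  have h2 : |c - z| < √(s ^ 2 + ((c - z) ^ 2 + h ^ 2)) := by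
    rw [← Real.sqrt_sq_eq_abs]
    exact Real.sqrt_lt_sqrt (sq_nonneg _) (by nlinarith [sq_nonneg s, sq_pos_of_pos hh])
  have := le_abs_self z
  have := le_abs_self (c - z)
  rw [energySum]
  linarith

/-- If A and B are the two energies, then A² − B² = c(2z − c). Hence A + B determines A − B, and
2(A² + B²) = (A + B)² + (A − B)² determines h². -/
theorem axisDistSq_energySum {s c z h : ℝ} (hc : 0 ≤ c) (hh : 0 < h) :
    axisDistSq s c (energySum s c z h) z = h ^ 2 := by
  have hτ : 0 < energySum s c z h := hc.trans_lt (lt_energySum hh)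
  rw [axisDistSq]
  have e1 : √(s ^ 2 + (z ^ 2 + h ^ 2)) ^ 2 = s ^ 2 + (z ^ 2 + h ^ 2) :=
    Real.sq_sqrt (by positivity)
  have e2 : √(s ^ 2 + ((c - z) ^ 2 + h ^ 2)) ^ 2 = s ^ 2 + ((c - z) ^ 2 + h ^ 2) :=
    Real.sq_sqrt (by positivity)
  rw [energySum] at hτ ⊢
  generalize √(s ^ 2 + (z ^ 2 + h ^ 2)) = A at *
  generalize √(s ^ 2 + ((c - z) ^ 2 + h ^ 2)) = B at *
  have hv : c * (2 * z - c) = (A - B) * (A + B) := by linear_combination e2 - e1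
  have hv2 : c ^ 2 * (2 * z - c) ^ 2 = (A - B) ^ 2 * (A + B) ^ 2 := by
    rw [← mul_pow, hv, mul_pow]
  field_simp
  have hd : (A - B) ^ 2 = 2 * A ^ 2 + 2 * B ^ 2 - (A + B) ^ 2 := by ring
  rw [hd] at hv2
  linear_combination hv2 + 2 * (A + B) ^ 2 * e1 + 2 * (A + B) ^ 2 * e2

theorem energySum_sqrt_axisDistSq {s c τ z : ℝ} (hc : 0 ≤ c) (hτ : c < τ)
    (hH : 0 < axisDistSq s c τ z) : energySum s c z (√(axisDistSq s c τ z)) = τ := by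
  have hτ0 : 0 < τ := hc.trans_lt hτ
  have hD : 0 < τ ^ 2 - c ^ 2 := by nlinarith
  -- The difference of the two energies, so that they are (τ ± v)/2. Positivity of `axisDistSq`
  -- forces |2z − c| < τ, hence |v| ≤ τ, and both square roots open with the right sign.
  set v : ℝ := c * (2 * z - c) / τ with hv
  have hzc : (2 * z - c) ^ 2 < τ ^ 2 := by
    by_contra! hcon
    have : axisDistSq s c τ z ≤ 0 := by
      rw [axisDistSq]
      have : (τ ^ 2 - c ^ 2) / (4 * τ ^ 2) * τ ^ 2 ≤
          (τ ^ 2 - c ^ 2) / (4 * τ ^ 2) * (2 * z - c) ^ 2 := by gcongr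
      have e : (τ ^ 2 - c ^ 2) / (4 * τ ^ 2) * τ ^ 2 = (τ ^ 2 - c ^ 2) / 4 := by field_simp
      nlinarith [sq_nonneg s]
    linarith
  have hv' : |v| ≤ τ := by
    rw [hv, abs_div, abs_of_pos hτ0, div_le_iff₀ hτ0, abs_mul, abs_of_nonneg hc]
    have := abs_lt_of_sq_lt_sq hzc hτ0.le
    gcongr
  rw [energySum, Real.sq_sqrt hH.le]
  obtain ⟨hv1, hv2⟩ := abs_le.1 hv'
  have e1 : s ^ 2 + (z ^ 2 + axisDistSq s c τ z) = ((τ + v) / 2) ^ 2 := by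
    rw [axisDistSq, hv]; field_simp; ring
  have e2 : s ^ 2 + ((c - z) ^ 2 + axisDistSq s c τ z) = ((τ - v) / 2) ^ 2 := by
    rw [axisDistSq, hv]; field_simp; ring
  rw [e1, e2, Real.sqrt_sq (by linarith), Real.sqrt_sq (by linarith)]
  ring

theorem hasDerivAt_energySum {s c z h : ℝ} (hh : 0 < h) :
    HasDerivAt (energySum s c z)
      (h / √(s ^ 2 + (z ^ 2 + h ^ 2)) + h / √(s ^ 2 + ((c - z) ^ 2 + h ^ 2))) h := by
  have key : ∀ b : ℝ, HasDerivAt (fun h => √(s ^ 2 + (b ^ 2 + h ^ 2)))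
      (h / √(s ^ 2 + (b ^ 2 + h ^ 2))) h := by
    intro b
    have h1 : HasDerivAt (fun h : ℝ => s ^ 2 + (b ^ 2 + h ^ 2)) (2 * h) h := by
      simpa using ((hasDerivAt_pow 2 h).const_add (b ^ 2)).const_add (s ^ 2)
    convert h1.sqrt (by positivity) using 1
    have : 0 < √(s ^ 2 + (b ^ 2 + h ^ 2)) := by positivity
    field_simp
  exact (key z).add (key (c - z))

theorem injOn_energySum {s c z : ℝ} (hc : 0 ≤ c) : InjOn (energySum s c z) (Ioi 0) := by
  intro a (ha : 0 < a) b (hb : 0 < b) hab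
  have h1 := axisDistSq_energySum (s := s) (z := z) hc ha
  have h2 := axisDistSq_energySum (s := s) (z := z) hc hb
  rw [hab, h2] at h1
  exact ((sq_eq_sq₀ hb.le ha.le).1 h1).symm

theorem image_energySum {s c z : ℝ} (hc : 0 ≤ c) :
    energySum s c z '' Ioi 0 = Ioi c ∩ {τ | 0 < axisDistSq s c τ z} := by
  ext τ
  constructor
  · rintro ⟨h, hh : 0 < h, rfl⟩
    refine ⟨lt_energySum hh, ?_⟩
    rw [mem_ofPred_eq, axisDistSq_energySum hc hh]
    positivity
  · rintro ⟨h1, h2⟩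
    exact ⟨_, Real.sqrt_pos.2 h2, energySum_sqrt_axisDistSq hc h1 h2⟩

/-- Change of variables from the distance to the axis to the total energy. -/
theorem lintegral_energySum {s c z : ℝ} (hc : 0 ≤ c) (k : ℝ → ℝ≥0∞) :
    ∫⁻ h in Ioi (0 : ℝ), ENNReal.ofReal (2 * Real.pi ^ 2 * h ^ 3) *
      (ENNReal.ofReal (1 / (√(s ^ 2 + (z ^ 2 + h ^ 2)) * √(s ^ 2 + ((c - z) ^ 2 + h ^ 2)))) *
        k (energySum s c z h)) =
    ∫⁻ τ in Ioi c, ENNReal.ofReal (2 * Real.pi ^ 2 / τ * axisDistSq s c τ z) * k τ := by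
  have hm' : Measurable fun τ => axisDistSq s c τ z := by unfold axisDistSq; fun_prop
  have hm : MeasurableSet {τ | 0 < axisDistSq s c τ z} := measurableSet_lt measurable_const hm'
  -- Energies not attained at height z have a nonpositive `axisDistSq`, so `ENNReal.ofReal` removes
  -- them.
  have h1 : ∫⁻ τ in Ioi c, ENNReal.ofReal (2 * Real.pi ^ 2 / τ * axisDistSq s c τ z) * k τ =
      ∫⁻ τ in energySum s c z '' Ioi 0,
        ENNReal.ofReal (2 * Real.pi ^ 2 / τ * axisDistSq s c τ z) * k τ := by
    rw [image_energySum hc, inter_comm, ← Measure.restrict_restrict hm, ← lintegral_indicator hm]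
    refine setLIntegral_congr_fun measurableSet_Ioi fun τ (hτ : c < τ) => ?_
    by_cases hH : 0 < axisDistSq s c τ z
    · rw [indicator_of_mem (by exact hH)]
    · rw [indicator_of_notMem (by exact hH), ENNReal.ofReal_of_nonpos, zero_mul]
      have : 0 < τ := hc.trans_lt hτ
      exact mul_nonpos_of_nonneg_of_nonpos (by positivity) (not_lt.1 hH)
  rw [h1, lintegral_image_eq_lintegral_abs_deriv_mul measurableSet_Ioi
    (fun h hh => (hasDerivAt_energySum hh).hasDerivWithinAt) (injOn_energySum hc)]
  refine setLIntegral_congr_fun measurableSet_Ioi fun h (hh : 0 < h) => ?_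
  rw [← mul_assoc, ← mul_assoc, axisDistSq_energySum hc hh, ← ENNReal.ofReal_mul (by positivity),
    ← ENNReal.ofReal_mul (by positivity), abs_of_pos (by positivity)]
  -- The Jacobian is h/A + h/B = hτ/(AB): it supplies the factor 1/(AB) and one of the three powers
  -- of h.
  congr 2
  have hτ : 0 < energySum s c z h := hc.trans_lt (lt_energySum hh)
  rw [energySum] at *
  have e1 : 0 < √(s ^ 2 + (z ^ 2 + h ^ 2)) := by positivity
  have e2 : 0 < √(s ^ 2 + ((c - z) ^ 2 + h ^ 2)) := by positivity
  field_simp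
  ring

/-- The density of the two-particle phase space measure, as a function of the squared mass. -/
noncomputable def phaseDensity (s D : ℝ) : ℝ :=
  Real.pi ^ 2 / 3 * ((D - 4 * s ^ 2) * √((D - 4 * s ^ 2) / D))

theorem phaseDensity_nonneg {s D : ℝ} (hD : 0 ≤ D) : 0 ≤ phaseDensity s D := by
  rw [phaseDensity]
  rcases le_total 0 (D - 4 * s ^ 2) with h | h
  · positivity
  · rw [Real.sqrt_eq_zero_of_nonpos (div_nonpos_of_nonpos_of_nonneg h hD)]
    simp

/-- `ENNReal.ofReal` cuts the parabola to its positive arc between the roots (c ± √(A/B))/2. For A ≤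
0 the arc is empty, and the right side vanishes because the real square root is zero on nonpositive
arguments. -/
theorem lintegral_ofReal_parabola {A B C c : ℝ} (hB : 0 < B) (hC : 0 ≤ C) :
    ∫⁻ z, ENNReal.ofReal (C * (A - B * (2 * z - c) ^ 2)) =
      ENNReal.ofReal (2 / 3 * C * (A * √(A / B))) := by
  rcases le_or_gt A 0 with hA | hA
  · rw [Real.sqrt_eq_zero_of_nonpos (div_nonpos_of_nonpos_of_nonneg hA hB.le)]
    simp only [mul_zero, ENNReal.ofReal_zero]
    rw [← lintegral_zero (μ := (volume : Measure ℝ))]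
    refine lintegral_congr fun z => ENNReal.ofReal_of_nonpos ?_
    exact mul_nonpos_of_nonneg_of_nonpos hC (by nlinarith [mul_nonneg hB.le (sq_nonneg (2 * z - c))])
  set q := √(A / B) with hq
  have hq0 : 0 ≤ q := Real.sqrt_nonneg _
  have hq2 : B * q ^ 2 = A := by rw [hq, Real.sq_sqrt (by positivity)]; field_simp
  have hle : (c - q) / 2 ≤ (c + q) / 2 := by linarith
  have h1 : ∫⁻ z, ENNReal.ofReal (C * (A - B * (2 * z - c) ^ 2)) =
      ∫⁻ z in Ioc ((c - q) / 2) ((c + q) / 2), ENNReal.ofReal (C * (A - B * (2 * z - c) ^ 2)) := by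
    rw [← lintegral_indicator measurableSet_Ioc]
    refine lintegral_congr fun z => ?_
    by_cases hz : z ∈ Ioc ((c - q) / 2) ((c + q) / 2)
    · rw [indicator_of_mem hz]
    · rw [indicator_of_notMem hz, ENNReal.ofReal_of_nonpos]
      refine mul_nonpos_of_nonneg_of_nonpos hC ?_
      have : q ^ 2 ≤ (2 * z - c) ^ 2 := by
        rw [mem_Ioc, not_and_or, not_lt, not_le] at hz
        rcases hz with hz | hz <;> nlinarith
      nlinarith [mul_le_mul_of_nonneg_left this hB.le]
  rw [h1, ← ofReal_integral_eq_lintegral_ofReal, ← intervalIntegral.integral_of_le hle]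
  · congr 1
    have hd : ∀ z ∈ uIcc ((c - q) / 2) ((c + q) / 2),
        HasDerivAt (fun z => C * (A * z - B * (2 * z - c) ^ 3 / 6))
          (C * (A - B * (2 * z - c) ^ 2)) z := by
      intro z _
      have h2 : HasDerivAt (fun z : ℝ => 2 * z - c) 2 z := by
        simpa using ((hasDerivAt_id z).const_mul 2).sub_const c
      have h3 := ((((hasDerivAt_id z).const_mul A).sub
        (((h2.pow 3).const_mul B).div_const 6))).const_mul C
      refine HasDerivAt.congr_deriv h3 ?_
      push_cast
      ring
    rw [intervalIntegral.integral_eq_sub_of_hasDerivAt hd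
      (Continuous.intervalIntegrable (by fun_prop) _ _)]
    rw [← hq2]
    ring
  · exact (Continuous.integrableOn_Icc (by fun_prop)).mono_set Ioc_subset_Icc_self
  · refine (ae_restrict_iff' measurableSet_Ioc).2 (Eventually.of_forall fun z hz => ?_)
    refine mul_nonneg hC ?_
    have : (2 * z - c) ^ 2 ≤ q ^ 2 := by
      rw [mem_Ioc] at hz
      nlinarith
    nlinarith [mul_le_mul_of_nonneg_left this hB.le]

/-- The half-width of the arc carries a factor τ that cancels the prefactor 1/τ. Only τ² − c²
survives, as Lorentz invariance predicts. -/
theorem lintegral_axisDistSq {s c τ : ℝ} (hc : 0 ≤ c) (hτ : c < τ) :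
    ∫⁻ z, ENNReal.ofReal (2 * Real.pi ^ 2 / τ * axisDistSq s c τ z) =
      ENNReal.ofReal (phaseDensity s (τ ^ 2 - c ^ 2)) := by
  have hτ0 : 0 < τ := hc.trans_lt hτ
  have hD : 0 < τ ^ 2 - c ^ 2 := by nlinarith
  simp only [axisDistSq]
  rw [lintegral_ofReal_parabola (by positivity) (by positivity)]
  congr 1
  have e : (τ ^ 2 - c ^ 2 - 4 * s ^ 2) / 4 / ((τ ^ 2 - c ^ 2) / (4 * τ ^ 2)) =
      (τ ^ 2 - c ^ 2 - 4 * s ^ 2) / (τ ^ 2 - c ^ 2) * τ ^ 2 := by field_simp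
  rw [e, Real.sqrt_mul' _ (by positivity), Real.sqrt_sq hτ0.le, phaseDensity]
  field_simp
  ring

end KleinGordon

/-! ### The two-particle measure on energy-momentum space -/

namespace KleinGordon
open Set

theorem phi_nonneg (s r : ℝ) : 0 ≤ phi s r := Real.sqrt_nonneg _

theorem phi_sq (s r : ℝ) : phi s r ^ 2 = s ^ 2 + r ^ 2 := Real.sq_sqrt (by positivity)

theorem continuous_phi (s : ℝ) : Continuous (phi s) := by unfold phi; fun_prop

theorem continuous_phi_norm (s : ℝ) : Continuous fun ξ : E => phi s ‖ξ‖ :=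
  (continuous_phi s).comp continuous_norm

theorem phi_pos_of_ne {s r : ℝ} (hr : r ≠ 0) : 0 < phi s r := Real.sqrt_pos.2 (by positivity)

theorem le_phi {s r : ℝ} : s ≤ phi s r := Real.le_sqrt_of_sq_le (by nlinarith [sq_nonneg r])

theorem le_phi_right {s r : ℝ} : r ≤ phi s r := Real.le_sqrt_of_sq_le (by nlinarith [sq_nonneg s])

theorem phi_pos_of_pos {s r : ℝ} (hs : 0 < s) : 0 < phi s r := hs.trans_le le_phi

/-- The first coordinate axis and its orthogonal complement. -/
noncomputable def axisEquiv : ℝ × EuclideanSpace ℝ (Fin 4) ≃ᵐ E :=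
  ((MeasurableEquiv.refl ℝ).prodCongr (MeasurableEquiv.toLp 2 (Fin 4 → ℝ)).symm).trans
    ((MeasurableEquiv.piFinSuccAbove (fun _ : Fin 5 => ℝ) 0).symm.trans
      (MeasurableEquiv.toLp 2 (Fin 5 → ℝ)))

theorem measurePreserving_axisEquiv : MeasurePreserving axisEquiv := by
  refine MeasurePreserving.trans (μb := volume) ?_ (MeasurePreserving.trans (μb := volume) ?_ ?_)
  · exact (MeasurePreserving.id volume).prod
      (EuclideanSpace.volume_preserving_symm_measurableEquiv_toLp (Fin 4))
  · exact (volume_preserving_piFinSuccAbove (fun _ : Fin 5 => ℝ) 0).symm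
  · exact (EuclideanSpace.volume_preserving_symm_measurableEquiv_toLp (Fin 5)).symm

theorem axisEquiv_zero (p : ℝ × EuclideanSpace ℝ (Fin 4)) : axisEquiv p 0 = p.1 := by
  simp [axisEquiv, MeasurableEquiv.prodCongr]

theorem axisEquiv_succ (p : ℝ × EuclideanSpace ℝ (Fin 4)) (i : Fin 4) :
    axisEquiv p i.succ = p.2 i := by
  simp [axisEquiv, MeasurableEquiv.prodCongr]

theorem norm_axisEquiv_sq (p : ℝ × EuclideanSpace ℝ (Fin 4)) :
    ‖axisEquiv p‖ ^ 2 = p.1 ^ 2 + ‖p.2‖ ^ 2 := by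
  rw [EuclideanSpace.norm_sq_eq, Fin.sum_univ_succ, EuclideanSpace.norm_sq_eq p.2]
  simp only [axisEquiv_zero, axisEquiv_succ, Real.norm_eq_abs, sq_abs]

theorem norm_single_sub_axisEquiv_sq (c : ℝ) (p : ℝ × EuclideanSpace ℝ (Fin 4)) :
    ‖EuclideanSpace.single 0 c - axisEquiv p‖ ^ 2 = (c - p.1) ^ 2 + ‖p.2‖ ^ 2 := by
  rw [EuclideanSpace.norm_sq_eq, Fin.sum_univ_succ, EuclideanSpace.norm_sq_eq p.2]
  simp only [PiLp.sub_apply, axisEquiv_zero, axisEquiv_succ, Real.norm_eq_abs, sq_abs]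
  simp

/-- There is a rotation taking the first coordinate axis to a given direction. -/
theorem exists_linearIsometryEquiv_single (ξ : E) :
    ∃ R : E ≃ₗᵢ[ℝ] E, R (EuclideanSpace.single 0 ‖ξ‖) = ξ := by
  have h : ‖(EuclideanSpace.single 0 ‖ξ‖ : E)‖ = ‖ξ‖ := by simp
  exact ⟨(Submodule.span ℝ {EuclideanSpace.single 0 ‖ξ‖ - ξ})ᗮ.reflection,
    Submodule.reflection_sub h⟩

/-- The energy distribution of two free particles with total momentum `ξ`. -/
theorem lintegral_fixed_momentum (s : ℝ) (ξ : E) (k : ℝ → ℝ≥0∞) (hk : Measurable k) :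
    ∫⁻ y : E, ENNReal.ofReal (1 / (phi s ‖y‖ * phi s ‖ξ - y‖)) *
      k (phi s ‖y‖ + phi s ‖ξ - y‖) =
    ∫⁻ τ in Ioi ‖ξ‖, ENNReal.ofReal (phaseDensity s (τ ^ 2 - ‖ξ‖ ^ 2)) * k τ := by
  obtain ⟨R, hR⟩ := exists_linearIsometryEquiv_single ξ
  set c := ‖ξ‖ with hc
  have hc0 : 0 ≤ c := norm_nonneg ξ
  have hφ := continuous_phi s
  have hmeas : Measurable fun y : E => ENNReal.ofReal (1 / (phi s ‖y‖ * phi s ‖ξ - y‖)) *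
      k (phi s ‖y‖ + phi s ‖ξ - y‖) := by
    have := hφ.measurable
    fun_prop
  have h0 : Measurable fun p : ℝ × EuclideanSpace ℝ (Fin 4) =>
      ENNReal.ofReal (1 / (√(s ^ 2 + (p.1 ^ 2 + ‖p.2‖ ^ 2)) *
        √(s ^ 2 + ((c - p.1) ^ 2 + ‖p.2‖ ^ 2)))) * k (energySum s c p.1 ‖p.2‖) := by
    unfold energySum
    fun_prop
  simp only [energySum] at h0
  have hR' := hmeas.comp R.continuous.measurable
  simp only [Function.comp_def] at hR'
  rw [← R.measurePreserving.lintegral_comp hmeas,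
    ← measurePreserving_axisEquiv.lintegral_comp hR']
  have h1 : ∀ p : ℝ × EuclideanSpace ℝ (Fin 4),
      phi s ‖R (axisEquiv p)‖ = √(s ^ 2 + (p.1 ^ 2 + ‖p.2‖ ^ 2)) := fun p => by
    rw [phi, R.norm_map, norm_axisEquiv_sq]
  have h2 : ∀ p : ℝ × EuclideanSpace ℝ (Fin 4),
      phi s ‖ξ - R (axisEquiv p)‖ = √(s ^ 2 + ((c - p.1) ^ 2 + ‖p.2‖ ^ 2)) := fun p => by
    rw [phi]
    nth_rewrite 1 [← hR]
    rw [← map_sub, R.norm_map, norm_single_sub_axisEquiv_sq]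
  simp only [h1, h2]
  rw [Measure.volume_eq_prod, lintegral_prod _ h0.aemeasurable]
  -- After rotating ξ onto the axis the integrand depends on the height z and the distance to the
  -- axis. At each height the distance is traded for the total energy; the height is then integrated
  -- out at fixed energy.
  calc _ = ∫⁻ z : ℝ, ∫⁻ τ in Ioi c,
        ENNReal.ofReal (2 * Real.pi ^ 2 / τ * axisDistSq s c τ z) * k τ := by
        refine lintegral_congr fun z => ?_
        rw [← lintegral_energySum hc0]
        refine (lintegral_fun_norm_four (fun h => ENNReal.ofReal
          (1 / (√(s ^ 2 + (z ^ 2 + h ^ 2)) * √(s ^ 2 + ((c - z) ^ 2 + h ^ 2)))) *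
          k (energySum s c z h)) ?_)
        unfold energySum
        fun_prop
    _ = ∫⁻ τ in Ioi c, ∫⁻ z : ℝ,
        ENNReal.ofReal (2 * Real.pi ^ 2 / τ * axisDistSq s c τ z) * k τ := by
        refine lintegral_lintegral_swap (Measurable.aemeasurable ?_)
        unfold axisDistSq
        fun_prop
    _ = _ := by
        refine setLIntegral_congr_fun measurableSet_Ioi fun τ (hτ : c < τ) => ?_
        rw [lintegral_mul_const, lintegral_axisDistSq hc0 hτ]
        unfold axisDistSq
        fun_prop

/-- The density on `ℝ × E` of the two-particle phase space measure. -/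
noncomputable def phaseWeight (s : ℝ) (q : ℝ × E) : ℝ :=
  if ‖q.2‖ < q.1 then phaseDensity s (q.1 ^ 2 - ‖q.2‖ ^ 2) else 0

theorem measurable_phaseWeight (s : ℝ) : Measurable (phaseWeight s) := by
  unfold phaseWeight phaseDensity
  refine Measurable.ite (measurableSet_lt (by fun_prop) (by fun_prop)) (by fun_prop)
    measurable_const

theorem phaseWeight_nonneg (s : ℝ) (q : ℝ × E) : 0 ≤ phaseWeight s q := by
  rw [phaseWeight]
  split_ifs with h
  · exact phaseDensity_nonneg (by nlinarith [norm_nonneg q.2])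
  · exact le_rfl

/-- Total energy and momentum of two particles. -/
noncomputable def totalMomentum (s : ℝ) (p : E × E) : ℝ × E :=
  (phi s ‖p.1‖ + phi s ‖p.2‖, p.1 + p.2)

theorem continuous_totalMomentum (s : ℝ) : Continuous (totalMomentum s) := by
  have := continuous_phi s
  unfold totalMomentum
  fun_prop

/-- The substitution y₂ = ξ − y₁ slices the pairs by total momentum, and each slice is
`lintegral_fixed_momentum`. -/
theorem lintegral_totalMomentum (s : ℝ) (k : ℝ × E → ℝ≥0∞) (hk : Measurable k) :
    ∫⁻ p : E × E, ENNReal.ofReal (1 / (phi s ‖p.1‖ * phi s ‖p.2‖)) * k (totalMomentum s p) =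
      ∫⁻ q, ENNReal.ofReal (phaseWeight s q) * k q := by
  have hφ := (continuous_phi s).measurable
  have hw := measurable_phaseWeight s
  have hT := (continuous_totalMomentum s).measurable
  rw [Measure.volume_eq_prod, Measure.volume_eq_prod, lintegral_prod _ (by fun_prop),
    lintegral_prod_symm _ (by fun_prop)]
  calc _ = ∫⁻ y : E, ∫⁻ ξ : E, ENNReal.ofReal (1 / (phi s ‖y‖ * phi s ‖ξ - y‖)) *
        k (phi s ‖y‖ + phi s ‖ξ - y‖, ξ) := by
        refine lintegral_congr fun y => ?_
        rw [← lintegral_add_left_eq_self (μ := (volume : Measure E))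
          (fun ξ => ENNReal.ofReal (1 / (phi s ‖y‖ * phi s ‖ξ - y‖)) *
            k (phi s ‖y‖ + phi s ‖ξ - y‖, ξ)) y]
        simp only [totalMomentum, add_sub_cancel_left]
    _ = ∫⁻ ξ : E, ∫⁻ y : E, ENNReal.ofReal (1 / (phi s ‖y‖ * phi s ‖ξ - y‖)) *
        k (phi s ‖y‖ + phi s ‖ξ - y‖, ξ) :=
        lintegral_lintegral_swap (Measurable.aemeasurable (by fun_prop))
    _ = _ := by
        refine lintegral_congr fun ξ => ?_
        rw [lintegral_fixed_momentum s ξ (fun τ => k (τ, ξ)) (by fun_prop),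
          ← lintegral_indicator measurableSet_Ioi]
        refine lintegral_congr fun τ => ?_
        by_cases hτ : ‖ξ‖ < τ
        · rw [indicator_of_mem (by exact hτ), phaseWeight, if_pos hτ]
        · rw [indicator_of_notMem (by exact hτ), phaseWeight, if_neg hτ]
          simp

/-- The pairing `φ_s(|y₁|) φ_s(|y₂|) - y₁ · y₂`. -/
noncomputable def lorentz (s : ℝ) (p : E × E) : ℝ :=
  phi s ‖p.1‖ * phi s ‖p.2‖ - inner ℝ p.1 p.2

/-- Cauchy-Schwarz for the plane vectors (s, a) and (s, b). -/
theorem sq_add_mul_le_phi_mul_phi (s a b : ℝ) : s ^ 2 + a * b ≤ phi s a * phi s b := by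
  rw [phi, phi, ← Real.sqrt_mul (by positivity)]
  exact Real.le_sqrt_of_sq_le (by nlinarith [sq_nonneg (s * (a - b))])

/-- The reversed Cauchy-Schwarz inequality on the mass shell; it makes the factor P − s² in the
density nonnegative. -/
theorem sq_le_lorentz (s : ℝ) (p : E × E) : s ^ 2 ≤ lorentz s p := by
  have := sq_add_mul_le_phi_mul_phi s ‖p.1‖ ‖p.2‖
  have := real_inner_le_norm p.1 p.2
  rw [lorentz]
  linarith

theorem lorentz_le (s : ℝ) (p : E × E) : lorentz s p ≤ 2 * (phi s ‖p.1‖ * phi s ‖p.2‖) := by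
  have := sq_add_mul_le_phi_mul_phi s ‖p.1‖ ‖p.2‖
  have := neg_le_of_abs_le (abs_real_inner_le_norm p.1 p.2)
  rw [lorentz]
  nlinarith [sq_nonneg s]

theorem totalMomentum_sq (s : ℝ) (p : E × E) :
    (totalMomentum s p).1 ^ 2 - ‖(totalMomentum s p).2‖ ^ 2 = 2 * s ^ 2 + 2 * lorentz s p := by
  simp only [totalMomentum, lorentz, norm_add_sq_real, add_sq, phi_sq]
  ring

theorem phaseDensity_two_mul (s P : ℝ) : phaseDensity s (2 * s ^ 2 + 2 * P) =
    2 * Real.pi ^ 2 / 3 * ((P - s ^ 2) * √((P - s ^ 2) / (P + s ^ 2))) := by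
  rw [phaseDensity]
  have : (2 * s ^ 2 + 2 * P - 4 * s ^ 2) / (2 * s ^ 2 + 2 * P) = (P - s ^ 2) / (P + s ^ 2) := by
    rw [show 2 * s ^ 2 + 2 * P - 4 * s ^ 2 = 2 * (P - s ^ 2) by ring,
      show 2 * s ^ 2 + 2 * P = 2 * (P + s ^ 2) by ring, mul_div_mul_left _ _ two_ne_zero]
  rw [this]
  ring

theorem phaseWeight_totalMomentum (s : ℝ) (p : E × E) : phaseWeight s (totalMomentum s p) =
    2 * Real.pi ^ 2 / 3 * ((lorentz s p - s ^ 2) *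
      √((lorentz s p - s ^ 2) / (lorentz s p + s ^ 2))) := by
  rw [phaseWeight]
  split_ifs with h
  · rw [totalMomentum_sq, phaseDensity_two_mul]
  -- A total outside the open light cone forces P + s² ≤ 0, hence P = s² = 0, and the formula
  -- vanishes there as well.
  · have h1 := totalMomentum_sq s p
    have h2 := sq_le_lorentz s p
    have h3 : 0 ≤ (totalMomentum s p).1 := add_nonneg (phi_nonneg _ _) (phi_nonneg _ _)
    have h4 : lorentz s p - s ^ 2 = 0 := by nlinarith [sq_nonneg s]
    rw [h4]
    simp

end KleinGordon

/-! ### Space-time Fourier transform and the weighted Cauchy-Schwarz inequality -/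

namespace KleinGordon
open scoped FourierTransform

/-- The Euclidean pairing on space-time. -/
noncomputable def pairing (q q' : ℝ × E) : ℝ := q.1 * q'.1 + inner ℝ q.2 q'.2

theorem pairing_comm (q q' : ℝ × E) : pairing q q' = pairing q' q := by
  rw [pairing, pairing, mul_comm, real_inner_comm]

/-- The space-time Fourier integral with kernel `e^{i(tτ + x·ξ)}`. -/
noncomputable def spaceTimeFourier (Ψ : ℝ × E → ℂ) (q : ℝ × E) : ℂ :=
  ∫ q', Ψ q' * Complex.exp (Complex.I * (pairing q' q : ℂ))

theorem norm_exp_I_mul (r : ℝ) : ‖Complex.exp (Complex.I * (r : ℂ))‖ = 1 := by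
  rw [mul_comm, Complex.norm_exp_ofReal_mul_I]

theorem lintegral_comp_inv_two_pi_smul {V : Type*} [NormedAddCommGroup V] [NormedSpace ℝ V]
    [FiniteDimensional ℝ V] [MeasurableSpace V] [BorelSpace V] (μ : Measure V)
    [μ.IsAddHaarMeasure] {f : V → ℝ≥0∞} (hf : Measurable f) :
    ∫⁻ x, f ((2 * Real.pi)⁻¹ • x) ∂μ =
      ENNReal.ofReal (2 * Real.pi) ^ Module.finrank ℝ V * ∫⁻ x, f x ∂μ := by
  have h1 : ∫⁻ x, f ((2 * Real.pi)⁻¹ • x) ∂μ =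
      ∫⁻ x, f x ∂(μ.map fun x => (2 * Real.pi)⁻¹ • x) := by
    rw [lintegral_map hf (by fun_prop)]
  rw [h1, Measure.map_addHaar_smul μ (by positivity), lintegral_smul_measure, inv_pow, inv_inv,
    abs_of_pos (by positivity), ENNReal.ofReal_pow (by positivity), smul_eq_mul]

-- The product `ℝ × E` carries the sup norm and is no inner product space, so Plancherel is imported
-- from `WithLp 2 (ℝ × E)`.
theorem spaceTimeFourier_eq (Ψ : ℝ × E → ℂ) (q : ℝ × E) :
    spaceTimeFourier Ψ q = 𝓕⁻ (fun v : WithLp 2 (ℝ × E) => Ψ v.ofLp)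
      ((2 * Real.pi)⁻¹ • WithLp.toLp 2 q) := by
  rw [Real.fourierInv_eq', spaceTimeFourier]
  rw [← (WithLp.volume_preserving_ofLp ℝ E).integral_comp
    (MeasurableEquiv.toLp 2 (ℝ × E)).symm.measurableEmbedding]
  refine integral_congr_ae (Eventually.of_forall fun v => ?_)
  simp only [smul_eq_mul, inner_smul_right, WithLp.prod_inner_apply, pairing]
  rw [mul_comm]
  congr 2
  have : (Real.pi : ℂ) ≠ 0 := by exact_mod_cast Real.pi_ne_zero
  simp only [RCLike.inner_apply, conj_trivial]
  push_cast
  field_simp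

theorem lintegral_enorm_sq_eq_eLpNorm {α : Type*} {m : MeasurableSpace α} {μ : Measure α}
    (f : α → ℂ) : ∫⁻ x, ‖f x‖ₑ ^ 2 ∂μ = eLpNorm f 2 μ ^ 2 := by
  simpa using (eLpNorm_nnreal_pow_eq_lintegral (f := f) (μ := μ) (p := 2) two_ne_zero).symm

/-- **Plancherel's theorem** on space-time. -/
theorem lintegral_spaceTimeFourier {Ψ : ℝ × E → ℂ} (h1 : Integrable Ψ) (h2 : MemLp Ψ 2 volume) :
    ∫⁻ q, ‖spaceTimeFourier Ψ q‖ₑ ^ 2 =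
      ENNReal.ofReal (2 * Real.pi) ^ 6 * ∫⁻ q, ‖Ψ q‖ₑ ^ 2 := by
  have hmp := WithLp.volume_preserving_ofLp ℝ E
  have hemb := (MeasurableEquiv.toLp 2 (ℝ × E)).symm.measurableEmbedding
  set f : WithLp 2 (ℝ × E) → ℂ := fun v => Ψ v.ofLp with hf
  have hf1 : Integrable f := (hmp.integrable_comp_emb hemb).2 h1
  have hf2 : MemLp f 2 volume := h2.comp_measurePreserving hmp
  have hc : Continuous (𝓕 f) := continuous_fourier hf1
  have hinv : ∀ w, 𝓕⁻ f w = 𝓕 f (-w) := Real.fourierInv_eq_fourier_neg f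
  have hci : Continuous (𝓕⁻ f) := by
    rw [funext hinv]
    exact hc.comp continuous_neg
  calc ∫⁻ q, ‖spaceTimeFourier Ψ q‖ₑ ^ 2
      = ∫⁻ v : WithLp 2 (ℝ × E), ‖𝓕⁻ f ((2 * Real.pi)⁻¹ • v)‖ₑ ^ 2 := by
        rw [← hmp.lintegral_comp_emb hemb]
        simp only [spaceTimeFourier_eq, WithLp.toLp_ofLp, hf]
    _ = ENNReal.ofReal (2 * Real.pi) ^ 6 * ∫⁻ v, ‖𝓕⁻ f v‖ₑ ^ 2 := by
        rw [lintegral_comp_inv_two_pi_smul volume (f := fun v => ‖𝓕⁻ f v‖ₑ ^ 2)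
          (by fun_prop)]
        congr 2
        rw [(WithLp.linearEquiv 2 ℝ (ℝ × E)).finrank_eq]
        simp
    _ = ENNReal.ofReal (2 * Real.pi) ^ 6 * ∫⁻ v, ‖𝓕 f v‖ₑ ^ 2 := by
        simp only [hinv]
        rw [(Measure.measurePreserving_neg volume).lintegral_comp
          (f := fun v => ‖𝓕 f v‖ₑ ^ 2) (by fun_prop)]
    _ = ENNReal.ofReal (2 * Real.pi) ^ 6 * ∫⁻ v, ‖f v‖ₑ ^ 2 := by
        rw [lintegral_enorm_sq_eq_eLpNorm, lintegral_enorm_sq_eq_eLpNorm,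
          eLpNorm_fourier_eq hf1 hf2]
    _ = _ := by rw [← hmp.lintegral_comp_emb hemb]

/-- The Cauchy-Schwarz inequality for the Lebesgue integral. -/
theorem sq_lintegral_mul_le {α : Type*} {m : MeasurableSpace α} {μ : Measure α} {f g : α → ℝ≥0∞}
    (hf : AEMeasurable f μ) (hg : AEMeasurable g μ) :
    (∫⁻ x, f x * g x ∂μ) ^ 2 ≤ (∫⁻ x, f x ^ 2 ∂μ) * ∫⁻ x, g x ^ 2 ∂μ := by
  have h := ENNReal.lintegral_mul_le_Lp_mul_Lq μ Real.HolderConjugate.two_two hf hg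
  simp only [Pi.mul_apply, ENNReal.rpow_two] at h
  calc (∫⁻ x, f x * g x ∂μ) ^ 2
      ≤ ((∫⁻ x, f x ^ 2 ∂μ) ^ (1 / 2 : ℝ) * (∫⁻ x, g x ^ 2 ∂μ) ^ (1 / 2 : ℝ)) ^ 2 := by gcongr
    _ = _ := by
        rw [mul_pow, ← ENNReal.rpow_natCast, ← ENNReal.rpow_natCast, ← ENNReal.rpow_mul,
          ← ENNReal.rpow_mul]
        norm_num

/-- The free evolution of an integrable frequency profile. -/
noncomputable def freeWave (s : ℝ) (F : E → ℂ) (q : ℝ × E) : ℂ :=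
  invFourierIntegral (fun ξ => Complex.exp (Complex.I * ((q.1 * phi s ‖ξ‖ : ℝ) : ℂ)) * F ξ) q.2

theorem measurable_phase (s t : ℝ) :
    Measurable fun ξ : E => Complex.exp (Complex.I * ((t * phi s ‖ξ‖ : ℝ) : ℂ)) := by
  have := (continuous_phi_norm s).measurable
  fun_prop

theorem integrable_phase_mul {F : E → ℂ} (hF : Integrable F) (s t : ℝ) :
    Integrable fun ξ => Complex.exp (Complex.I * ((t * phi s ‖ξ‖ : ℝ) : ℂ)) * F ξ :=
  hF.bdd_mul (measurable_phase s t).aestronglyMeasurable (c := 1)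
    (Eventually.of_forall fun _ => (norm_exp_I_mul _).le)

theorem freeWave_eq (s : ℝ) (F : E → ℂ) (q : ℝ × E) :
    freeWave s F q = (1 / (2 * Real.pi) ^ 5 : ℝ) *
      ∫ ξ, F ξ * Complex.exp (Complex.I * (pairing q (phi s ‖ξ‖, ξ) : ℂ)) := by
  rw [freeWave, invFourierIntegral]
  congr 1
  refine integral_congr_ae (Eventually.of_forall fun ξ => ?_)
  simp only [pairing]
  push_cast
  rw [mul_add, Complex.exp_add]
  ring

theorem continuous_freeWave (s : ℝ) {F : E → ℂ} (hF : Integrable F) :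
    Continuous (freeWave s F) := by
  rw [funext (freeWave_eq s F)]
  refine continuous_const.mul ?_
  refine continuous_of_dominated (bound := fun ξ => ‖F ξ‖) (fun q => ?_) (fun q => ?_) hF.norm ?_
  · refine hF.1.mul (Measurable.aestronglyMeasurable ?_)
    have := (continuous_phi_norm s).measurable
    unfold pairing
    fun_prop
  · refine Eventually.of_forall fun ξ => ?_
    rw [norm_mul, norm_exp_I_mul, mul_one]
  · refine Eventually.of_forall fun ξ => ?_
    unfold pairing
    fun_prop

/-- Squaring adds phases, so space-time sees a pair of frequencies only through its total. The
exponent 4 = 2·2 makes this an L² problem. -/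
theorem freeWave_sq_eq (s : ℝ) (F : E → ℂ) (q : ℝ × E) :
    freeWave s F q ^ 2 = ((1 / (2 * Real.pi) ^ 10 : ℝ) : ℂ) *
      ∫ p : E × E, F p.1 * F p.2 *
        Complex.exp (Complex.I * (pairing q (totalMomentum s p) : ℂ)) := by
  have h : ∀ p : E × E, F p.1 * F p.2 *
      Complex.exp (Complex.I * (pairing q (totalMomentum s p) : ℂ)) =
      (F p.1 * Complex.exp (Complex.I * (pairing q (phi s ‖p.1‖, p.1) : ℂ))) *
      (F p.2 * Complex.exp (Complex.I * (pairing q (phi s ‖p.2‖, p.2) : ℂ))) := fun p => by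
    have : pairing q (totalMomentum s p) =
        pairing q (phi s ‖p.1‖, p.1) + pairing q (phi s ‖p.2‖, p.2) := by
      simp only [pairing, totalMomentum, inner_add_right]
      ring
    rw [this, Complex.ofReal_add, mul_add, Complex.exp_add]
    ring
  simp only [h]
  rw [Measure.volume_eq_prod, integral_prod_mul
    (fun ξ => F ξ * Complex.exp (Complex.I * (pairing q (phi s ‖ξ‖, ξ) : ℂ)))
    (fun ξ => F ξ * Complex.exp (Complex.I * (pairing q (phi s ‖ξ‖, ξ) : ℂ))), freeWave_eq]
  push_cast
  ring

theorem freeWave_sub (s : ℝ) {F G : E → ℂ} (hF : Integrable F) (hG : Integrable G) (q : ℝ × E) :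
    freeWave s (F - G) q = freeWave s F q - freeWave s G q := by
  have key : ∀ {F : E → ℂ}, Integrable F → Integrable fun ξ =>
      F ξ * Complex.exp (Complex.I * (pairing q (phi s ‖ξ‖, ξ) : ℂ)) := fun {F} hF => by
    refine hF.mul_bdd (Measurable.aestronglyMeasurable ?_) (c := 1)
      (Eventually.of_forall fun ξ => (norm_exp_I_mul _).le)
    have := (continuous_phi_norm s).measurable
    unfold pairing
    fun_prop
  rw [freeWave_eq, freeWave_eq, freeWave_eq, ← mul_sub, ← integral_sub (key hF) (key hG)]
  simp only [Pi.sub_apply, sub_mul]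

/-- Pairing the square of a free wave with a test function. -/
theorem integral_freeWave_sq_mul (s : ℝ) {F : E → ℂ} (hF : Integrable F) {Ψ : ℝ × E → ℂ}
    (hΨ : Integrable Ψ) :
    ∫ q, freeWave s F q ^ 2 * Ψ q = ((1 / (2 * Real.pi) ^ 10 : ℝ) : ℂ) *
      ∫ p : E × E, F p.1 * F p.2 * spaceTimeFourier Ψ (totalMomentum s p) := by
  have hT := (continuous_totalMomentum s).measurable
  have hFF : Integrable fun p : E × E => F p.1 * F p.2 := hF.mul_prod hF
  simp only [freeWave_sq_eq, mul_assoc, integral_const_mul]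
  congr 1
  simp only [← integral_mul_const, spaceTimeFourier, ← integral_const_mul]
  rw [integral_integral_swap]
  · refine integral_congr_ae (Eventually.of_forall fun p => ?_)
    refine integral_congr_ae (Eventually.of_forall fun q => ?_)
    simp only
    ring
  · have h1 := (hΨ.mul_prod hFF).mul_bdd (c := 1)
      (g := fun z : (ℝ × E) × (E × E) =>
        Complex.exp (Complex.I * (pairing z.1 (totalMomentum s z.2) : ℂ)))
      (Measurable.aestronglyMeasurable ?_)
      (Eventually.of_forall fun z => (norm_exp_I_mul _).le)
    · refine h1.congr (Eventually.of_forall fun z => ?_)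
      simp only [Function.uncurry]
      ring
    · have := (continuous_phi s).measurable
      unfold pairing
      fun_prop

theorem ae_phi_pos (s : ℝ) : ∀ᵐ ξ : E, 0 < phi s ‖ξ‖ := by
  filter_upwards [Measure.ae_ne volume (0 : E)] with ξ hξ
  exact phi_pos_of_ne (norm_ne_zero_iff.2 hξ)

theorem ae_phi_mul_phi_pos (s : ℝ) : ∀ᵐ p : E × E, 0 < phi s ‖p.1‖ * phi s ‖p.2‖ := by
  have h1 : ∀ᵐ p : E × E, 0 < phi s ‖p.1‖ := Measure.quasiMeasurePreserving_fst.ae (ae_phi_pos s)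
  have h2 : ∀ᵐ p : E × E, 0 < phi s ‖p.2‖ := Measure.quasiMeasurePreserving_snd.ae (ae_phi_pos s)
  filter_upwards [h1, h2] with p h1 h2 using mul_pos h1 h2

/-- The set where the density vanishes has pushforward measure zero, so its preimage is null by
`lintegral_totalMomentum`; no description of the degenerate pairs is needed. -/
theorem ae_phaseWeight_pos (s : ℝ) : ∀ᵐ p : E × E, 0 < phaseWeight s (totalMomentum s p) := by
  have hm : MeasurableSet {q | phaseWeight s q ≤ 0} :=
    measurableSet_le (measurable_phaseWeight s) measurable_const
  have hk : Measurable (Set.indicator {q : ℝ × E | phaseWeight s q ≤ 0} (1 : ℝ × E → ℝ≥0∞)) :=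
    measurable_one.indicator hm
  have h := lintegral_totalMomentum s _ hk
  have h0 : ∫⁻ q, ENNReal.ofReal (phaseWeight s q) *
      Set.indicator {q : ℝ × E | phaseWeight s q ≤ 0} (1 : ℝ × E → ℝ≥0∞) q = 0 := by
    refine (lintegral_congr fun q => ?_).trans lintegral_zero
    by_cases hq : phaseWeight s q ≤ 0
    · rw [ENNReal.ofReal_of_nonpos hq, zero_mul]
    · rw [Set.indicator_of_notMem (by exact hq), mul_zero]
  have hφ := (continuous_phi s).measurable
  have hT := (continuous_totalMomentum s).measurable
  rw [h0, lintegral_eq_zero_iff (by fun_prop)] at h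
  filter_upwards [h, ae_phi_mul_phi_pos s] with p hp hpos
  by_contra hcon
  have h1 := ENNReal.ofReal_pos.2 (one_div_pos.2 hpos)
  rw [Pi.zero_apply, Set.indicator_of_mem (by exact not_lt.1 hcon)] at hp
  exact h1.ne' (by simpa using hp)

/-- The weighted two-particle energy of a frequency profile. -/
noncomputable def pairEnergy (s : ℝ) (F : E → ℂ) : ℝ≥0∞ :=
  ∫⁻ p : E × E, ‖F p.1 * F p.2‖ₑ ^ 2 *
    ENNReal.ofReal (phi s ‖p.1‖ * phi s ‖p.2‖ * phaseWeight s (totalMomentum s p))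

/-- Cauchy-Schwarz with weight g² = φφw. One factor is the pair energy; in the other, 1/(φφ) pushes
forward to the density w, which cancels 1/w and leaves at most the plain L² norm of `k`. -/
theorem sq_lintegral_comp_totalMomentum_le (s : ℝ) {F : E → ℂ}
    (hF : AEStronglyMeasurable F volume) {k : ℝ × E → ℂ} (hk : Measurable k) :
    (∫⁻ p : E × E, ‖F p.1 * F p.2 * k (totalMomentum s p)‖ₑ) ^ 2 ≤
      pairEnergy s F * ∫⁻ q, ‖k q‖ₑ ^ 2 := by
  have hφ := (continuous_phi s).measurable
  have hT := (continuous_totalMomentum s).measurable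
  have hw := measurable_phaseWeight s
  have hFF : AEMeasurable (fun p : E × E => ‖F p.1 * F p.2‖ₑ) := (hF.comp_fst.mul hF.comp_snd).enorm
  set g : E × E → ℝ := fun p => √(phi s ‖p.1‖ * phi s ‖p.2‖ * phaseWeight s (totalMomentum s p))
    with hg
  have hgm : Measurable g := by fun_prop
  have h1 : ∫⁻ p : E × E, ‖F p.1 * F p.2 * k (totalMomentum s p)‖ₑ =
      ∫⁻ p : E × E, (‖F p.1 * F p.2‖ₑ * ENNReal.ofReal (g p)) *
        (ENNReal.ofReal (g p)⁻¹ * ‖k (totalMomentum s p)‖ₑ) := by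
    refine lintegral_congr_ae ?_
    filter_upwards [ae_phi_mul_phi_pos s, ae_phaseWeight_pos s] with p hp1 hp2
    have hgp : 0 < g p := Real.sqrt_pos.2 (mul_pos hp1 hp2)
    calc _ = ‖F p.1 * F p.2‖ₑ * (ENNReal.ofReal (g p) * ENNReal.ofReal (g p)⁻¹) *
          ‖k (totalMomentum s p)‖ₑ := by
          rw [← ENNReal.ofReal_mul hgp.le, mul_inv_cancel₀ hgp.ne', ENNReal.ofReal_one, mul_one,
            enorm_mul]
      _ = _ := by ring
  have h2 : ∫⁻ p : E × E, (‖F p.1 * F p.2‖ₑ * ENNReal.ofReal (g p)) ^ 2 = pairEnergy s F := by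
    refine lintegral_congr fun p => ?_
    rw [mul_pow, ← ENNReal.ofReal_pow (Real.sqrt_nonneg _), Real.sq_sqrt]
    exact mul_nonneg (mul_nonneg (phi_nonneg _ _) (phi_nonneg _ _)) (phaseWeight_nonneg _ _)
  have h3 : ∫⁻ p : E × E, (ENNReal.ofReal (g p)⁻¹ * ‖k (totalMomentum s p)‖ₑ) ^ 2 ≤
      ∫⁻ q, ‖k q‖ₑ ^ 2 := by
    calc _ = ∫⁻ p : E × E, ENNReal.ofReal (1 / (phi s ‖p.1‖ * phi s ‖p.2‖)) *
          (fun q => ENNReal.ofReal (phaseWeight s q)⁻¹ * ‖k q‖ₑ ^ 2) (totalMomentum s p) := by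
          refine lintegral_congr fun p => ?_
          have h0 := mul_nonneg (phi_nonneg s ‖p.1‖) (phi_nonneg s ‖p.2‖)
          simp only
          rw [mul_pow, ← ENNReal.ofReal_pow (inv_nonneg.2 (Real.sqrt_nonneg _)), inv_pow,
            Real.sq_sqrt (mul_nonneg h0 (phaseWeight_nonneg _ _)), mul_inv,
            ENNReal.ofReal_mul (inv_nonneg.2 h0), one_div, mul_assoc]
      _ = ∫⁻ q, ENNReal.ofReal (phaseWeight s q) *
          (ENNReal.ofReal (phaseWeight s q)⁻¹ * ‖k q‖ₑ ^ 2) :=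
          lintegral_totalMomentum s (fun q => ENNReal.ofReal (phaseWeight s q)⁻¹ * ‖k q‖ₑ ^ 2)
            (by fun_prop)
      _ ≤ _ := by
          refine lintegral_mono fun q => ?_
          rw [← mul_assoc, ← ENNReal.ofReal_mul (phaseWeight_nonneg _ _)]
          refine mul_le_of_le_one_left' ?_
          rw [ENNReal.ofReal_le_one]
          exact mul_inv_le_one
  rw [h1]
  refine (sq_lintegral_mul_le (by fun_prop) (by fun_prop)).trans ?_
  rw [h2]
  gcongr

end KleinGordon

/-! ### The L⁴ bound for integrable profiles, and equality for the exponential ones -/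

namespace KleinGordon

theorem measurable_spaceTimeFourier {Ψ : ℝ × E → ℂ} (hΨ : Integrable Ψ) :
    Measurable (spaceTimeFourier Ψ) := by
  refine (continuous_of_dominated (bound := fun q => ‖Ψ q‖) (fun q => ?_) (fun q => ?_)
    hΨ.norm ?_).measurable
  · refine hΨ.1.mul (Measurable.aestronglyMeasurable ?_)
    unfold pairing
    fun_prop
  · refine Eventually.of_forall fun q' => ?_
    rw [norm_mul, norm_exp_I_mul, mul_one]
  · refine Eventually.of_forall fun q' => ?_
    unfold pairing
    fun_prop

theorem enorm_inv_two_pi_pow : ‖((1 / (2 * Real.pi) ^ 10 : ℝ) : ℂ)‖ₑ =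
    (ENNReal.ofReal (2 * Real.pi) ^ 10)⁻¹ := by
  rw [← enorm_norm, Complex.norm_real, enorm_norm, Real.enorm_of_nonneg (by positivity), one_div,
    ENNReal.ofReal_inv_of_pos (by positivity), ENNReal.ofReal_pow (by positivity)]

theorem inv_two_pi_pow : ((ENNReal.ofReal (2 * Real.pi) ^ 10)⁻¹) ^ 2 *
    ENNReal.ofReal (2 * Real.pi) ^ 6 = (ENNReal.ofReal (2 * Real.pi) ^ 14)⁻¹ := by
  have hp0 : ENNReal.ofReal (2 * Real.pi) ≠ 0 := (ENNReal.ofReal_pos.2 (by positivity)).ne'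
  have hp1 : ENNReal.ofReal (2 * Real.pi) ≠ ∞ := ENNReal.ofReal_ne_top
  rw [← ENNReal.inv_pow, ← pow_mul, show 10 * 2 = 14 + 6 by norm_num, pow_add,
    ENNReal.mul_inv (Or.inr (ENNReal.pow_ne_top hp1)) (Or.inr (pow_ne_zero _ hp0)),
    mul_assoc, ENNReal.inv_mul_cancel (pow_ne_zero _ hp0) (ENNReal.pow_ne_top hp1),
    mul_one]

/-- Duality with the conjugate of u² cut off to a ball. Writing L for the integral and K for the
bound, this yields L² ≤ K·L, and the cutoff makes L finite so that it can be cancelled. -/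
theorem lintegral_freeWave_pow_four_le_of_isBounded (s : ℝ) {F : E → ℂ} (hF : Integrable F)
    (r : ℝ) : ∫⁻ q in Metric.closedBall 0 r, ‖freeWave s F q‖ₑ ^ 4 ≤
      (ENNReal.ofReal (2 * Real.pi) ^ 14)⁻¹ * pairEnergy s F := by
  set B : Set (ℝ × E) := Metric.closedBall 0 r with hB
  have hBm : MeasurableSet B := Metric.isClosed_closedBall.measurableSet
  have hu := continuous_freeWave s hF
  set Ψ : ℝ × E → ℂ := B.indicator fun q => (starRingEnd ℂ) (freeWave s F q ^ 2) with hΨ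
  have hc : Continuous fun q => (starRingEnd ℂ) (freeWave s F q ^ 2) :=
    Complex.continuous_conj.comp (hu.pow 2)
  have hK : IsCompact B := isCompact_closedBall 0 r
  have hΨ1 : Integrable Ψ := (hc.continuousOn.integrableOn_compact hK).integrable_indicator hBm
  have hΨsq : Integrable fun q => ‖Ψ q‖ ^ 2 := by
    have h1 : Integrable (B.indicator fun q => ‖freeWave s F q‖ ^ 4) :=
      ((hu.norm.pow 4).continuousOn.integrableOn_compact hK).integrable_indicator hBm
    refine h1.congr (Eventually.of_forall fun q => ?_)
    by_cases hq : q ∈ B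
    · simp only [hΨ, Set.indicator_of_mem hq, RCLike.norm_conj, norm_pow]
      ring
    · simp [hΨ, Set.indicator_of_notMem hq]
  have hΨ2 : MemLp Ψ 2 volume := (memLp_two_iff_integrable_sq_norm hΨ1.1).2 hΨsq
  set L := ∫⁻ q in B, ‖freeWave s F q‖ₑ ^ 4 with hL
  have hLΨ : ∫⁻ q, ‖Ψ q‖ₑ ^ 2 = L := by
    rw [hL, ← lintegral_indicator hBm]
    refine lintegral_congr fun q => ?_
    by_cases hq : q ∈ B
    · simp only [hΨ, Set.indicator_of_mem hq, RCLike.enorm_conj, enorm_pow]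
      ring
    · simp [hΨ, Set.indicator_of_notMem hq]
  have hLtop : L ≠ ∞ := by
    rw [← hLΨ, lintegral_enorm_sq_eq_eLpNorm]
    exact ENNReal.pow_ne_top hΨ2.2.ne
  have hdual : L = ‖∫ q, freeWave s F q ^ 2 * Ψ q‖ₑ := by
    have h1 : ∫ q, freeWave s F q ^ 2 * Ψ q = ((∫ q, ‖Ψ q‖ ^ 2 : ℝ) : ℂ) := by
      rw [← integral_complex_ofReal]
      refine integral_congr_ae (Eventually.of_forall fun q => ?_)
      by_cases hq : q ∈ B
      · simp only [hΨ, Set.indicator_of_mem hq]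
        rw [Complex.mul_conj, Complex.normSq_eq_norm_sq, RCLike.norm_conj]
      · simp [hΨ, Set.indicator_of_notMem hq]
    rw [h1, ← hLΨ, ← enorm_norm, Complex.norm_real, enorm_norm,
      Real.enorm_of_nonneg (integral_nonneg fun _ => by positivity),
      ofReal_integral_eq_lintegral_ofReal hΨsq (Eventually.of_forall fun _ => by positivity)]
    refine lintegral_congr fun q => ?_
    rw [ENNReal.ofReal_pow (norm_nonneg _), ofReal_norm]
  set κ := ENNReal.ofReal (2 * Real.pi) with hκ
  have hle : L ^ 2 ≤ (κ ^ 14)⁻¹ * pairEnergy s F * L := by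
    calc L ^ 2 = ((κ ^ 10)⁻¹ * ‖∫ p : E × E, F p.1 * F p.2 *
          spaceTimeFourier Ψ (totalMomentum s p)‖ₑ) ^ 2 := by
          rw [hdual, integral_freeWave_sq_mul s hF hΨ1, enorm_mul, enorm_inv_two_pi_pow]
      _ ≤ ((κ ^ 10)⁻¹ * ∫⁻ p : E × E, ‖F p.1 * F p.2 *
          spaceTimeFourier Ψ (totalMomentum s p)‖ₑ) ^ 2 := by
          gcongr
          exact enorm_integral_le_lintegral_enorm _
      _ ≤ ((κ ^ 10)⁻¹) ^ 2 * (pairEnergy s F * (κ ^ 6 * L)) := by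
          rw [mul_pow, ← hLΨ, ← lintegral_spaceTimeFourier hΨ1 hΨ2]
          gcongr
          exact sq_lintegral_comp_totalMomentum_le s hF.1 (measurable_spaceTimeFourier hΨ1)
      _ = _ := by
          rw [← inv_two_pi_pow]
          ring
  rcases eq_or_ne L 0 with h0 | h0
  · rw [h0]; exact zero_le
  · rw [sq] at hle
    exact (ENNReal.mul_le_mul_iff_left h0 hLtop).1 hle

/-- The `L⁴` bound for the free evolution of an integrable frequency profile. -/
theorem lintegral_freeWave_pow_four_le (s : ℝ) {F : E → ℂ} (hF : Integrable F) :
    ∫⁻ q, ‖freeWave s F q‖ₑ ^ 4 ≤ (ENNReal.ofReal (2 * Real.pi) ^ 14)⁻¹ * pairEnergy s F := by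
  have hmono : Monotone fun n : ℕ => Metric.closedBall (0 : ℝ × E) n := fun m n h =>
    Metric.closedBall_subset_closedBall (by exact_mod_cast h)
  have := setLIntegral_iUnion_of_directed (μ := volume) (fun q => ‖freeWave s F q‖ₑ ^ 4)
    hmono.directed_le
  rw [Metric.iUnion_closedBall_nat, setLIntegral_univ] at this
  rw [this]
  exact iSup_le fun n => lintegral_freeWave_pow_four_le_of_isBounded s hF n

/-- The two-particle phase space measure, pushed forward to total energy and momentum. -/
theorem map_totalMomentum (s : ℝ) :
    ((volume : Measure (E × E)).withDensity fun p =>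
      ENNReal.ofReal (1 / (phi s ‖p.1‖ * phi s ‖p.2‖))).map (totalMomentum s) =
    (volume : Measure (ℝ × E)).withDensity fun q => ENNReal.ofReal (phaseWeight s q) := by
  have hφ := (continuous_phi s).measurable
  have hT := (continuous_totalMomentum s).measurable
  have hw := measurable_phaseWeight s
  refine Measure.ext_of_lintegral _ fun k hk => ?_
  rw [lintegral_map hk hT, lintegral_withDensity_eq_lintegral_mul _ (by fun_prop) (by fun_prop),
    lintegral_withDensity_eq_lintegral_mul _ (by fun_prop) hk]
  exact lintegral_totalMomentum s k hk

theorem integral_totalMomentum (s : ℝ) {k : ℝ × E → ℂ} (hk : Measurable k) :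
    ∫ p : E × E, ((1 / (phi s ‖p.1‖ * phi s ‖p.2‖) : ℝ) : ℂ) * k (totalMomentum s p) =
      ∫ q, (phaseWeight s q : ℂ) * k q := by
  have hφ := (continuous_phi s).measurable
  have hT := (continuous_totalMomentum s).measurable
  have hw := measurable_phaseWeight s
  have h1 := integral_map (μ := (volume : Measure (E × E)).withDensity fun p =>
      ENNReal.ofReal (1 / (phi s ‖p.1‖ * phi s ‖p.2‖))) hT.aemeasurable
      (f := k) hk.aestronglyMeasurable
  rw [map_totalMomentum, integral_withDensity_eq_integral_toReal_smul (by fun_prop) (by simp),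
    integral_withDensity_eq_integral_toReal_smul (by fun_prop) (by simp)] at h1
  simp only [Complex.real_smul, ENNReal.toReal_ofReal (phaseWeight_nonneg s _)] at h1
  rw [h1]
  refine integral_congr_ae (Eventually.of_forall fun p => ?_)
  simp only
  rw [ENNReal.toReal_ofReal]
  exact one_div_nonneg.2 (mul_nonneg (phi_nonneg _ _) (phi_nonneg _ _))

/-- A radial function with an exponentially decaying profile, and a singularity at the origin of
order at most two, is integrable. -/
theorem integrable_radial {g : ℝ → ℝ} (hg : Measurable g) {C a : ℝ} (ha : 0 < a)
    (h : ∀ r, 0 < r → |g r| * r ^ 2 ≤ C * Real.exp (-(a * r))) :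
    Integrable fun ξ : E => g ‖ξ‖ := by
  rw [integrable_fun_norm_addHaar volume (f := g)]
  have h1 : IntegrableOn (fun r : ℝ => C * (r ^ 2 * Real.exp (-(a * r)))) (Set.Ioi 0) := by
    have := (integrableOn_rpow_mul_exp_neg_mul_rpow (s := 2) (p := 1) (b := a) (by norm_num)
      one_pos ha).const_mul C
    refine IntegrableOn.congr_fun this (fun r hr => ?_) measurableSet_Ioi
    simp
  refine Integrable.mono' h1 (by fun_prop) ?_
  refine (ae_restrict_iff' measurableSet_Ioi).2 (Eventually.of_forall fun r (hr : 0 < r) => ?_)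
  rw [finrank_euclideanSpace, Fintype.card_fin, smul_eq_mul, norm_mul, Real.norm_eq_abs,
    Real.norm_eq_abs, abs_of_nonneg (by positivity)]
  calc r ^ (5 - 1) * |g r| = r ^ 2 * (|g r| * r ^ 2) := by ring
    _ ≤ r ^ 2 * (C * Real.exp (-(a * r))) :=
        mul_le_mul_of_nonneg_left (h r hr) (by positivity)
    _ = _ := by ring

theorem exp_neg_phi_le {a : ℝ} (ha : 0 < a) (s r : ℝ) :
    Real.exp (-(a * phi s r)) ≤ Real.exp (-(a * r)) := by
  have : a * r ≤ a * phi s r := by gcongr; exact le_phi_right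
  exact Real.exp_le_exp.2 (by linarith)

/-- Polynomial factors are absorbed by an exponential. -/
theorem exists_pow_mul_exp_neg_le (n : ℕ) {a : ℝ} (ha : 0 < a) :
    ∃ C, 0 ≤ C ∧ ∀ r, 0 ≤ r → r ^ n * Real.exp (-(2 * a * r)) ≤ C * Real.exp (-(a * r)) := by
  refine ⟨n.factorial / a ^ n, by positivity, fun r hr => ?_⟩
  have h1 : (a * r) ^ n / n.factorial ≤ Real.exp (a * r) :=
    Real.pow_div_factorial_le_exp _ (by positivity) n
  have h2 : r ^ n ≤ n.factorial / a ^ n * Real.exp (a * r) := by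
    rw [mul_pow, div_le_iff₀ (by positivity)] at h1
    rw [div_mul_eq_mul_div, le_div_iff₀ (by positivity)]
    linarith
  calc r ^ n * Real.exp (-(2 * a * r))
      ≤ n.factorial / a ^ n * Real.exp (a * r) * Real.exp (-(2 * a * r)) := by gcongr
    _ = _ := by rw [mul_assoc, ← Real.exp_add]; ring_nf

/-- `e^{-aφ_s} φ_s^{-m}` is integrable on `E` for `m ≤ 2`. -/
theorem integrable_exp_neg_phi_div (s : ℝ) {a : ℝ} (ha : 0 < a) {m : ℕ} (hm : m ≤ 2) :
    Integrable fun ξ : E => Real.exp (-(a * phi s ‖ξ‖)) / phi s ‖ξ‖ ^ m := by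
  have hφ := (continuous_phi s).measurable
  -- Half of the decay rate absorbs r^(2−m); the other half remains for integrability.
  obtain ⟨C, hC0, hC⟩ := exists_pow_mul_exp_neg_le (2 - m) (half_pos ha)
  refine integrable_radial (g := fun r => Real.exp (-(a * phi s r)) / phi s r ^ m) (by fun_prop)
    (half_pos ha) (C := C) fun r hr => ?_
  have hpos : 0 < phi s r := phi_pos_of_ne hr.ne'
  rw [abs_of_nonneg (by positivity)]
  refine le_trans ?_ (hC r hr.le)
  rw [show 2 * (a / 2) * r = a * r by ring, show r ^ 2 = r ^ (2 - m) * r ^ m by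
    rw [← pow_add, Nat.sub_add_cancel hm]]
  have h1 : r ^ m / phi s r ^ m ≤ 1 :=
    div_le_one_of_le₀ (by gcongr; exact le_phi_right) (by positivity)
  calc _ = Real.exp (-(a * phi s r)) * r ^ (2 - m) * (r ^ m / phi s r ^ m) := by ring
    _ ≤ Real.exp (-(a * phi s r)) * r ^ (2 - m) * 1 := by gcongr
    _ ≤ Real.exp (-(a * r)) * r ^ (2 - m) := by
        rw [mul_one]
        exact mul_le_mul_of_nonneg_right (exp_neg_phi_le ha s r) (by positivity)
    _ = _ := by ring

theorem integrable_faHat (s : ℝ) {a : ℝ} (ha : 0 < a) : Integrable (faHat s a) := by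
  have := (integrable_exp_neg_phi_div s ha (m := 1) (by norm_num)).ofReal (𝕜 := ℂ)
  simp only [pow_one] at this
  exact this

theorem phaseWeight_totalMomentum_le (s : ℝ) (p : E × E) :
    phaseWeight s (totalMomentum s p) ≤ 2 * Real.pi ^ 2 / 3 * (lorentz s p - s ^ 2) := by
  rw [phaseWeight_totalMomentum]
  have h := sq_le_lorentz s p
  have h1 : √((lorentz s p - s ^ 2) / (lorentz s p + s ^ 2)) ≤ 1 := by
    rw [Real.sqrt_le_one]
    exact div_le_one_of_le₀ (by nlinarith [sq_nonneg s]) (by nlinarith [sq_nonneg s])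
  gcongr
  exact mul_le_of_le_one_right (by linarith) h1

/-- The pair energy is controlled by the energy. -/
theorem pairEnergy_le (s : ℝ) {F : E → ℂ} (hF : AEStronglyMeasurable F volume) :
    pairEnergy s F ≤ ENNReal.ofReal (4 * Real.pi ^ 2 / 3) *
      (∫⁻ ξ, ‖((phi s ‖ξ‖ : ℝ) : ℂ) * F ξ‖ₑ ^ 2) ^ 2 := by
  have hφ := (continuous_phi s).measurable
  have hm : AEMeasurable (fun ξ => ‖((phi s ‖ξ‖ : ℝ) : ℂ) * F ξ‖ₑ ^ 2) volume := by
    have := hF.aemeasurable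
    fun_prop
  rw [sq (∫⁻ ξ, _), ← lintegral_prod_mul hm hm, ← lintegral_const_mul' _ _ ENNReal.ofReal_ne_top,
    ← Measure.volume_eq_prod]
  refine lintegral_mono fun p => ?_
  have h0 := mul_nonneg (phi_nonneg s ‖p.1‖) (phi_nonneg s ‖p.2‖)
  -- Using P ≤ 2φφ loses the sharp constant, but suffices for finiteness and for convergence in L⁴.
  have hle : phi s ‖p.1‖ * phi s ‖p.2‖ * phaseWeight s (totalMomentum s p) ≤
      4 * Real.pi ^ 2 / 3 * (phi s ‖p.1‖ * phi s ‖p.2‖) ^ 2 := by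
    have h1 : phaseWeight s (totalMomentum s p) ≤
        2 * Real.pi ^ 2 / 3 * (2 * (phi s ‖p.1‖ * phi s ‖p.2‖)) := by
      refine (phaseWeight_totalMomentum_le s p).trans ?_
      have := lorentz_le s p
      gcongr
      nlinarith [sq_nonneg s]
    calc _ ≤ phi s ‖p.1‖ * phi s ‖p.2‖ *
          (2 * Real.pi ^ 2 / 3 * (2 * (phi s ‖p.1‖ * phi s ‖p.2‖))) := by gcongr
      _ = _ := by ring
  have he : ∀ ξ : E, ‖((phi s ‖ξ‖ : ℝ) : ℂ)‖ₑ = ENNReal.ofReal (phi s ‖ξ‖) := fun ξ => by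
    rw [← enorm_norm, Complex.norm_real, enorm_norm, Real.enorm_of_nonneg (phi_nonneg _ _)]
  calc _ ≤ ‖F p.1 * F p.2‖ₑ ^ 2 *
        ENNReal.ofReal (4 * Real.pi ^ 2 / 3 * (phi s ‖p.1‖ * phi s ‖p.2‖) ^ 2) := by gcongr
    _ = _ := by
        rw [ENNReal.ofReal_mul (by positivity), ENNReal.ofReal_pow h0,
          ENNReal.ofReal_mul (phi_nonneg _ _)]
        simp only [enorm_mul, he]
        ring

theorem lintegral_phi_mul_faHat_ne_top (s : ℝ) {a : ℝ} (ha : 0 < a) :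
    ∫⁻ ξ, ‖((phi s ‖ξ‖ : ℝ) : ℂ) * faHat s a ξ‖ₑ ^ 2 ≠ ∞ := by
  have h := (integrable_exp_neg_phi_div s (show 0 < 2 * a by positivity) (m := 0) (by norm_num))
  have h1 : ∀ᵐ ξ : E, ‖((phi s ‖ξ‖ : ℝ) : ℂ) * faHat s a ξ‖ₑ ^ 2 =
      ‖Real.exp (-(2 * a * phi s ‖ξ‖)) / phi s ‖ξ‖ ^ 0‖ₑ := by
    filter_upwards [ae_phi_pos s] with ξ hξ
    rw [faHat, ← Complex.ofReal_mul, ← enorm_pow, ← Complex.ofReal_pow, ← enorm_norm,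
      Complex.norm_real, enorm_norm]
    congr 1
    rw [mul_div_cancel₀ _ hξ.ne', pow_zero, div_one, ← Real.exp_nat_mul]
    push_cast
    ring_nf
  rw [lintegral_congr_ae h1]
  exact h.2.ne

/-- This is the case of equality in the weighted Cauchy-Schwarz inequality: apart from the density
1/(φφ), the product depends on the total energy only. -/
theorem faHat_mul_faHat (s a : ℝ) (p : E × E) : faHat s a p.1 * faHat s a p.2 =
    ((1 / (phi s ‖p.1‖ * phi s ‖p.2‖) : ℝ) : ℂ) *
      ((Real.exp (-(a * (totalMomentum s p).1)) : ℝ) : ℂ) := by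
  rw [faHat, faHat, ← Complex.ofReal_mul, ← Complex.ofReal_mul, totalMomentum, mul_add, neg_add,
    Real.exp_add]
  congr 1
  ring

/-- The profile `e^{-aφ_s}/φ_s` attains equality in the `L⁴` bound. -/
theorem lintegral_freeWave_faHat (s : ℝ) {a : ℝ} (ha : 0 < a) :
    ∫⁻ q, ‖freeWave s (faHat s a) q‖ₑ ^ 4 =
      (ENNReal.ofReal (2 * Real.pi) ^ 14)⁻¹ * pairEnergy s (faHat s a) := by
  have hφ := (continuous_phi s).measurable
  have hT := (continuous_totalMomentum s).measurable
  have hw := measurable_phaseWeight s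
  have hF := integrable_faHat s ha
  set G : ℝ × E → ℂ := fun q => (phaseWeight s q : ℂ) * ((Real.exp (-(a * q.1)) : ℝ) : ℂ) with hG
  have hGm : Measurable G := by fun_prop
  have hGe : ∀ q, ‖G q‖ₑ =
      ENNReal.ofReal (phaseWeight s q) * ENNReal.ofReal (Real.exp (-(a * q.1))) := fun q => by
    simp only [hG]
    rw [← Complex.ofReal_mul, ← enorm_norm, Complex.norm_real, enorm_norm,
      Real.enorm_of_nonneg (mul_nonneg (phaseWeight_nonneg s q) (Real.exp_pos _).le),
      ENNReal.ofReal_mul (phaseWeight_nonneg s q)]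
  have hFe : ∀ p : E × E, ‖faHat s a p.1 * faHat s a p.2‖ₑ =
      ENNReal.ofReal (1 / (phi s ‖p.1‖ * phi s ‖p.2‖)) *
        ENNReal.ofReal (Real.exp (-(a * (totalMomentum s p).1))) := fun p => by
    have h0 : 0 ≤ 1 / (phi s ‖p.1‖ * phi s ‖p.2‖) :=
      one_div_nonneg.2 (mul_nonneg (phi_nonneg _ _) (phi_nonneg _ _))
    rw [faHat_mul_faHat, ← Complex.ofReal_mul, ← enorm_norm, Complex.norm_real, enorm_norm,
      Real.enorm_of_nonneg (mul_nonneg h0 (Real.exp_pos _).le), ENNReal.ofReal_mul h0]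
  have hG1 : Integrable G := by
    refine ⟨hGm.aestronglyMeasurable, ?_⟩
    have h1 := lintegral_totalMomentum s (fun q => ENNReal.ofReal (Real.exp (-(a * q.1))))
      (by fun_prop)
    rw [HasFiniteIntegral, lintegral_congr hGe, ← h1, ← lintegral_congr hFe]
    exact (hF.mul_prod hF).2
  have hG2' : ∫⁻ q, ‖G q‖ₑ ^ 2 = pairEnergy s (faHat s a) := by
    have h1 := lintegral_totalMomentum s (fun q => ENNReal.ofReal (phaseWeight s q) *
      ENNReal.ofReal (Real.exp (-(a * q.1))) ^ 2) (by fun_prop)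
    have h2 : ∀ q, ‖G q‖ₑ ^ 2 = ENNReal.ofReal (phaseWeight s q) *
      (ENNReal.ofReal (phaseWeight s q) * ENNReal.ofReal (Real.exp (-(a * q.1))) ^ 2) := by
      intro q
      rw [hGe]
      ring
    rw [lintegral_congr h2, ← h1, pairEnergy]
    refine lintegral_congr_ae ?_
    filter_upwards [ae_phi_mul_phi_pos s] with p hp
    have h3 : ENNReal.ofReal (1 / (phi s ‖p.1‖ * phi s ‖p.2‖)) *
        ENNReal.ofReal (phi s ‖p.1‖ * phi s ‖p.2‖) = 1 := by
      rw [← ENNReal.ofReal_mul (by positivity), one_div_mul_cancel hp.ne', ENNReal.ofReal_one]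
    rw [hFe, ENNReal.ofReal_mul hp.le]
    calc _ = ENNReal.ofReal (1 / (phi s ‖p.1‖ * phi s ‖p.2‖)) * 1 *
          (ENNReal.ofReal (phaseWeight s (totalMomentum s p)) *
            ENNReal.ofReal (Real.exp (-(a * (totalMomentum s p).1))) ^ 2) := by rw [mul_one]
      _ = _ := by rw [← h3]; ring
  have hfin : pairEnergy s (faHat s a) ≠ ∞ :=
    ne_top_of_le_ne_top (ENNReal.mul_ne_top ENNReal.ofReal_ne_top
      (ENNReal.pow_ne_top (lintegral_phi_mul_faHat_ne_top s ha))) (pairEnergy_le s hF.1)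
  have hG2 : MemLp G 2 volume := by
    refine ⟨hG1.1, ?_⟩
    rw [← hG2', lintegral_enorm_sq_eq_eLpNorm] at hfin
    exact lt_top_iff_ne_top.2 fun h => hfin (by rw [h]; simp)
  -- The pushforward exhibits u² as a multiple of the transform of `G`, so Plancherel alone computes
  -- its L² norm and no inequality is used.
  have hsq : ∀ q, freeWave s (faHat s a) q ^ 2 =
      ((1 / (2 * Real.pi) ^ 10 : ℝ) : ℂ) * spaceTimeFourier G q := fun q => by
    rw [freeWave_sq_eq]
    congr 1
    have h1 := integral_totalMomentum s (k := fun q' =>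
      ((Real.exp (-(a * q'.1)) : ℝ) : ℂ) * Complex.exp (Complex.I * (pairing q q' : ℂ)))
      (by unfold pairing; fun_prop)
    simp only [faHat_mul_faHat, mul_assoc]
    rw [h1, spaceTimeFourier]
    refine integral_congr_ae (Eventually.of_forall fun q' => ?_)
    simp only [hG, mul_assoc]
    rw [pairing_comm]
  set κ := ENNReal.ofReal (2 * Real.pi) with hκ
  calc ∫⁻ q, ‖freeWave s (faHat s a) q‖ₑ ^ 4
      = ∫⁻ q, ((κ ^ 10)⁻¹) ^ 2 * ‖spaceTimeFourier G q‖ₑ ^ 2 := by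
        refine lintegral_congr fun q => ?_
        rw [show 4 = 2 * 2 by norm_num, pow_mul, ← enorm_pow, hsq, enorm_mul, enorm_inv_two_pi_pow, mul_pow]
    _ = ((κ ^ 10)⁻¹) ^ 2 * κ ^ 6 * pairEnergy s (faHat s a) := by
        have := measurable_spaceTimeFourier hG1
        rw [lintegral_const_mul _ (by fun_prop), lintegral_spaceTimeFourier hG1 hG2, hG2',
          mul_assoc]
    _ = _ := by
        rw [inv_two_pi_pow]

end KleinGordon

/-! ### Approximation by profiles of bounded frequency -/

namespace KleinGordon

theorem lintegral_enorm_pow_four_eq_eLpNorm {α : Type*} {m : MeasurableSpace α} {μ : Measure α}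
    (f : α → ℂ) : ∫⁻ x, ‖f x‖ₑ ^ 4 ∂μ = eLpNorm f 4 μ ^ 4 := by
  simpa using (eLpNorm_nnreal_pow_eq_lintegral (f := f) (μ := μ) (p := 4) four_ne_zero).symm

theorem inv_two_pi_pow_mul_le_one :
    (ENNReal.ofReal (2 * Real.pi) ^ 14)⁻¹ * ENNReal.ofReal (4 * Real.pi ^ 2 / 3) ≤ 1 := by
  rw [← ENNReal.ofReal_pow (by positivity), ← ENNReal.ofReal_inv_of_pos (by positivity),
    ← ENNReal.ofReal_mul (by positivity), ENNReal.ofReal_le_one, ← div_eq_inv_mul,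
    div_le_one (by positivity)]
  have h1 : (1 : ℝ) ≤ 2 * Real.pi := by linarith [Real.two_le_pi]
  calc 4 * Real.pi ^ 2 / 3 ≤ (2 * Real.pi) ^ 2 := by nlinarith [sq_nonneg Real.pi]
    _ ≤ (2 * Real.pi) ^ 14 := pow_le_pow_right₀ h1 (by norm_num)

/-- The constant 1 is far from sharp. Applied to differences of profiles, the bound transports
Cauchy sequences from the energy norm to L⁴. -/
theorem eLpNorm_freeWave_le (s : ℝ) {F : E → ℂ} (hF : Integrable F) :
    eLpNorm (freeWave s F) 4 volume ≤
      eLpNorm (fun ξ => ((phi s ‖ξ‖ : ℝ) : ℂ) * F ξ) 2 volume := by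
  refine (ENNReal.pow_le_pow_left_iff four_ne_zero).1 ?_
  rw [← lintegral_enorm_pow_four_eq_eLpNorm]
  calc _ ≤ (ENNReal.ofReal (2 * Real.pi) ^ 14)⁻¹ * (ENNReal.ofReal (4 * Real.pi ^ 2 / 3) *
        (∫⁻ ξ, ‖((phi s ‖ξ‖ : ℝ) : ℂ) * F ξ‖ₑ ^ 2) ^ 2) :=
        (lintegral_freeWave_pow_four_le s hF).trans (by gcongr; exact pairEnergy_le s hF.1)
    _ ≤ 1 * (∫⁻ ξ, ‖((phi s ‖ξ‖ : ℝ) : ℂ) * F ξ‖ₑ ^ 2) ^ 2 := by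
        rw [← mul_assoc]
        gcongr
        exact inv_two_pi_pow_mul_le_one
    _ = _ := by rw [lintegral_enorm_sq_eq_eLpNorm]; ring

/-! ### Frequency truncation -/

/-- Restriction of a frequency profile to a ball. -/
noncomputable def truncate (F : E → ℂ) (n : ℕ) : E → ℂ :=
  (Metric.closedBall (0 : E) n).indicator F

theorem norm_truncate_le (F : E → ℂ) (n : ℕ) (ξ : E) : ‖truncate F n ξ‖ ≤ ‖F ξ‖ :=
  norm_indicator_le_norm_self _ _

theorem truncate_eventually_eq (F : E → ℂ) (ξ : E) : ∀ᶠ n in atTop, truncate F n ξ = F ξ := by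
  obtain ⟨N, hN⟩ := exists_nat_ge ‖ξ‖
  filter_upwards [eventually_ge_atTop N] with n hn
  refine Set.indicator_of_mem ?_ _
  rw [mem_closedBall_zero_iff]
  exact hN.trans (by exact_mod_cast hn)

/-- On a ball F = (φF)·(1/φ), and 1/φ is square integrable there even for s = 0, since r⁻² is
integrable near the origin in dimension five. -/
theorem integrable_truncate {s : ℝ} {F : E → ℂ}
    (hF2 : MemLp (fun ξ => ((phi s ‖ξ‖ : ℝ) : ℂ) * F ξ) 2 volume) (n : ℕ) :
    Integrable (truncate F n) := by
  have hφ := (continuous_phi s).measurable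
  set g : E → ℂ := fun ξ => (((if ‖ξ‖ ≤ n then 1 / phi s ‖ξ‖ else 0 : ℝ)) : ℂ) with hg
  have hgm : Measurable g := by
    refine Complex.measurable_ofReal.comp (Measurable.ite ?_ (by fun_prop) measurable_const)
    exact measurableSet_le (by fun_prop) measurable_const
  have hg2 : MemLp g 2 volume := by
    rw [memLp_two_iff_integrable_sq_norm hgm.aestronglyMeasurable]
    -- The constant eⁿ makes the exponential majorant at least 1 on the support r ≤ n.
    have h := integrable_radial (g := fun r => (if r ≤ n then 1 / phi s r else 0) ^ 2)
      (Measurable.pow_const (Measurable.ite (measurableSet_le measurable_id measurable_const)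
        (by fun_prop) measurable_const) 2) one_pos (C := Real.exp n) fun r hr => ?_
    · refine h.congr (Eventually.of_forall fun ξ => ?_)
      simp only [hg, Complex.norm_real, Real.norm_eq_abs, sq_abs]
    · have hpos : 0 < phi s r := phi_pos_of_ne hr.ne'
      rw [abs_of_nonneg (by positivity), ← Real.exp_add]
      split_ifs with hrn
      · have h1 : (1 / phi s r) ^ 2 * r ^ 2 ≤ 1 := by
          rw [one_div, inv_pow, inv_mul_le_one₀ (by positivity)]
          gcongr
          exact le_phi_right
        refine h1.trans (Real.one_le_exp ?_)
        linarith
      · rw [zero_pow two_ne_zero, zero_mul]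
        positivity
  have h := hF2.integrable_mul hg2
  refine h.congr ?_
  filter_upwards [ae_phi_pos s] with ξ hξ
  simp only [Pi.mul_apply, hg, truncate]
  by_cases hn : ‖ξ‖ ≤ n
  · rw [Set.indicator_of_mem (by simpa using hn), if_pos hn]
    have : ((phi s ‖ξ‖ : ℝ) : ℂ) ≠ 0 := by exact_mod_cast hξ.ne'
    push_cast
    field_simp
  · rw [Set.indicator_of_notMem (by simpa using hn), if_neg hn]
    simp

theorem memLp_phi_mul_truncate {s : ℝ} {F : E → ℂ} (hF : AEStronglyMeasurable F volume)
    (hF2 : MemLp (fun ξ => ((phi s ‖ξ‖ : ℝ) : ℂ) * F ξ) 2 volume) (n : ℕ) :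
    MemLp (fun ξ => ((phi s ‖ξ‖ : ℝ) : ℂ) * truncate F n ξ) 2 volume := by
  refine hF2.of_le ?_ (Eventually.of_forall fun ξ => ?_)
  · refine AEStronglyMeasurable.mul ?_ (hF.indicator Metric.isClosed_closedBall.measurableSet)
    have := continuous_phi_norm s
    exact (by fun_prop : Continuous fun ξ : E => ((phi s ‖ξ‖ : ℝ) : ℂ)).aestronglyMeasurable
  · rw [norm_mul, norm_mul]
    gcongr
    exact norm_truncate_le F n ξ

theorem tendsto_eLpNorm_phi_mul_truncate {s : ℝ} {F : E → ℂ} (hF : AEStronglyMeasurable F volume)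
    (hF2 : MemLp (fun ξ => ((phi s ‖ξ‖ : ℝ) : ℂ) * F ξ) 2 volume) :
    Tendsto (fun n => eLpNorm ((fun ξ => ((phi s ‖ξ‖ : ℝ) : ℂ) * truncate F n ξ) -
      fun ξ => ((phi s ‖ξ‖ : ℝ) : ℂ) * F ξ) 2 volume) atTop (𝓝 0) := by
  have hm := fun n => ((memLp_phi_mul_truncate hF hF2 n).sub hF2).1
  have h1 : Tendsto (fun n => ∫⁻ ξ, ‖((fun ξ => ((phi s ‖ξ‖ : ℝ) : ℂ) * truncate F n ξ) -
      fun ξ => ((phi s ‖ξ‖ : ℝ) : ℂ) * F ξ) ξ‖ₑ ^ 2) atTop (𝓝 (∫⁻ _ : E, 0)) := by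
    refine tendsto_lintegral_of_dominated_convergence'
      (fun ξ => ‖((phi s ‖ξ‖ : ℝ) : ℂ) * F ξ‖ₑ ^ 2) (fun n => (hm n).enorm.pow_const 2)
      (fun n => Eventually.of_forall fun ξ => ?_) ?_ (Eventually.of_forall fun ξ => ?_)
    · refine ENNReal.pow_le_pow_left ?_
      rw [enorm_le_iff_norm_le]
      simp only [Pi.sub_apply, ← mul_sub, norm_mul]
      gcongr
      by_cases hξ : ξ ∈ Metric.closedBall (0 : E) n
      · simp [truncate, Set.indicator_of_mem hξ]
      · simp [truncate, Set.indicator_of_notMem hξ]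
    · rw [lintegral_enorm_sq_eq_eLpNorm]
      exact ENNReal.pow_ne_top hF2.2.ne
    · refine tendsto_const_nhds.congr' ?_
      filter_upwards [truncate_eventually_eq F ξ] with n hn
      simp [hn]
  simp only [lintegral_zero, lintegral_enorm_sq_eq_eLpNorm] at h1
  have h2 := h1.ennrpow_const (1 / 2 : ℝ)
  refine (h2.congr fun n => ?_).trans (by simp)
  rw [← ENNReal.rpow_natCast, ← ENNReal.rpow_mul]
  norm_num

theorem pairEnergy_truncate_le (s : ℝ) (F : E → ℂ) (n : ℕ) :
    pairEnergy s (truncate F n) ≤ pairEnergy s F := by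
  refine lintegral_mono fun p => ?_
  gcongr
  rw [enorm_le_iff_norm_le, norm_mul, norm_mul]
  gcongr <;> exact norm_truncate_le F n _

/-- A sequence of functions whose integrals tend to zero has a subsequence tending to zero almost
everywhere. -/
theorem exists_subseq_tendsto_ae_zero {α : Type*} {m : MeasurableSpace α} {μ : Measure α}
    {g : ℕ → α → ℝ≥0∞} (hg : ∀ n, AEMeasurable (g n) μ)
    (h : Tendsto (fun n => ∫⁻ x, g n x ∂μ) atTop (𝓝 0)) :
    ∃ k : ℕ → ℕ, Tendsto k atTop atTop ∧ ∀ᵐ x ∂μ, Tendsto (fun j => g (k j) x) atTop (𝓝 0) := by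
  have h1 : ∀ j : ℕ, ∃ n, j ≤ n ∧ ∫⁻ x, g n x ∂μ ≤ (2⁻¹ : ℝ≥0∞) ^ j := fun j => by
    have hpos : (0 : ℝ≥0∞) < (2⁻¹ : ℝ≥0∞) ^ j := ENNReal.pow_pos (by simp) j
    obtain ⟨n, hn⟩ := ((h.eventually (Iic_mem_nhds hpos)).and (eventually_ge_atTop j)).exists
    exact ⟨n, hn.2, hn.1⟩
  choose k hk1 hk2 using h1
  refine ⟨k, tendsto_atTop_mono hk1 tendsto_id, ?_⟩
  have hsum : ∫⁻ x, ∑' j, g (k j) x ∂μ ≠ ∞ := by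
    rw [lintegral_tsum fun j => hg (k j)]
    refine ne_top_of_le_ne_top ?_ (ENNReal.tsum_le_tsum hk2)
    rw [ENNReal.tsum_geometric]
    simp
  filter_upwards [ae_lt_top' (AEMeasurable.tsum fun j => hg (k j)) hsum] with x hx
  rw [← Nat.cofinite_eq_atTop]
  exact ENNReal.tendsto_cofinite_zero_of_tsum_ne_top hx.ne

end KleinGordon

/-! ### Existence, uniqueness and the L⁴ bound of the evolution -/

namespace KleinGordon

theorem isFourierTransform_freeWave {F : E → ℂ} (hF : Integrable F) (s t : ℝ) :
    IsFourierTransform (fun x => freeWave s F (t, x))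
      (fun ξ => Complex.exp (Complex.I * ((t * phi s ‖ξ‖ : ℝ) : ℂ)) * F ξ) := by
  have h := isFourierTransform_invFourierIntegral (integrable_phase_mul hF s t)
  simp only [freeWave]
  exact h

/-- The truncated free waves converge in `L⁴` of space-time. -/
theorem exists_tendsto_freeWave_truncate {s : ℝ} {F : E → ℂ} (hF : AEStronglyMeasurable F volume)
    (hF2 : MemLp (fun ξ => ((phi s ‖ξ‖ : ℝ) : ℂ) * F ξ) 2 volume) :
    ∃ u : ℝ × E → ℂ, StronglyMeasurable u ∧ MemLp u 4 volume ∧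
      Tendsto (fun n => eLpNorm (freeWave s (truncate F n) - u) 4 volume) atTop (𝓝 0) := by
  have : Fact ((1 : ℝ≥0∞) ≤ 4) := ⟨by norm_num⟩
  have hFi := integrable_truncate hF2
  have hw := memLp_phi_mul_truncate hF hF2
  have hv : ∀ n, MemLp (freeWave s (truncate F n)) 4 volume := fun n =>
    ⟨(continuous_freeWave s (hFi n)).aestronglyMeasurable,
      (eLpNorm_freeWave_le s (hFi n)).trans_lt (hw n).2⟩
  have hwt : Tendsto (fun n => (hw n).toLp _) atTop (𝓝 (hF2.toLp _)) :=
    (Lp.tendsto_Lp_iff_tendsto_eLpNorm'' _ hw _ hF2).2 (tendsto_eLpNorm_phi_mul_truncate hF hF2)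
  have hd : ∀ n m, dist ((hv n).toLp _) ((hv m).toLp _) ≤ dist ((hw n).toLp _) ((hw m).toLp _) := by
    intro n m
    rw [← ENNReal.ofReal_le_ofReal_iff dist_nonneg, ← edist_dist, ← edist_dist,
      Lp.edist_toLp_toLp, Lp.edist_toLp_toLp]
    have h1 := eLpNorm_freeWave_le s ((hFi n).sub (hFi m))
    rw [funext (freeWave_sub s (hFi n) (hFi m))] at h1
    refine h1.trans_eq (congrArg (fun f => eLpNorm f 2 volume) ?_)
    funext ξ
    simp only [Pi.sub_apply, mul_sub]
  have hc : CauchySeq fun n => (hv n).toLp _ := by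
    rw [cauchySeq_iff_tendsto_dist_atTop_0]
    exact squeeze_zero (fun _ => dist_nonneg) (fun n => hd n.1 n.2)
      (cauchySeq_iff_tendsto_dist_atTop_0.1 hwt.cauchySeq)
  obtain ⟨U, hU⟩ := cauchySeq_tendsto_of_complete hc
  refine ⟨U, Lp.stronglyMeasurable U, Lp.memLp U, ?_⟩
  rw [Lp.tendsto_Lp_iff_tendsto_eLpNorm'] at hU
  refine hU.congr fun n => eLpNorm_congr_ae ?_
  filter_upwards [(hv n).coeFn_toLp] with q hq
  simp [hq]

instance holderConjugate_four : ENNReal.HolderConjugate 4 (ENNReal.ofReal (4 / 3)) := by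
  have h := (Real.HolderConjugate.conjExponent (p := 4) (by norm_num)).ennrealOfReal
  rw [show Real.conjExponent 4 = 4 / 3 by norm_num [Real.conjExponent]] at h
  simpa using h

/-- Hölder with exponents 4 and 4/3. -/
theorem tendsto_integral_mul_schwartz {v : ℕ → E → ℂ} {w : E → ℂ}
    (hv : ∀ n, AEStronglyMeasurable (v n) volume) (hw : MemLp w 4 volume)
    (h : Tendsto (fun n => ∫⁻ x, ‖v n x - w x‖ₑ ^ 4) atTop (𝓝 0)) (χ : 𝓢(E, ℂ))
    (hvi : ∀ n, Integrable fun x => v n x * χ x) :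
    Tendsto (fun n => ∫ x, v n x * χ x) atTop (𝓝 (∫ x, w x * χ x)) := by
  have hwi := integrable_mul_schwartz_of_memLp (p := 4) (q := ENNReal.ofReal (4 / 3)) hw χ
  have hχ := χ.memLp (ENNReal.ofReal (4 / 3)) volume
  have h4 : Tendsto (fun n => eLpNorm (v n - w) 4 volume) atTop (𝓝 0) := by
    have h1 := h.ennrpow_const (1 / 4 : ℝ)
    refine (h1.congr fun n => ?_).trans (by simp)
    rw [show (fun x => ‖v n x - w x‖ₑ ^ 4) = fun x => ‖(v n - w) x‖ₑ ^ 4 from rfl]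
    rw [lintegral_enorm_pow_four_eq_eLpNorm, ← ENNReal.rpow_natCast, ← ENNReal.rpow_mul]
    norm_num
  have h5 : Tendsto (fun n => eLpNorm (v n - w) 4 volume *
      eLpNorm χ (ENNReal.ofReal (4 / 3)) volume) atTop (𝓝 0) := by
    simpa using ENNReal.Tendsto.mul_const h4 (Or.inr hχ.2.ne)
  rw [tendsto_iff_edist_tendsto_0]
  refine tendsto_of_tendsto_of_tendsto_of_le_of_le tendsto_const_nhds h5 (fun _ => zero_le)
    fun n => ?_
  simp only
  rw [edist_eq_enorm_sub, ← integral_sub (hvi n) hwi]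
  refine (enorm_integral_le_lintegral_enorm _).trans ?_
  rw [← eLpNorm_one_eq_lintegral_enorm]
  have := eLpNorm_smul_le_mul_eLpNorm (p := 4) (q := ENNReal.ofReal (4 / 3)) (r := 1)
    (μ := volume) (φ := v n - w) (f := χ) hχ.1 ((hv n).sub hw.1)
  refine le_trans (le_of_eq (congrArg (fun f => eLpNorm f 1 volume) ?_)) this
  funext x
  simp [sub_mul]

/-- The free evolution exists on the energy space, and satisfies the `L⁴` bound. -/
theorem exists_isEvolution {s : ℝ} {f : E → ℂ} (hf : f ∈ energySpace s) :
    ∃ u, IsEvolution s f u ∧ eLpNorm u 4 volume ^ 4 ≤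
      (ENNReal.ofReal (2 * Real.pi) ^ 14)⁻¹ * pairEnergy s (hat f) := by
  set F := hat f with hFdef
  have hF : AEStronglyMeasurable F volume := hf.1.aestronglyMeasurable_right
  have hF2 : MemLp (fun ξ => ((phi s ‖ξ‖ : ℝ) : ℂ) * F ξ) 2 volume := hf.2
  have hFi := integrable_truncate hF2
  obtain ⟨u, hum, hu4, hut⟩ := exists_tendsto_freeWave_truncate hF hF2
  have hvm : ∀ n, Continuous (freeWave s (truncate F n)) := fun n => continuous_freeWave s (hFi n)
  refine ⟨u, ⟨hum.aestronglyMeasurable, ?_⟩, ?_⟩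
  -- Convergence in L⁴ of space-time gives, along a subsequence, convergence in L⁴ of space for
  -- almost every time. The Fourier relation then passes to the limit on each such slice.
  · have h1 : Tendsto (fun n => ∫⁻ t : ℝ, ∫⁻ x : E,
        ‖freeWave s (truncate F n) (t, x) - u (t, x)‖ₑ ^ 4) atTop (𝓝 0) := by
      have h2 := ENNReal.Tendsto.pow (n := 4) hut
      rw [zero_pow four_ne_zero] at h2
      refine h2.congr fun n => ?_
      rw [← lintegral_enorm_pow_four_eq_eLpNorm, Measure.volume_eq_prod, lintegral_prod]
      · rfl
      · exact (((hvm n).measurable.sub hum.measurable).enorm.pow_const 4).aemeasurable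
    obtain ⟨k, hk, hkt⟩ := exists_subseq_tendsto_ae_zero (fun n => by
      refine Measurable.aemeasurable (Measurable.lintegral_prod_right'
        (f := fun q => ‖freeWave s (truncate F n) q - u q‖ₑ ^ 4) ?_)
      exact ((hvm n).measurable.sub hum.measurable).enorm.pow_const 4) h1
    have hut4 : ∀ᵐ t : ℝ, ∫⁻ x : E, ‖u (t, x)‖ₑ ^ 4 < ∞ := by
      have hmeas : Measurable fun q => ‖u q‖ₑ ^ 4 := hum.measurable.enorm.pow_const 4
      refine ae_lt_top hmeas.lintegral_prod_right' ?_
      rw [← lintegral_prod _ hmeas.aemeasurable, ← Measure.volume_eq_prod,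
        lintegral_enorm_pow_four_eq_eLpNorm]
      exact ENNReal.pow_ne_top hu4.2.ne
    filter_upwards [hkt, hut4] with t ht htop ψ
    have hutm : StronglyMeasurable fun x => u (t, x) := hum.comp_measurable measurable_prodMk_left
    have hu : MemLp (fun x => u (t, x)) 4 volume := by
      refine ⟨hutm.aestronglyMeasurable, ?_⟩
      rw [lintegral_enorm_pow_four_eq_eLpNorm] at htop
      exact lt_top_iff_ne_top.2 fun h => by simp [h] at htop
    have hphase := measurable_phase s t
    have hint : Integrable fun ξ =>
        Complex.exp (Complex.I * ((t * phi s ‖ξ‖ : ℝ) : ℂ)) * F ξ * ψ ξ := by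
      simp only [mul_assoc]
      exact (hf.1 ψ).2.1.bdd_mul hphase.aestronglyMeasurable (c := 1)
        (Eventually.of_forall fun ξ => (norm_exp_I_mul _).le)
    refine ⟨integrable_mul_schwartz_of_memLp (p := 4) (q := ENNReal.ofReal (4 / 3)) hu ψ, hint, ?_⟩
    obtain ⟨χ, hχ⟩ := exists_schwartz_fourierIntegral ψ
    have hft := fun n => isFourierTransform_freeWave (hFi n) s t
    have hlim1 : Tendsto (fun j => ∫ ξ, Complex.exp (Complex.I * ((t * phi s ‖ξ‖ : ℝ) : ℂ)) *
        truncate F (k j) ξ * ψ ξ) atTop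
        (𝓝 (∫ ξ, Complex.exp (Complex.I * ((t * phi s ‖ξ‖ : ℝ) : ℂ)) * F ξ * ψ ξ)) := by
      refine tendsto_integral_of_dominated_convergence _ (fun j => ((hft (k j)) ψ).2.1.1) hint.norm
        (fun j => Eventually.of_forall fun ξ => ?_) (Eventually.of_forall fun ξ => ?_)
      · simp only [norm_mul]
        gcongr
        exact norm_truncate_le F _ ξ
      · refine tendsto_const_nhds.congr' ?_
        filter_upwards [hk.eventually (truncate_eventually_eq F ξ)] with j hj
        rw [hj]
    have hlim2 := tendsto_integral_mul_schwartz (v := fun j x => freeWave s (truncate F (k j)) (t, x))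
      (w := fun x => u (t, x)) (fun j => ((hvm (k j)).comp
        (Continuous.prodMk_right t)).aestronglyMeasurable) hu ht χ fun j => (hft (k j) χ).1
    simp only [hχ]
    refine tendsto_nhds_unique hlim1 (hlim2.congr fun j => ?_)
    rw [(hft (k j) ψ).2.2]
    simp only [hχ]
  · set K := (ENNReal.ofReal (2 * Real.pi) ^ 14)⁻¹ * pairEnergy s F with hK
    have hK4 : (K ^ (1 / 4 : ℝ)) ^ 4 = K := by
      rw [← ENNReal.rpow_natCast, ← ENNReal.rpow_mul]
      norm_num
    have hle : ∀ n, eLpNorm u 4 volume ≤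
        K ^ (1 / 4 : ℝ) + eLpNorm (freeWave s (truncate F n) - u) 4 volume := fun n => by
      have h1 := eLpNorm_sub_le (p := 4) (hvm n).aestronglyMeasurable
        ((hvm n).aestronglyMeasurable.sub hu4.1) (μ := volume) (by norm_num)
      rw [sub_sub_cancel] at h1
      refine h1.trans ?_
      gcongr
      refine (ENNReal.pow_le_pow_left_iff four_ne_zero).1 ?_
      rw [hK4, ← lintegral_enorm_pow_four_eq_eLpNorm]
      exact (lintegral_freeWave_pow_four_le s (hFi n)).trans
        (by rw [hK]; gcongr; exact pairEnergy_truncate_le s F n)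
    have hlim : Tendsto (fun n => K ^ (1 / 4 : ℝ) +
        eLpNorm (freeWave s (truncate F n) - u) 4 volume) atTop (𝓝 (K ^ (1 / 4 : ℝ))) := by
      simpa using tendsto_const_nhds.add hut
    calc _ ≤ (K ^ (1 / 4 : ℝ)) ^ 4 := by
          gcongr
          exact ge_of_tendsto' hlim hle
      _ = K := hK4

/-- The free evolution is unique up to null sets. -/
theorem IsEvolution.ae_eq {s : ℝ} {f : E → ℂ} {u v : ℝ × E → ℂ} (hu : IsEvolution s f u)
    (hv : IsEvolution s f v) : u =ᵐ[volume] v := by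
  obtain ⟨⟨u', hum, hu'⟩, hut⟩ := hu
  obtain ⟨⟨v', hvm, hv'⟩, hvt⟩ := hv
  refine hu'.trans (EventuallyEq.trans ?_ hv'.symm)
  have hm : MeasurableSet {q | u' q = v' q} := measurableSet_eq_fun hum.measurable hvm.measurable
  rw [Measure.volume_eq_prod] at hu' hv' ⊢
  rw [EventuallyEq, Measure.ae_prod_iff_ae_ae hm]
  filter_upwards [hut, hvt, Measure.ae_ae_of_ae_prod hu', Measure.ae_ae_of_ae_prod hv']
    with t h1 h2 h3 h4
  filter_upwards [h1.unique_left h2, h3, h4] with x h5 h6 h7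
  rw [← h6, ← h7, h5]

theorem isEvolution_evolution {s : ℝ} {f : E → ℂ} (hf : f ∈ energySpace s) :
    IsEvolution s f (evolution s f) := by
  obtain ⟨u, hu, -⟩ := exists_isEvolution hf
  exact Classical.epsilon_spec (p := fun u => IsEvolution s f u) ⟨u, hu⟩

theorem eLpNorm_evolution_pow_four_le {s : ℝ} {f : E → ℂ} (hf : f ∈ energySpace s) :
    eLpNorm (evolution s f) 4 volume ^ 4 ≤
      (ENNReal.ofReal (2 * Real.pi) ^ 14)⁻¹ * pairEnergy s (hat f) := by
  obtain ⟨u, hu, hle⟩ := exists_isEvolution hf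
  rwa [eLpNorm_congr_ae ((isEvolution_evolution hf).ae_eq hu)]

theorem evolution_ae_eq_freeWave {s : ℝ} {f F : E → ℂ} (hf : f ∈ energySpace s)
    (hF : Integrable F) (h : hat f =ᵐ[volume] F) : evolution s f =ᵐ[volume] freeWave s F := by
  refine (isEvolution_evolution hf).ae_eq
    ⟨(continuous_freeWave s hF).aestronglyMeasurable, Eventually.of_forall fun t => ?_⟩
  refine (isFourierTransform_freeWave hF s t).congr_right ?_
  filter_upwards [h] with ξ hξ
  rw [hξ]

end KleinGordon

namespace KleinGordon

/-! ### Quadratic functionals of a frequency profile -/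

/-- The energy `∫ φ_s² |F|²`. -/
noncomputable def energyInt (s : ℝ) (F : E → ℂ) : ℝ := ∫ ξ, phi s ‖ξ‖ ^ 2 * ‖F ξ‖ ^ 2

/-- The weighted charge `∫ s φ_s |F|²`. -/
noncomputable def chargeInt (s : ℝ) (F : E → ℂ) : ℝ := ∫ ξ, s * phi s ‖ξ‖ * ‖F ξ‖ ^ 2

/-- The momentum `∫ φ_s |F|² ξ`. -/
noncomputable def momentumInt (s : ℝ) (F : E → ℂ) : E := ∫ ξ, (phi s ‖ξ‖ * ‖F ξ‖ ^ 2) • ξ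

section Quadratic

variable {s : ℝ} {F : E → ℂ}

theorem integrable_energy (hF2 : MemLp (fun ξ => ((phi s ‖ξ‖ : ℝ) : ℂ) * F ξ) 2 volume) :
    Integrable fun ξ => phi s ‖ξ‖ ^ 2 * ‖F ξ‖ ^ 2 := by
  refine ((memLp_two_iff_integrable_sq_norm hF2.1).1 hF2).congr (Eventually.of_forall fun ξ => ?_)
  simp only [norm_mul, Complex.norm_real, Real.norm_eq_abs, mul_pow, sq_abs]

/-- The factor s stays inside the integral: s ≤ φ dominates the integrand by the energy, and s = 0
requires no control of φ|F|². -/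
theorem integrable_charge (hs : 0 ≤ s) (hF : AEStronglyMeasurable F volume)
    (hF2 : MemLp (fun ξ => ((phi s ‖ξ‖ : ℝ) : ℂ) * F ξ) 2 volume) :
    Integrable fun ξ => s * phi s ‖ξ‖ * ‖F ξ‖ ^ 2 := by
  refine (integrable_energy hF2).mono' ?_ (Eventually.of_forall fun ξ => ?_)
  · exact (continuous_const.mul (continuous_phi_norm s)).aestronglyMeasurable.mul (hF.norm.pow 2)
  · have h0 := phi_nonneg s ‖ξ‖
    rw [Real.norm_of_nonneg (by positivity), sq (phi s ‖ξ‖)]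
    gcongr
    exact le_phi

theorem integrable_momentum (hF : AEStronglyMeasurable F volume)
    (hF2 : MemLp (fun ξ => ((phi s ‖ξ‖ : ℝ) : ℂ) * F ξ) 2 volume) :
    Integrable fun ξ => (phi s ‖ξ‖ * ‖F ξ‖ ^ 2) • ξ := by
  refine (integrable_energy hF2).mono' ?_ (Eventually.of_forall fun ξ => ?_)
  · exact ((continuous_phi_norm s).aestronglyMeasurable.mul (hF.norm.pow 2)).smul
      continuous_id.aestronglyMeasurable
  · have h0 := phi_nonneg s ‖ξ‖
    rw [norm_smul, Real.norm_of_nonneg (by positivity), sq (phi s ‖ξ‖)]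
    calc _ ≤ phi s ‖ξ‖ * ‖F ξ‖ ^ 2 * phi s ‖ξ‖ := by gcongr; exact le_phi_right
      _ = _ := by ring

theorem chargeInt_nonneg (hs : 0 ≤ s) : 0 ≤ chargeInt s F :=
  integral_nonneg fun ξ => by have := phi_nonneg s ‖ξ‖; simp only [Pi.zero_apply]; positivity

theorem chargeInt_le_energyInt (hs : 0 ≤ s) (hF : AEStronglyMeasurable F volume)
    (hF2 : MemLp (fun ξ => ((phi s ‖ξ‖ : ℝ) : ℂ) * F ξ) 2 volume) :
    chargeInt s F ≤ energyInt s F := by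
  refine integral_mono (integrable_charge hs hF hF2) (integrable_energy hF2) fun ξ => ?_
  have h0 := phi_nonneg s ‖ξ‖
  simp only [sq (phi s ‖ξ‖)]
  gcongr
  exact le_phi

/-- The integrand of the two-particle energy with the kernel replaced by `P - c s²`. -/
noncomputable def pairIntegrand (s c : ℝ) (F : E → ℂ) (p : E × E) : ℝ :=
  ‖F p.1 * F p.2‖ ^ 2 * (phi s ‖p.1‖ * phi s ‖p.2‖ * (lorentz s p - c * s ^ 2))

theorem integrable_inner_momentum (hF : AEStronglyMeasurable F volume)
    (hF2 : MemLp (fun ξ => ((phi s ‖ξ‖ : ℝ) : ℂ) * F ξ) 2 volume) :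
    Integrable fun p : E × E => (inner ℝ ((phi s ‖p.1‖ * ‖F p.1‖ ^ 2) • p.1)
      ((phi s ‖p.2‖ * ‖F p.2‖ ^ 2) • p.2) : ℝ) := by
  have h := integrable_momentum hF hF2
  refine (h.norm.mul_prod h.norm).mono' ?_ (Eventually.of_forall fun p => norm_inner_le_norm _ _)
  exact h.1.comp_fst.inner h.1.comp_snd

/-- Multiplied by φφ, the kernel is a sum of three tensor products, giving the squares of energy,
charge and momentum. The value c = 1 serves the upper bound and c = 3 the lower one. -/
theorem integrable_pairIntegrand_and_integral (hs : 0 ≤ s) (hF : AEStronglyMeasurable F volume)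
    (hF2 : MemLp (fun ξ => ((phi s ‖ξ‖ : ℝ) : ℂ) * F ξ) 2 volume) (c : ℝ) :
    Integrable (pairIntegrand s c F) ∧ ∫ p, pairIntegrand s c F p =
      energyInt s F ^ 2 - c * chargeInt s F ^ 2 - ‖momentumInt s F‖ ^ 2 := by
  have hA := integrable_energy hF2
  have hB := integrable_charge hs hF hF2
  have hV := integrable_momentum hF hF2
  have hVV := integrable_inner_momentum hF hF2
  have hAA := hA.mul_prod hA
  have hBB := (hB.mul_prod hB).const_mul c
  have e : pairIntegrand s c F = fun p : E × E =>
      ((phi s ‖p.1‖ ^ 2 * ‖F p.1‖ ^ 2) * (phi s ‖p.2‖ ^ 2 * ‖F p.2‖ ^ 2) -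
        c * ((s * phi s ‖p.1‖ * ‖F p.1‖ ^ 2) * (s * phi s ‖p.2‖ * ‖F p.2‖ ^ 2))) -
      (inner ℝ ((phi s ‖p.1‖ * ‖F p.1‖ ^ 2) • p.1) ((phi s ‖p.2‖ * ‖F p.2‖ ^ 2) • p.2) : ℝ) := by
    funext p
    simp only [pairIntegrand, lorentz, norm_mul, inner_smul_left, inner_smul_right, conj_trivial]
    ring
  have hVI : ∫ p : E × E, (inner ℝ ((phi s ‖p.1‖ * ‖F p.1‖ ^ 2) • p.1)
      ((phi s ‖p.2‖ * ‖F p.2‖ ^ 2) • p.2) : ℝ) = ‖momentumInt s F‖ ^ 2 := by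
    rw [Measure.volume_eq_prod, integral_prod _ hVV]
    simp only [integral_inner hV]
    change ∫ ξ, (inner ℝ ((phi s ‖ξ‖ * ‖F ξ‖ ^ 2) • ξ) (momentumInt s F) : ℝ) = _
    rw [← real_inner_self_eq_norm_sq]
    refine Eq.trans ?_ (integral_inner hV (momentumInt s F))
    exact integral_congr_ae (Eventually.of_forall fun ξ => real_inner_comm _ _)
  rw [e]
  refine ⟨(hAA.sub hBB).sub hVV, ?_⟩
  refine (integral_sub (hAA.sub hBB) hVV).trans ?_
  refine (congrArg₂ (· - ·) (integral_sub hAA hBB) hVI).trans ?_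
  rw [integral_const_mul,
    integral_prod_mul (fun ξ => phi s ‖ξ‖ ^ 2 * ‖F ξ‖ ^ 2) (fun ξ => phi s ‖ξ‖ ^ 2 * ‖F ξ‖ ^ 2),
    integral_prod_mul (fun ξ => s * phi s ‖ξ‖ * ‖F ξ‖ ^ 2) (fun ξ => s * phi s ‖ξ‖ * ‖F ξ‖ ^ 2),
    energyInt, chargeInt]
  ring

/-- The integrand of the two-particle energy, as a real function. -/
noncomputable def pairWeight (s : ℝ) (F : E → ℂ) (p : E × E) : ℝ :=
  ‖F p.1 * F p.2‖ ^ 2 * (phi s ‖p.1‖ * phi s ‖p.2‖ * phaseWeight s (totalMomentum s p))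

theorem pairWeight_nonneg (p : E × E) : 0 ≤ pairWeight s F p := by
  have h1 := phi_nonneg s ‖p.1‖
  have h2 := phi_nonneg s ‖p.2‖
  have h3 := phaseWeight_nonneg s (totalMomentum s p)
  rw [pairWeight]
  positivity

theorem pairWeight_le (p : E × E) :
    pairWeight s F p ≤ 2 * Real.pi ^ 2 / 3 * pairIntegrand s 1 F p := by
  have h1 := phi_nonneg s ‖p.1‖
  have h2 := phi_nonneg s ‖p.2‖
  have h3 := phaseWeight_totalMomentum_le s p
  calc _ ≤ ‖F p.1 * F p.2‖ ^ 2 * (phi s ‖p.1‖ * phi s ‖p.2‖ *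
        (2 * Real.pi ^ 2 / 3 * (lorentz s p - s ^ 2))) := by rw [pairWeight]; gcongr
    _ = _ := by rw [pairIntegrand]; ring

/-- With x = (P − s²)/(P + s²) in [0, 1] one has √x ≥ x, and (P − s²)² exceeds (P − 3s²)(P + s²) by
4s⁴. The case s = 0 is separate because P + s² may vanish. -/
theorem le_pairWeight (p : E × E) :
    2 * Real.pi ^ 2 / 3 * pairIntegrand s 3 F p ≤ pairWeight s F p := by
  have h1 := phi_nonneg s ‖p.1‖
  have h2 := phi_nonneg s ‖p.2‖
  have hP := sq_le_lorentz s p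
  have hs := sq_nonneg s
  have h3 : 2 * Real.pi ^ 2 / 3 * (lorentz s p - 3 * s ^ 2) ≤
      phaseWeight s (totalMomentum s p) := by
    rw [phaseWeight_totalMomentum]
    gcongr
    generalize lorentz s p = P at *
    rcases eq_or_lt_of_le hs with h0 | h0
    · rw [← h0] at hP ⊢
      rcases eq_or_lt_of_le hP with h | h
      · simp [← h]
      · rw [sub_zero, add_zero, div_self h.ne']
        simp
    · have hpos : 0 < P + s ^ 2 := by linarith
      have hx : 0 ≤ (P - s ^ 2) / (P + s ^ 2) := div_nonneg (by linarith) hpos.le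
      have hx1 : (P - s ^ 2) / (P + s ^ 2) ≤ 1 := div_le_one_of_le₀ (by linarith) hpos.le
      have h4 : (P - s ^ 2) / (P + s ^ 2) ≤ √((P - s ^ 2) / (P + s ^ 2)) :=
        Real.le_sqrt_of_sq_le (by nlinarith)
      calc P - 3 * s ^ 2 ≤ (P - s ^ 2) * ((P - s ^ 2) / (P + s ^ 2)) := by
            rw [mul_div_assoc', le_div_iff₀ hpos]
            nlinarith
        _ ≤ _ := mul_le_mul_of_nonneg_left h4 (by linarith)
  calc _ = ‖F p.1 * F p.2‖ ^ 2 * (phi s ‖p.1‖ * phi s ‖p.2‖ *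
        (2 * Real.pi ^ 2 / 3 * (lorentz s p - 3 * s ^ 2))) := by rw [pairIntegrand]; ring
    _ ≤ _ := by rw [pairWeight]; gcongr

theorem integrable_pairWeight (hs : 0 ≤ s) (hF : AEStronglyMeasurable F volume)
    (hF2 : MemLp (fun ξ => ((phi s ‖ξ‖ : ℝ) : ℂ) * F ξ) 2 volume) :
    Integrable (pairWeight s F) := by
  refine ((integrable_pairIntegrand_and_integral hs hF hF2 1).1.const_mul
    (2 * Real.pi ^ 2 / 3)).mono' ?_ (Eventually.of_forall fun p => ?_)
  · have hφ := (continuous_phi s).measurable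
    have hT := (continuous_totalMomentum s).measurable
    have hw := measurable_phaseWeight s
    refine ((hF.comp_fst.mul hF.comp_snd).norm.pow 2).mul (Measurable.aestronglyMeasurable ?_)
    fun_prop
  · rw [Real.norm_of_nonneg (pairWeight_nonneg p)]
    exact pairWeight_le p

theorem pairEnergy_eq (hs : 0 ≤ s) (hF : AEStronglyMeasurable F volume)
    (hF2 : MemLp (fun ξ => ((phi s ‖ξ‖ : ℝ) : ℂ) * F ξ) 2 volume) :
    pairEnergy s F = ENNReal.ofReal (∫ p, pairWeight s F p) := by
  rw [ofReal_integral_eq_lintegral_ofReal (integrable_pairWeight hs hF hF2)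
    (Eventually.of_forall fun p => pairWeight_nonneg p)]
  refine lintegral_congr fun p => ?_
  rw [pairWeight, ENNReal.ofReal_mul (sq_nonneg ‖F p.1 * F p.2‖), ENNReal.ofReal_pow (norm_nonneg _),
    ofReal_norm]

theorem integral_pairWeight_le (hs : 0 ≤ s) (hF : AEStronglyMeasurable F volume)
    (hF2 : MemLp (fun ξ => ((phi s ‖ξ‖ : ℝ) : ℂ) * F ξ) 2 volume) :
    ∫ p, pairWeight s F p ≤
      2 * Real.pi ^ 2 / 3 * (energyInt s F ^ 2 - chargeInt s F ^ 2) := by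
  obtain ⟨h1, h2⟩ := integrable_pairIntegrand_and_integral hs hF hF2 1
  calc _ ≤ ∫ p, 2 * Real.pi ^ 2 / 3 * pairIntegrand s 1 F p :=
        integral_mono (integrable_pairWeight hs hF hF2) (h1.const_mul _) pairWeight_le
    _ ≤ _ := by
        rw [integral_const_mul, h2]
        refine mul_le_mul_of_nonneg_left ?_ (by positivity)
        nlinarith [sq_nonneg ‖momentumInt s F‖]

theorem le_integral_pairWeight (hs : 0 ≤ s) (hF : AEStronglyMeasurable F volume)
    (hF2 : MemLp (fun ξ => ((phi s ‖ξ‖ : ℝ) : ℂ) * F ξ) 2 volume) (hV : momentumInt s F = 0) :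
    2 * Real.pi ^ 2 / 3 * (energyInt s F ^ 2 - 3 * chargeInt s F ^ 2) ≤
      ∫ p, pairWeight s F p := by
  obtain ⟨h1, h2⟩ := integrable_pairIntegrand_and_integral hs hF hF2 3
  calc _ = ∫ p, 2 * Real.pi ^ 2 / 3 * pairIntegrand s 3 F p := by
        rw [integral_const_mul, h2, hV]
        simp
    _ ≤ _ := integral_mono (h1.const_mul _) (integrable_pairWeight hs hF hF2) le_pairWeight

/-- The difference (φφ)² − (s² + y₁·y₂)² equals s²|y₁ − y₂|² plus the nonnegative defect in
Cauchy-Schwarz. -/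
theorem sq_lt_lorentz (hs : 0 < s) {p : E × E} (hp : p.1 ≠ p.2) : s ^ 2 < lorentz s p := by
  have h1 := phi_pos_of_pos (r := ‖p.1‖) hs
  have h2 := phi_pos_of_pos (r := ‖p.2‖) hs
  have h3 : 0 < ‖p.1 - p.2‖ ^ 2 := by
    have := norm_pos_iff.2 (sub_ne_zero.2 hp)
    positivity
  rw [norm_sub_sq_real] at h3
  have h4 : (inner ℝ p.1 p.2) ^ 2 ≤ ‖p.1‖ ^ 2 * ‖p.2‖ ^ 2 := by
    rw [← mul_pow]
    exact sq_le_sq' (neg_le_of_abs_le (abs_real_inner_le_norm _ _)) (real_inner_le_norm _ _)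
  have h5 : (s ^ 2 + inner ℝ p.1 p.2) ^ 2 < (phi s ‖p.1‖ * phi s ‖p.2‖) ^ 2 := by
    rw [mul_pow, phi_sq, phi_sq]
    nlinarith [mul_pos (sq_pos_of_pos hs) h3]
  have h6 := (abs_lt_of_sq_lt_sq' h5 (by positivity)).2
  rw [lorentz]
  linarith

theorem ae_fst_ne_snd : ∀ᵐ p : E × E, p.1 ≠ p.2 := by
  have hm : MeasurableSet {p : E × E | p.1 ≠ p.2} :=
    (measurableSet_eq_fun measurable_fst measurable_snd).compl
  rw [Measure.volume_eq_prod, Measure.ae_prod_iff_ae_ae hm]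
  exact Eventually.of_forall fun x => by
    filter_upwards [Measure.ae_ne volume x] with y hy using hy.symm

/-- For positive `s` the bound on the two-particle energy is strict. -/
theorem integral_pairWeight_lt (hs : 0 < s) (hF : AEStronglyMeasurable F volume)
    (hF2 : MemLp (fun ξ => ((phi s ‖ξ‖ : ℝ) : ℂ) * F ξ) 2 volume) (h0 : ¬ F =ᵐ[volume] 0) :
    ∫ p, pairWeight s F p <
      2 * Real.pi ^ 2 / 3 * (energyInt s F ^ 2 - chargeInt s F ^ 2) := by
  obtain ⟨h1, h2⟩ := integrable_pairIntegrand_and_integral hs.le hF hF2 1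
  have hle : ∫ p, 2 * Real.pi ^ 2 / 3 * pairIntegrand s 1 F p ≤
      2 * Real.pi ^ 2 / 3 * (energyInt s F ^ 2 - chargeInt s F ^ 2) := by
    rw [integral_const_mul, h2]
    refine mul_le_mul_of_nonneg_left ?_ (by positivity)
    nlinarith [sq_nonneg ‖momentumInt s F‖]
  have hi := integrable_pairWeight hs.le hF hF2
  refine lt_of_lt_of_le (lt_of_le_of_ne (integral_mono hi (h1.const_mul _) pairWeight_le)
    fun heq => h0 ?_) hle
  have hae := (integral_eq_iff_of_ae_le hi (h1.const_mul _)
    (Eventually.of_forall pairWeight_le)).1 heq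
  -- Equal integrals of ordered functions force equality almost everywhere, whereas off the null
  -- diagonal the inequality is strict wherever F(y₁)F(y₂) ≠ 0.
  have hzero : ∀ᵐ p : E × E, F p.1 * F p.2 = 0 := by
    filter_upwards [hae, ae_fst_ne_snd] with p hp hne
    by_contra hcon
    have hlt : pairWeight s F p < 2 * Real.pi ^ 2 / 3 * pairIntegrand s 1 F p := by
      have h3 := phi_pos_of_pos (r := ‖p.1‖) hs
      have h4 := phi_pos_of_pos (r := ‖p.2‖) hs
      have h5 := sq_lt_lorentz hs hne
      have h6 : √((lorentz s p - s ^ 2) / (lorentz s p + s ^ 2)) < 1 := by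
        have hs2 := sq_pos_of_pos hs
        rw [Real.sqrt_lt' one_pos, div_lt_iff₀ (by linarith)]
        linarith
      have h7 : 0 < ‖F p.1 * F p.2‖ := norm_pos_iff.2 hcon
      have h8 : (lorentz s p - s ^ 2) * √((lorentz s p - s ^ 2) / (lorentz s p + s ^ 2)) <
          lorentz s p - s ^ 2 := mul_lt_of_lt_one_right (by linarith) h6
      calc _ < ‖F p.1 * F p.2‖ ^ 2 * (phi s ‖p.1‖ * phi s ‖p.2‖ *
            (2 * Real.pi ^ 2 / 3 * (lorentz s p - s ^ 2))) := by
            rw [pairWeight, phaseWeight_totalMomentum]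
            gcongr
        _ = _ := by rw [pairIntegrand]; ring
    exact hlt.ne hp
  rw [Measure.volume_eq_prod] at hzero
  have h3 := Measure.ae_ae_of_ae_prod hzero
  by_contra hcon
  have hex : ∃ x, F x ≠ 0 ∧ ∀ᵐ y : E, F x * F y = 0 := by
    by_contra hno
    refine hcon ?_
    filter_upwards [h3] with x hx
    by_contra hx0
    exact hno ⟨x, hx0, hx⟩
  obtain ⟨x, hx0, hx⟩ := hex
  refine hcon ?_
  filter_upwards [hx] with y hy
  exact (mul_eq_zero.1 hy).resolve_left hx0

end Quadratic

/-! ### The norms in terms of the Fourier transform -/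

theorem eLpNorm_multiplier_sq {m f : E → ℂ} (h : MemLp (fun ξ => m ξ * hat f ξ) 2 volume) :
    (eLpNorm (multiplier m f) 2 volume).toReal ^ 2 =
      ((2 * Real.pi) ^ 5)⁻¹ * ∫ ξ, ‖m ξ * hat f ξ‖ ^ 2 := by
  obtain ⟨w, hw, hw2⟩ := exists_isFourierTransform_of_memLp h
  have h1 : IsFourierTransform (multiplier m f) (fun ξ => m ξ * hat f ξ) :=
    Classical.epsilon_spec (p := fun w => IsFourierTransform w (fun ξ => m ξ * hat f ξ)) ⟨w, hw⟩
  rw [eLpNorm_congr_ae (h1.unique_left hw), hw2]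

section Norms

variable {s : ℝ} {f : E → ℂ}

theorem phiNorm_one_sq (hf : f ∈ energySpace s) :
    phiNorm s 1 f ^ 2 = ((2 * Real.pi) ^ 5)⁻¹ * energyInt s (hat f) := by
  have h := hf.2
  rw [phiNorm, eLpNorm_multiplier_sq]
  · simp only [Real.rpow_one, norm_mul, Complex.norm_real, Real.norm_eq_abs, mul_pow, sq_abs,
      energyInt]
  · simpa only [Real.rpow_one] using h

/-- For s = 0 the half-order norm is not known to be meaningful, but the factor s² removes it. For s
> 0 it is controlled by φ ≤ φ²/s. -/
theorem sq_mul_phiNorm_half_pow_four (hs : 0 ≤ s) (hf : f ∈ energySpace s) :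
    s ^ 2 * phiNorm s (1 / 2) f ^ 4 = (((2 * Real.pi) ^ 5)⁻¹ * chargeInt s (hat f)) ^ 2 := by
  rcases hs.eq_or_lt with rfl | hs
  · simp [chargeInt]
  have hF : AEStronglyMeasurable (hat f) volume := hf.1.aestronglyMeasurable_right
  have hsq : ∀ ξ : E, (phi s ‖ξ‖ ^ (1 / 2 : ℝ)) ^ 2 = phi s ‖ξ‖ := fun ξ => by
    rw [← Real.rpow_natCast, ← Real.rpow_mul (phi_nonneg _ _)]
    norm_num
  have hφ : Continuous fun ξ : E => phi s ‖ξ‖ ^ (1 / 2 : ℝ) :=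
    (continuous_phi_norm s).rpow_const fun _ => Or.inr (by norm_num)
  have hm : MemLp (fun ξ => ((phi s ‖ξ‖ ^ (1 / 2 : ℝ) : ℝ) : ℂ) * hat f ξ) 2 volume := by
    have hmeas : AEStronglyMeasurable
        (fun ξ => ((phi s ‖ξ‖ ^ (1 / 2 : ℝ) : ℝ) : ℂ) * hat f ξ) volume :=
      (Complex.continuous_ofReal.comp hφ).aestronglyMeasurable.mul hF
    rw [memLp_two_iff_integrable_sq_norm hmeas]
    refine ((integrable_charge hs.le hF hf.2).const_mul s⁻¹).congr
      (Eventually.of_forall fun ξ => ?_)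
    simp only [norm_mul, Complex.norm_real, Real.norm_eq_abs, mul_pow, sq_abs, hsq]
    field_simp
  have h1 : phiNorm s (1 / 2) f ^ 2 = ((2 * Real.pi) ^ 5)⁻¹ * (s⁻¹ * chargeInt s (hat f)) := by
    rw [phiNorm, eLpNorm_multiplier_sq hm, chargeInt, ← integral_const_mul s⁻¹]
    congr 1
    refine integral_congr_ae (Eventually.of_forall fun ξ => ?_)
    simp only [norm_mul, Complex.norm_real, Real.norm_eq_abs, mul_pow, sq_abs, hsq]
    field_simp
  rw [show phiNorm s (1 / 2) f ^ 4 = (phiNorm s (1 / 2) f ^ 2) ^ 2 by ring, h1]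
  field_simp

theorem phiNorm_pow_sub (hs : 0 ≤ s) (hf : f ∈ energySpace s) :
    phiNorm s 1 f ^ 4 - s ^ 2 * phiNorm s (1 / 2) f ^ 4 =
      (((2 * Real.pi) ^ 5)⁻¹) ^ 2 * (energyInt s (hat f) ^ 2 - chargeInt s (hat f) ^ 2) := by
  rw [sq_mul_phiNorm_half_pow_four hs hf,
    show phiNorm s 1 f ^ 4 = (phiNorm s 1 f ^ 2) ^ 2 by ring, phiNorm_one_sq hf]
  ring

theorem energyInt_sq_sub_nonneg (hs : 0 ≤ s) (hf : f ∈ energySpace s) :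
    0 ≤ energyInt s (hat f) ^ 2 - chargeInt s (hat f) ^ 2 := by
  have h1 := chargeInt_nonneg (s := s) (F := hat f) hs
  have h2 := chargeInt_le_energyInt hs hf.1.aestronglyMeasurable_right hf.2
  nlinarith

theorem sNorm_nonneg (hs : 0 ≤ s) (hf : f ∈ energySpace s) : 0 ≤ sNorm s f := by
  rw [sNorm, phiNorm_pow_sub hs hf]
  have := energyInt_sq_sub_nonneg hs hf
  positivity

theorem rpow_quarter_pow_four {x : ℝ} (hx : 0 ≤ x) : (x ^ (1 / 4 : ℝ)) ^ 4 = x := by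
  rw [← Real.rpow_natCast, ← Real.rpow_mul hx]
  norm_num

theorem sNorm_pow_four (hs : 0 ≤ s) (hf : f ∈ energySpace s) : sNorm s f ^ 4 =
    (((2 * Real.pi) ^ 5)⁻¹) ^ 2 * (energyInt s (hat f) ^ 2 - chargeInt s (hat f) ^ 2) := by
  rw [sNorm, phiNorm_pow_sub hs hf, rpow_quarter_pow_four]
  have := energyInt_sq_sub_nonneg hs hf
  positivity

theorem sharpConst_pos : 0 < sharpConst := by
  have := Real.pi_pos
  rw [sharpConst]
  positivity

theorem sharpConst_pow_four : sharpConst ^ 4 = 1 / (24 * Real.pi ^ 2) :=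
  rpow_quarter_pow_four (by positivity)

/-- The origin of the constant: (2π)⁻¹⁴ · 2π²/3 = (2π)⁻¹⁰/(24π²), where (2π)⁻¹⁰ belongs to the
fourth power of the norm. -/
theorem ofReal_sharpConst_mul_pow_four (hs : 0 ≤ s) (hf : f ∈ energySpace s) :
    ENNReal.ofReal (sharpConst * sNorm s f) ^ 4 = (ENNReal.ofReal (2 * Real.pi) ^ 14)⁻¹ *
      ENNReal.ofReal (2 * Real.pi ^ 2 / 3 *
        (energyInt s (hat f) ^ 2 - chargeInt s (hat f) ^ 2)) := by
  have hpi := Real.pi_pos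
  rw [← ENNReal.ofReal_pow (mul_nonneg sharpConst_pos.le (sNorm_nonneg hs hf)), mul_pow,
    sharpConst_pow_four, sNorm_pow_four hs hf, ← ENNReal.ofReal_pow (by positivity),
    ← ENNReal.ofReal_inv_of_pos (by positivity), ← ENNReal.ofReal_mul (by positivity)]
  congr 1
  field_simp
  ring

/-- The sharp Strichartz estimate. -/
theorem eLpNorm_evolution_le (hs : 0 ≤ s) (hf : f ∈ energySpace s) :
    eLpNorm (evolution s f) 4 volume ≤ ENNReal.ofReal (sharpConst * sNorm s f) := by
  have hF : AEStronglyMeasurable (hat f) volume := hf.1.aestronglyMeasurable_right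
  refine (ENNReal.pow_le_pow_left_iff four_ne_zero).1
    ((eLpNorm_evolution_pow_four_le hf).trans ?_)
  rw [ofReal_sharpConst_mul_pow_four hs hf, pairEnergy_eq hs hF hf.2]
  gcongr
  exact integral_pairWeight_le hs hF hf.2

/-- For positive `s` there are no maximisers. -/
theorem eLpNorm_evolution_ne (hs : 0 < s) (hf : f ∈ energySpace s) (h0 : ¬ f =ᵐ[volume] 0) :
    eLpNorm (evolution s f) 4 volume ≠ ENNReal.ofReal (sharpConst * sNorm s f) := by
  have hF : AEStronglyMeasurable (hat f) volume := hf.1.aestronglyMeasurable_right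
  have hF0 : ¬ hat f =ᵐ[volume] 0 := fun h =>
    h0 ((hf.1.congr_right h).unique_left IsFourierTransform.zero)
  intro heq
  have h1 := eLpNorm_evolution_pow_four_le hf
  rw [heq, ofReal_sharpConst_mul_pow_four hs.le hf, pairEnergy_eq hs.le hF hf.2] at h1
  have hlt := integral_pairWeight_lt hs hF hf.2 hF0
  have h2 : ENNReal.ofReal (2 * Real.pi) ^ 14 ≠ 0 :=
    pow_ne_zero _ (ENNReal.ofReal_pos.2 (by positivity)).ne'
  rw [ENNReal.mul_le_mul_iff_right (ENNReal.inv_ne_zero.2 (ENNReal.pow_ne_top ENNReal.ofReal_ne_top))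
    (ENNReal.inv_ne_top.2 h2)] at h1
  have h3 : 0 ≤ ∫ p, pairWeight s (hat f) p := integral_nonneg fun p => pairWeight_nonneg p
  exact hlt.not_ge ((ENNReal.ofReal_le_ofReal_iff h3).1 h1)

end Norms

end KleinGordon

/-! ### Behaviour under null sets and scalar multiples -/

namespace KleinGordon

theorem energyInt_congr {s : ℝ} {F G : E → ℂ} (h : F =ᵐ[volume] G) :
    energyInt s F = energyInt s G :=
  integral_congr_ae (by filter_upwards [h] with ξ hξ; rw [hξ])

theorem chargeInt_congr {s : ℝ} {F G : E → ℂ} (h : F =ᵐ[volume] G) :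
    chargeInt s F = chargeInt s G :=
  integral_congr_ae (by filter_upwards [h] with ξ hξ; rw [hξ])

theorem energyInt_const_mul (s : ℝ) (c : ℂ) (F : E → ℂ) :
    energyInt s (fun ξ => c * F ξ) = ‖c‖ ^ 2 * energyInt s F := by
  rw [energyInt, energyInt, ← integral_const_mul]
  refine integral_congr_ae (Eventually.of_forall fun ξ => ?_)
  simp only [norm_mul]
  ring

theorem chargeInt_const_mul (s : ℝ) (c : ℂ) (F : E → ℂ) :
    chargeInt s (fun ξ => c * F ξ) = ‖c‖ ^ 2 * chargeInt s F := by
  rw [chargeInt, chargeInt, ← integral_const_mul]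
  refine integral_congr_ae (Eventually.of_forall fun ξ => ?_)
  simp only [norm_mul]
  ring

theorem freeWave_const_mul (s : ℝ) (c : ℂ) (F : E → ℂ) :
    freeWave s (fun ξ => c * F ξ) = c • freeWave s F := by
  funext q
  simp only [Pi.smul_apply, smul_eq_mul, freeWave_eq, mul_assoc, integral_const_mul]
  ring

theorem mem_energySpace_of_isFourierTransform {s : ℝ} {f F : E → ℂ} (h : IsFourierTransform f F)
    (hF : MemLp (fun ξ => ((phi s ‖ξ‖ : ℝ) : ℂ) * F ξ) 2 volume) : f ∈ energySpace s := by
  refine ⟨h.hat, (memLp_congr_ae ?_).2 hF⟩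
  filter_upwards [h.hat_ae_eq] with ξ hξ
  rw [hξ]

/-! ### The maximising family -/

section Maximisers

variable {s a : ℝ}

theorem isFourierTransform_fa (s : ℝ) (ha : 0 < a) : IsFourierTransform (fa s a) (faHat s a) :=
  isFourierTransform_invFourierIntegral (integrable_faHat s ha)

theorem memLp_phi_mul_faHat (s : ℝ) (ha : 0 < a) :
    MemLp (fun ξ => ((phi s ‖ξ‖ : ℝ) : ℂ) * faHat s a ξ) 2 volume := by
  have hφ := continuous_phi_norm s
  have hc : Continuous fun ξ : E => ((phi s ‖ξ‖ : ℝ) : ℂ) := Complex.continuous_ofReal.comp hφ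
  refine ⟨hc.aestronglyMeasurable.mul (integrable_faHat s ha).1, ?_⟩
  have h := lintegral_phi_mul_faHat_ne_top s ha
  rw [lintegral_enorm_sq_eq_eLpNorm] at h
  exact lt_top_iff_ne_top.2 fun h' => h (by rw [h']; simp)

theorem fa_mem_energySpace (s : ℝ) (ha : 0 < a) : fa s a ∈ energySpace s :=
  mem_energySpace_of_isFourierTransform (isFourierTransform_fa s ha) (memLp_phi_mul_faHat s ha)

theorem norm_faHat (s a : ℝ) (ξ : E) :
    ‖faHat s a ξ‖ = Real.exp (-(a * phi s ‖ξ‖)) / phi s ‖ξ‖ := by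
  rw [faHat, Complex.norm_real, Real.norm_of_nonneg]
  exact div_nonneg (Real.exp_pos _).le (phi_nonneg _ _)

theorem energyInt_faHat (s a : ℝ) :
    energyInt s (faHat s a) = ∫ ξ : E, Real.exp (-(2 * a * phi s ‖ξ‖)) := by
  refine integral_congr_ae ?_
  filter_upwards [ae_phi_pos s] with ξ hξ
  rw [norm_faHat, div_pow, mul_div_cancel₀ _ (by positivity), ← Real.exp_nat_mul]
  push_cast
  ring_nf

theorem chargeInt_faHat (s a : ℝ) :
    chargeInt s (faHat s a) = ∫ ξ : E, s / phi s ‖ξ‖ * Real.exp (-(2 * a * phi s ‖ξ‖)) := by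
  refine integral_congr_ae ?_
  filter_upwards [ae_phi_pos s] with ξ hξ
  have : Real.exp (-(2 * a * phi s ‖ξ‖)) = Real.exp (-(a * phi s ‖ξ‖)) ^ 2 := by
    rw [← Real.exp_nat_mul]
    push_cast
    ring_nf
  rw [norm_faHat, this]
  field_simp

/-- The profile is even, so nothing is lost when |V|² is dropped. -/
theorem momentumInt_faHat (s a : ℝ) : momentumInt s (faHat s a) = 0 := by
  have h : momentumInt s (faHat s a) = -momentumInt s (faHat s a) := by
    conv_lhs => rw [momentumInt, ← integral_neg_eq_self]
    rw [momentumInt, ← integral_neg]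
    simp only [norm_faHat, norm_neg, smul_neg]
  have h2 : (2 : ℝ) • momentumInt s (faHat s a) = 0 := by
    rw [two_smul]
    nth_rewrite 1 [h]
    exact neg_add_cancel _
  exact (smul_eq_zero.1 h2).resolve_left two_ne_zero

theorem integrable_exp_neg_phi (s : ℝ) (ha : 0 < a) :
    Integrable fun ξ : E => Real.exp (-(2 * a * phi s ‖ξ‖)) := by
  simpa using integrable_exp_neg_phi_div s (show 0 < 2 * a by positivity) (m := 0) (by norm_num)

/-- Strictness comes from s < φ_s away from the origin. It makes the normalisation in `ga` a
division by a positive number. -/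
theorem chargeInt_lt_energyInt_faHat (hs : 0 ≤ s) (ha : 0 < a) :
    chargeInt s (faHat s a) < energyInt s (faHat s a) := by
  have hm := (integrable_faHat s ha).1
  have h1 := integrable_charge hs hm (memLp_phi_mul_faHat s ha)
  have h2 := integrable_energy (memLp_phi_mul_faHat s ha)
  refine lt_of_le_of_ne (chargeInt_le_energyInt hs hm (memLp_phi_mul_faHat s ha)) fun heq => ?_
  have hle : ∀ ξ : E, s * phi s ‖ξ‖ * ‖faHat s a ξ‖ ^ 2 ≤ phi s ‖ξ‖ ^ 2 * ‖faHat s a ξ‖ ^ 2 := by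
    intro ξ
    have h0 := phi_nonneg s ‖ξ‖
    rw [sq (phi s ‖ξ‖)]
    gcongr
    exact le_phi
  have hae := (integral_eq_iff_of_ae_le h1 h2 (Eventually.of_forall hle)).1 heq
  have hF : ∀ᵐ ξ : E, False := by
    filter_upwards [hae, Measure.ae_ne volume (0 : E)] with ξ hξ hξ0
    have hpos : 0 < phi s ‖ξ‖ := phi_pos_of_ne (norm_ne_zero_iff.2 hξ0)
    have hlt : s < phi s ‖ξ‖ := by
      refine Real.lt_sqrt_of_sq_lt ?_
      have := sq_pos_of_pos (norm_pos_iff.2 hξ0)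
      linarith
    have hn : 0 < ‖faHat s a ξ‖ := by rw [norm_faHat]; positivity
    have : s * phi s ‖ξ‖ * ‖faHat s a ξ‖ ^ 2 < phi s ‖ξ‖ ^ 2 * ‖faHat s a ξ‖ ^ 2 := by
      rw [sq (phi s ‖ξ‖)]
      gcongr
    exact this.ne hξ
  rw [ae_iff] at hF
  simp at hF

theorem energyInt_faHat_sq_sub_pos (hs : 0 ≤ s) (ha : 0 < a) :
    0 < energyInt s (faHat s a) ^ 2 - chargeInt s (faHat s a) ^ 2 := by
  have h1 := chargeInt_lt_energyInt_faHat hs ha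
  have h2 := chargeInt_nonneg (F := faHat s a) hs
  nlinarith

theorem sNorm_fa_pow_four (hs : 0 ≤ s) (ha : 0 < a) : sNorm s (fa s a) ^ 4 =
    (((2 * Real.pi) ^ 5)⁻¹) ^ 2 *
      (energyInt s (faHat s a) ^ 2 - chargeInt s (faHat s a) ^ 2) := by
  rw [sNorm_pow_four hs (fa_mem_energySpace s ha),
    energyInt_congr (isFourierTransform_fa s ha).hat_ae_eq,
    chargeInt_congr (isFourierTransform_fa s ha).hat_ae_eq]

theorem sNorm_fa_pos (hs : 0 ≤ s) (ha : 0 < a) : 0 < sNorm s (fa s a) := by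
  refine lt_of_le_of_ne (sNorm_nonneg hs (fa_mem_energySpace s ha)) fun h => ?_
  have h1 := sNorm_fa_pow_four hs ha
  have h2 := energyInt_faHat_sq_sub_pos hs ha
  rw [← h, zero_pow four_ne_zero] at h1
  have : 0 < (((2 * Real.pi) ^ 5)⁻¹) ^ 2 *
      (energyInt s (faHat s a) ^ 2 - chargeInt s (faHat s a) ^ 2) := by positivity
  exact this.ne h1

theorem ga_eq (s a : ℝ) : ga s a = fun x => ((sNorm s (fa s a) : ℝ) : ℂ)⁻¹ * fa s a x := by
  funext x
  rw [ga, div_eq_inv_mul]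

theorem isFourierTransform_ga (s : ℝ) (ha : 0 < a) : IsFourierTransform (ga s a)
    (fun ξ => ((sNorm s (fa s a) : ℝ) : ℂ)⁻¹ * faHat s a ξ) := by
  rw [ga_eq]
  exact (isFourierTransform_fa s ha).const_mul _

theorem ga_mem_energySpace (s : ℝ) (ha : 0 < a) : ga s a ∈ energySpace s := by
  refine mem_energySpace_of_isFourierTransform (isFourierTransform_ga s ha) ?_
  refine (memLp_congr_ae (Eventually.of_forall fun ξ => ?_)).1
    ((memLp_phi_mul_faHat s ha).const_mul ((sNorm s (fa s a) : ℝ) : ℂ)⁻¹)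
  ring

theorem norm_inv_sNorm_fa (hs : 0 ≤ s) (ha : 0 < a) :
    ‖((sNorm s (fa s a) : ℝ) : ℂ)⁻¹‖ = (sNorm s (fa s a))⁻¹ := by
  rw [norm_inv, Complex.norm_real, Real.norm_of_nonneg (sNorm_fa_pos hs ha).le]

theorem energyInt_hat_ga (hs : 0 ≤ s) (ha : 0 < a) : energyInt s (hat (ga s a)) =
    (sNorm s (fa s a))⁻¹ ^ 2 * energyInt s (faHat s a) := by
  rw [energyInt_congr (isFourierTransform_ga s ha).hat_ae_eq, energyInt_const_mul,
    norm_inv_sNorm_fa hs ha]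

theorem sNorm_ga (hs : 0 ≤ s) (ha : 0 < a) : sNorm s (ga s a) = 1 := by
  have hpos := sNorm_fa_pos hs ha
  have h1 : sNorm s (ga s a) ^ 4 = 1 := by
    rw [sNorm_pow_four hs (ga_mem_energySpace s ha), energyInt_hat_ga hs ha,
      chargeInt_congr (isFourierTransform_ga s ha).hat_ae_eq, chargeInt_const_mul,
      norm_inv_sNorm_fa hs ha]
    have h2 := sNorm_fa_pow_four hs ha
    calc _ = ((((2 * Real.pi) ^ 5)⁻¹) ^ 2 *
        (energyInt s (faHat s a) ^ 2 - chargeInt s (faHat s a) ^ 2)) *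
          (sNorm s (fa s a))⁻¹ ^ 4 := by ring
      _ = 1 := by rw [← h2, ← mul_pow, mul_inv_cancel₀ hpos.ne', one_pow]
  exact (pow_eq_one_iff_of_nonneg (sNorm_nonneg hs (ga_mem_energySpace s ha)) four_ne_zero).1 h1

theorem eLpNorm_evolution_ga_le (hs : 0 ≤ s) (ha : 0 < a) :
    eLpNorm (evolution s (ga s a)) 4 volume ≤ ENNReal.ofReal sharpConst := by
  have h := eLpNorm_evolution_le hs (ga_mem_energySpace s ha)
  rwa [sNorm_ga hs ha, mul_one] at h

/-- The ratio of charge to energy of the profile `e^{-aφ_s}/φ_s`. -/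
noncomputable def chargeRatio (s a : ℝ) : ℝ :=
  chargeInt s (faHat s a) / energyInt s (faHat s a)

theorem energyInt_faHat_pos (hs : 0 ≤ s) (ha : 0 < a) : 0 < energyInt s (faHat s a) :=
  (chargeInt_nonneg hs).trans_lt (chargeInt_lt_energyInt_faHat hs ha)

theorem chargeRatio_nonneg (hs : 0 ≤ s) (ha : 0 < a) : 0 ≤ chargeRatio s a :=
  div_nonneg (chargeInt_nonneg hs) (energyInt_faHat_pos hs ha).le

theorem chargeRatio_lt_one (hs : 0 ≤ s) (ha : 0 < a) : chargeRatio s a < 1 :=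
  (div_lt_one (energyInt_faHat_pos hs ha)).2 (chargeInt_lt_energyInt_faHat hs ha)

/-- Equality in the bilinear bound and zero momentum leave only the loss in the kernel, measured by
(A² − 3B²)/(A² − B²). -/
theorem le_eLpNorm_evolution_ga_pow_four (hs : 0 ≤ s) (ha : 0 < a) :
    ENNReal.ofReal (sharpConst ^ 4 *
      ((1 - 3 * chargeRatio s a ^ 2) / (1 - chargeRatio s a ^ 2))) ≤
      eLpNorm (evolution s (ga s a)) 4 volume ^ 4 := by
  have hpos := sNorm_fa_pos hs ha
  have hpi := Real.pi_pos
  have hA := energyInt_faHat_pos hs ha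
  have hAB := energyInt_faHat_sq_sub_pos hs ha
  have hm := (integrable_faHat s ha).1
  have h2 := memLp_phi_mul_faHat s ha
  have hlow := le_integral_pairWeight hs hm h2 (momentumInt_faHat s a)
  have hev := evolution_ae_eq_freeWave (ga_mem_energySpace s ha)
    ((integrable_faHat s ha).const_mul _) (isFourierTransform_ga s ha).hat_ae_eq
  have hinv : ‖((sNorm s (fa s a) : ℝ) : ℂ)⁻¹‖ₑ = ENNReal.ofReal (sNorm s (fa s a))⁻¹ := by
    rw [← ofReal_norm, norm_inv_sNorm_fa hs ha]
  rw [eLpNorm_congr_ae hev, freeWave_const_mul, eLpNorm_const_smul, mul_pow,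
    ← lintegral_enorm_pow_four_eq_eLpNorm, lintegral_freeWave_faHat s ha,
    pairEnergy_eq hs hm h2, hinv, ← ENNReal.ofReal_pow (by positivity),
    ← ENNReal.ofReal_pow (by positivity), ← ENNReal.ofReal_inv_of_pos (by positivity),
    ← ENNReal.ofReal_mul (by positivity), ← ENNReal.ofReal_mul (by positivity)]
  refine ENNReal.ofReal_le_ofReal ?_
  calc _ = (sNorm s (fa s a))⁻¹ ^ 4 * (((2 * Real.pi) ^ 14)⁻¹ * (2 * Real.pi ^ 2 / 3 *
        (energyInt s (faHat s a) ^ 2 - 3 * chargeInt s (faHat s a) ^ 2))) := by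
        have hne : 1 - chargeRatio s a ^ 2 ≠ 0 := by
          have h3 := chargeRatio_nonneg hs ha
          have h4 := chargeRatio_lt_one hs ha
          nlinarith
        rw [inv_pow, sNorm_fa_pow_four hs ha, sharpConst_pow_four]
        rw [chargeRatio] at *
        generalize energyInt s (faHat s a) = A at *
        generalize chargeInt s (faHat s a) = B at *
        have e1 : 1 - (B / A) ^ 2 = (A ^ 2 - B ^ 2) / A ^ 2 := by field_simp
        have e2 : 1 - 3 * (B / A) ^ 2 = (A ^ 2 - 3 * B ^ 2) / A ^ 2 := by field_simp
        rw [e1, e2]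
        have := hAB.ne'
        field_simp
        ring
    _ ≤ _ := by gcongr

/-- On a fixed ball the integrand tends uniformly to 1, so the energy eventually exceeds any number
below the volume of that ball. -/
theorem tendsto_energyInt_faHat (s : ℝ) :
    Tendsto (fun a => energyInt s (faHat s a)) (𝓝[>] 0) atTop := by
  refine tendsto_atTop.2 fun b => ?_
  have hvol : Tendsto (fun n : ℕ => (n : ℝ) ^ 5 * volume.real (Metric.ball (0 : E) 1)) atTop
      atTop := by
    refine Tendsto.atTop_mul_const ?_ ?_
    · exact ENNReal.toReal_pos (Metric.measure_ball_pos volume _ one_pos).ne'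
        measure_ball_lt_top.ne
    · exact (tendsto_pow_atTop (by norm_num)).comp tendsto_natCast_atTop_atTop
  obtain ⟨n, hn⟩ := (hvol.eventually (eventually_gt_atTop b)).exists
  set v := (n : ℝ) ^ 5 * volume.real (Metric.ball (0 : E) 1) with hv
  have hlim : Tendsto (fun a : ℝ => Real.exp (-(2 * a * phi s n)) * v) (𝓝[>] 0) (𝓝 v) := by
    have : Continuous fun a : ℝ => Real.exp (-(2 * a * phi s n)) * v := by fun_prop
    refine (tendsto_nhdsWithin_of_tendsto_nhds (this.tendsto 0)).trans (by simp)
  filter_upwards [hlim.eventually (eventually_gt_nhds hn), self_mem_nhdsWithin] with a h1 ha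
  refine h1.le.trans ?_
  rw [energyInt_faHat]
  have hi := integrable_exp_neg_phi s (show 0 < a from ha)
  calc Real.exp (-(2 * a * phi s n)) * v
      = ∫ ξ in Metric.closedBall (0 : E) n, Real.exp (-(2 * a * phi s n)) := by
        rw [setIntegral_const, smul_eq_mul, measureReal_def,
          Measure.addHaar_closedBall _ _ (by positivity), finrank_euclideanSpace, Fintype.card_fin,
          ENNReal.toReal_mul, ENNReal.toReal_ofReal (by positivity), hv, measureReal_def, mul_comm]
    _ ≤ ∫ ξ in Metric.closedBall (0 : E) n, Real.exp (-(2 * a * phi s ‖ξ‖)) := by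
        refine setIntegral_mono_on ?_ hi.integrableOn Metric.isClosed_closedBall.measurableSet
          fun ξ hξ => ?_
        · exact integrableOn_const (isCompact_closedBall _ _).measure_lt_top.ne
        · have hξ' : ‖ξ‖ ≤ n := by simpa using hξ
          have : phi s ‖ξ‖ ≤ phi s n := by unfold phi; gcongr
          have ha' : 0 < a := ha
          gcongr
    _ ≤ _ := setIntegral_le_integral hi (Eventually.of_forall fun ξ => (Real.exp_pos _).le)

/-- Where φ > M the charge density is at most s/M times that of the energy; where φ ≤ M it is at
most 1 on a ball of radius M, uniformly in a. -/
theorem chargeInt_faHat_le (hs : 0 ≤ s) (ha : 0 < a) {M : ℝ} (hM : 0 < M) :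
    chargeInt s (faHat s a) ≤
      s / M * energyInt s (faHat s a) + volume.real (Metric.closedBall (0 : E) M) := by
  have hi := integrable_exp_neg_phi s ha
  have hc : Integrable ((Metric.closedBall (0 : E) M).indicator (1 : E → ℝ)) :=
    (integrable_indicator_iff Metric.isClosed_closedBall.measurableSet).2
      (integrableOn_const (isCompact_closedBall _ _).measure_lt_top.ne)
  rw [chargeInt_faHat, energyInt_faHat, ← integral_const_mul,
    ← integral_indicator_one Metric.isClosed_closedBall.measurableSet,
    ← integral_add (hi.const_mul _) hc]
  refine integral_mono_of_nonneg (Eventually.of_forall fun ξ => ?_) ((hi.const_mul _).add hc)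
    (Eventually.of_forall fun ξ => ?_)
  · exact mul_nonneg (div_nonneg hs (phi_nonneg _ _)) (Real.exp_pos _).le
  · simp only
    rcases le_or_gt (phi s ‖ξ‖) M with h | h
    · have hmem : ξ ∈ Metric.closedBall (0 : E) M := by
        simpa using le_phi_right.trans h
      rw [Set.indicator_of_mem hmem]
      have h1 : s / phi s ‖ξ‖ ≤ 1 := div_le_one_of_le₀ le_phi (phi_nonneg _ _)
      have h2 : Real.exp (-(2 * a * phi s ‖ξ‖)) ≤ 1 := by
        have := phi_nonneg s ‖ξ‖
        exact Real.exp_le_one_iff.2 (by have : 0 ≤ 2 * a * phi s ‖ξ‖ := by positivity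
                                        linarith)
      have h3 : 0 ≤ s / M * Real.exp (-(2 * a * phi s ‖ξ‖)) := by positivity
      have h4 : s / phi s ‖ξ‖ * Real.exp (-(2 * a * phi s ‖ξ‖)) ≤ 1 :=
        mul_le_one₀ h1 (Real.exp_pos _).le h2
      simp only [Pi.one_apply]
      linarith
    · have h1 : s / phi s ‖ξ‖ * Real.exp (-(2 * a * phi s ‖ξ‖)) ≤
          s / M * Real.exp (-(2 * a * phi s ‖ξ‖)) := by gcongr
      have h2 : 0 ≤ (Metric.closedBall (0 : E) M).indicator (1 : E → ℝ) ξ :=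
        Set.indicator_nonneg (fun _ _ => zero_le_one) ξ
      linarith

theorem tendsto_chargeRatio (hs : 0 ≤ s) : Tendsto (chargeRatio s) (𝓝[>] 0) (𝓝 0) := by
  refine tendsto_order.2 ⟨fun b hb => ?_, fun b hb => ?_⟩
  · filter_upwards [self_mem_nhdsWithin] with a ha using hb.trans_le (chargeRatio_nonneg hs ha)
  -- This gives s/M < b/2, and the summand 1 keeps M positive when s = 0. The energy is then taken
  -- large enough for the volume term to cost less than another b/2.
  · set M := (2 * s + 1) / b with hM
    have hM0 : 0 < M := by positivity
    have hsM : s / M < b / 2 := by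
      rw [hM, div_div_eq_mul_div, div_lt_div_iff₀ (by positivity) (by positivity)]
      nlinarith
    filter_upwards [self_mem_nhdsWithin, (tendsto_energyInt_faHat s).eventually
      (eventually_gt_atTop (2 * volume.real (Metric.closedBall (0 : E) M) / b))] with a ha hA
    have hA0 := energyInt_faHat_pos hs (show 0 < a from ha)
    have h1 := chargeInt_faHat_le hs ha hM0
    rw [chargeRatio, div_lt_iff₀ hA0]
    rw [div_lt_iff₀ hb] at hA
    nlinarith

theorem tendsto_eLpNorm_evolution_ga (hs : 0 ≤ s) :
    Tendsto (fun a : ℝ => eLpNorm (evolution s (ga s a)) 4 volume) (𝓝[>] 0)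
      (𝓝 (ENNReal.ofReal sharpConst)) := by
  have hq := tendsto_chargeRatio hs
  have h1 : Tendsto (fun a => ENNReal.ofReal (sharpConst ^ 4 *
      ((1 - 3 * chargeRatio s a ^ 2) / (1 - chargeRatio s a ^ 2)))) (𝓝[>] 0)
      (𝓝 (ENNReal.ofReal (sharpConst ^ 4))) := by
    refine (ENNReal.continuous_ofReal.tendsto _).comp ?_
    have h2 : Tendsto (fun a => sharpConst ^ 4 *
        ((1 - 3 * chargeRatio s a ^ 2) / (1 - chargeRatio s a ^ 2))) (𝓝[>] 0)
        (𝓝 (sharpConst ^ 4 * ((1 - 3 * 0 ^ 2) / (1 - 0 ^ 2)))) :=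
      (((hq.pow 2).const_mul 3).const_sub 1 |>.div ((hq.pow 2).const_sub 1)
        (by norm_num)).const_mul _
    simpa using h2
  have h4 : Tendsto (fun a : ℝ => eLpNorm (evolution s (ga s a)) 4 volume ^ 4) (𝓝[>] 0)
      (𝓝 (ENNReal.ofReal (sharpConst ^ 4))) := by
    refine tendsto_of_tendsto_of_tendsto_of_le_of_le' h1 tendsto_const_nhds ?_ ?_
    · filter_upwards [self_mem_nhdsWithin] with a ha using le_eLpNorm_evolution_ga_pow_four hs ha
    · filter_upwards [self_mem_nhdsWithin] with a ha
      rw [ENNReal.ofReal_pow sharpConst_pos.le]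
      gcongr
      exact eLpNorm_evolution_ga_le hs ha
  have h5 := h4.ennrpow_const (1 / 4 : ℝ)
  have hroot : ∀ x : ℝ≥0∞, (x ^ 4) ^ (1 / 4 : ℝ) = x := fun x => by
    rw [← ENNReal.rpow_natCast, ← ENNReal.rpow_mul]
    norm_num
  rw [ENNReal.ofReal_pow sharpConst_pos.le] at h5
  simpa only [hroot] using h5

/-- The constant in the Strichartz estimate is best possible. -/
theorem isLeast_sharpConst (hs : 0 ≤ s) :
    IsLeast {C : ℝ | ∀ f ∈ energySpace s,
      eLpNorm (evolution s f) 4 volume ≤ ENNReal.ofReal (C * sNorm s f)} sharpConst := by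
  refine ⟨fun f hf => eLpNorm_evolution_le hs hf, fun C hC => ?_⟩
  have hle : ENNReal.ofReal sharpConst ≤ ENNReal.ofReal C := by
    refine le_of_tendsto (tendsto_eLpNorm_evolution_ga hs) ?_
    filter_upwards [self_mem_nhdsWithin] with a ha
    have := hC _ (ga_mem_energySpace s ha)
    rwa [sNorm_ga hs ha, mul_one] at this
  -- Positivity of `sharpConst` makes `ENNReal.ofReal` strictly monotone at this comparison, so
  -- negative `C` is excluded too.
  by_contra! hlt
  exact hle.not_gt ((ENNReal.ofReal_lt_ofReal_iff sharpConst_pos).2 hlt)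

end Maximisers

/-! ### Inhomogeneous Sobolev norms -/

theorem sobolevNorm_one (f : E → ℂ) : sobolevNorm 1 f = phiNorm 1 1 f := by
  have : ∀ ξ : E, (1 + ‖ξ‖ ^ 2) ^ ((1 : ℝ) / 2) = phi 1 ‖ξ‖ ^ (1 : ℝ) := fun ξ => by
    rw [Real.rpow_one, phi, Real.sqrt_eq_rpow, one_pow]
  simp only [sobolevNorm, phiNorm, this]

theorem sobolevNorm_half (f : E → ℂ) : sobolevNorm (1 / 2) f = phiNorm 1 (1 / 2) f := by
  have : ∀ ξ : E, (1 + ‖ξ‖ ^ 2) ^ ((1 / 2 : ℝ) / 2) = phi 1 ‖ξ‖ ^ (1 / 2 : ℝ) := fun ξ => by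
    rw [phi, Real.sqrt_eq_rpow, one_pow, ← Real.rpow_mul (by positivity)]
    norm_num
  simp only [sobolevNorm, phiNorm, this]

theorem sNorm_one_eq (f : E → ℂ) :
    sNorm 1 f = (sobolevNorm 1 f ^ 4 - sobolevNorm (1 / 2) f ^ 4) ^ (1 / 4 : ℝ) := by
  rw [sNorm, sobolevNorm_one, sobolevNorm_half, one_pow, one_mul]

theorem phiNorm_nonneg (s β : ℝ) (f : E → ℂ) : 0 ≤ phiNorm s β f := ENNReal.toReal_nonneg

theorem sNorm_le_phiNorm {s : ℝ} (hs : 0 ≤ s) {f : E → ℂ} (hf : f ∈ energySpace s) :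
    sNorm s f ≤ phiNorm s 1 f := by
  refine (pow_le_pow_iff_left₀ (sNorm_nonneg hs hf) (phiNorm_nonneg _ _ _) four_ne_zero).1 ?_
  have h0 : 0 ≤ phiNorm s 1 f ^ 4 - s ^ 2 * phiNorm s (1 / 2) f ^ 4 := by
    rw [phiNorm_pow_sub hs hf]
    have := energyInt_sq_sub_nonneg hs hf
    positivity
  rw [sNorm, rpow_quarter_pow_four h0]
  have := phiNorm_nonneg s (1 / 2) f
  have : 0 ≤ s ^ 2 * phiNorm s (1 / 2) f ^ 4 := by positivity
  linarith

/-- Normalising A² − B² to 1 makes A² equal to 1/(1 − (B/A)²), up to the common Plancherel factor.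
-/
theorem phiNorm_ga_pow_four {s a : ℝ} (hs : 0 ≤ s) (ha : 0 < a) :
    phiNorm s 1 (ga s a) ^ 4 = (1 - chargeRatio s a ^ 2)⁻¹ := by
  have hA := energyInt_faHat_pos hs ha
  have hAB := energyInt_faHat_sq_sub_pos hs ha
  rw [show phiNorm s 1 (ga s a) ^ 4 = (phiNorm s 1 (ga s a) ^ 2) ^ 2 by ring,
    phiNorm_one_sq (ga_mem_energySpace s ha), energyInt_hat_ga hs ha]
  have e : (((2 * Real.pi) ^ 5)⁻¹ * ((sNorm s (fa s a))⁻¹ ^ 2 * energyInt s (faHat s a))) ^ 2 =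
      (((2 * Real.pi) ^ 5)⁻¹) ^ 2 * (sNorm s (fa s a) ^ 4)⁻¹ * energyInt s (faHat s a) ^ 2 := by
    ring
  have hpi := Real.pi_pos
  rw [e, sNorm_fa_pow_four hs ha, chargeRatio]
  generalize energyInt s (faHat s a) = A at *
  generalize chargeInt s (faHat s a) = B at *
  have e1 : 1 - (B / A) ^ 2 = (A ^ 2 - B ^ 2) / A ^ 2 := by field_simp
  have := hAB.ne'
  rw [e1]
  field_simp

theorem tendsto_phiNorm_ga {s : ℝ} (hs : 0 ≤ s) :
    Tendsto (fun a => phiNorm s 1 (ga s a)) (𝓝[>] 0) (𝓝 1) := by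
  have h1 : Tendsto (fun a => ((1 - chargeRatio s a ^ 2)⁻¹) ^ (1 / 4 : ℝ)) (𝓝[>] 0)
      (𝓝 (((1 - 0 ^ 2)⁻¹) ^ (1 / 4 : ℝ))) :=
    (((tendsto_chargeRatio hs).pow 2).const_sub 1 |>.inv₀ (by norm_num)).rpow_const
      (Or.inr (by norm_num))
  have h2 : (((1 : ℝ) - 0 ^ 2)⁻¹) ^ (1 / 4 : ℝ) = 1 := by norm_num
  rw [h2] at h1
  refine h1.congr' ?_
  filter_upwards [self_mem_nhdsWithin] with a ha
  rw [← phiNorm_ga_pow_four hs ha, ← Real.rpow_natCast,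
    ← Real.rpow_mul (phiNorm_nonneg _ _ _)]
  norm_num

/-- The subtracted term tends to zero along the maximising family, so discarding it does not change
the best constant. -/
theorem isLeast_sharpConst_phiNorm {s : ℝ} (hs : 0 ≤ s) :
    IsLeast {C : ℝ | ∀ f ∈ energySpace s,
      eLpNorm (evolution s f) 4 volume ≤ ENNReal.ofReal (C * phiNorm s 1 f)} sharpConst := by
  refine ⟨fun f hf => (eLpNorm_evolution_le hs hf).trans (ENNReal.ofReal_le_ofReal
    (mul_le_mul_of_nonneg_left (sNorm_le_phiNorm hs hf) sharpConst_pos.le)), fun C hC => ?_⟩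
  have hlim : Tendsto (fun a => ENNReal.ofReal (C * phiNorm s 1 (ga s a))) (𝓝[>] 0)
      (𝓝 (ENNReal.ofReal C)) := by
    refine (ENNReal.continuous_ofReal.tendsto _).comp ?_
    simpa using (tendsto_phiNorm_ga hs).const_mul C
  have hle : ENNReal.ofReal sharpConst ≤ ENNReal.ofReal C := by
    refine le_of_tendsto_of_tendsto (tendsto_eLpNorm_evolution_ga hs) hlim ?_
    filter_upwards [self_mem_nhdsWithin] with a ha using hC _ (ga_mem_energySpace s ha)
  by_contra! hlt
  exact hle.not_gt ((ENNReal.ofReal_lt_ofReal_iff sharpConst_pos).2 hlt)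

end KleinGordon

theorem corollary2 :
    (∀ s : ℝ, 0 ≤ s →
      -- the evolution is well defined on the data space
      (∀ f ∈ KleinGordon.energySpace s,
        KleinGordon.IsEvolution s f (KleinGordon.evolution s f)) ∧
      -- the estimate holds and its constant is best possible
      IsLeast
        {C : ℝ | ∀ f ∈ KleinGordon.energySpace s,
          eLpNorm (KleinGordon.evolution s f) 4 volume ≤
            ENNReal.ofReal (C * KleinGordon.sNorm s f)}
        KleinGordon.sharpConst ∧
      -- the normalised functions form a maximising sequence
      (∀ a : ℝ, 0 < a →
        KleinGordon.IsFourierTransform (KleinGordon.fa s a) (KleinGordon.faHat s a) ∧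
        KleinGordon.ga s a ∈ KleinGordon.energySpace s ∧
        KleinGordon.sNorm s (KleinGordon.ga s a) = 1) ∧
      Tendsto (fun a : ℝ => eLpNorm (KleinGordon.evolution s (KleinGordon.ga s a)) 4 volume)
        (𝓝[>] 0) (𝓝 (ENNReal.ofReal KleinGordon.sharpConst)) ∧
      -- there are no maximisers for positive `s`
      (0 < s → ∀ f ∈ KleinGordon.energySpace s, ¬ f =ᵐ[volume] 0 →
        eLpNorm (KleinGordon.evolution s f) 4 volume ≠
          ENNReal.ofReal (KleinGordon.sharpConst * KleinGordon.sNorm s f))) ∧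
    -- the case `s = 1`: the sharp estimates in terms of inhomogeneous Sobolev norms
    IsLeast
      {C : ℝ | ∀ f ∈ KleinGordon.energySpace 1,
        eLpNorm (KleinGordon.evolution 1 f) 4 volume ≤
          ENNReal.ofReal (C * (KleinGordon.sobolevNorm 1 f ^ 4 -
            KleinGordon.sobolevNorm (1 / 2) f ^ 4) ^ (1 / 4 : ℝ))}
      KleinGordon.sharpConst ∧
    IsLeast
      {C : ℝ | ∀ f ∈ KleinGordon.energySpace 1,
        eLpNorm (KleinGordon.evolution 1 f) 4 volume ≤
          ENNReal.ofReal (C * KleinGordon.sobolevNorm 1 f)}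
      KleinGordon.sharpConst := by
  refine ⟨fun s hs => ⟨fun f hf => KleinGordon.isEvolution_evolution hf,
    KleinGordon.isLeast_sharpConst hs, fun a ha => ⟨KleinGordon.isFourierTransform_fa s ha,
      KleinGordon.ga_mem_energySpace s ha, KleinGordon.sNorm_ga hs ha⟩,
    KleinGordon.tendsto_eLpNorm_evolution_ga hs,
    fun hs' f hf h0 => KleinGordon.eLpNorm_evolution_ne hs' hf h0⟩, ?_, ?_⟩
  · simpa only [KleinGordon.sNorm_one_eq] using KleinGordon.isLeast_sharpConst zero_le_one
  · simpa only [KleinGordon.sobolevNorm_one] using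
      KleinGordon.isLeast_sharpConst_phiNorm zero_le_one
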